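/- Write $D=-i\,d/dx$, $\langle x\rangle=(1+x^2)^{1/2}$. For $\mu\in\mathbb R$ let $S^\mu(\mathbb R)$ be the space of smooth $f:\mathbb R\to\mathbb C$ such that for every $\alpha\in\mathbb N$ there is $C_\alpha$ with $|f^{(\alpha)}(x)|\le C_\alpha\langle x\rangle^{\mu-\alpha}$ for all $x\in\mathbb R$. For complex numbers $\xi_1,\dots,\xi_n$ and $0\le j\le n$ put $\sigma_j(\xi_1,\dots,\xi_n)=(-1)^j\sum_{i_1<\dots<i_j}\xi_{i_1}\cdots\xi_{i_j}$ ($\sigma_0=1$). Let $r_1,r_2\ge 0$ be integers, $m=r_1+r_2$, and let $P=\sum_{\alpha+\beta\le m}a_{\alpha,\beta}\,x^\beta D^\alpha$ with $a_{\alpha,\beta}\in\mathbb C$ and $a_{m,0}=1$. Put $a(x,\xi)=\sum_{\alpha+\beta\le m} a_{\alpha,\beta}\,x^\beta\xi^\alpha$, and let $$p(x,\xi)=\sum_{\gamma\ge0}\frac1{\gamma!}\Big(-\frac12\Big)^{\gamma}\partial_\xi^\gamma D_x^\gamma a(x,\xi)$$ be the Weyl symbol of $P$; it is a polynomial in $(x,\xi)$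 of degree at most $m$, monic of degree $m$ in $\xi$. Let $\xi_1(x),\dots,\xi_m(x)$ be its roots with respect to $\xi$, i.e. real-analytic complex-valued functions defined for $x$ large such that $p(x,\xi)=\prod_{j=1}^m(\xi-\xi_j(x))$ for $x$ large. Assume that, as $x\to+\infty$, * $\xi_j(x)=O(x)$ for $1\le j\le m$; * $|\xi_j(x)-\xi_k(x)|\gtrsim x$ for $1\le j\le r_1$ and $r_1+1\le k\le m$; * for some $\epsilon>0$, $|\xi_j(x)-\xi_k(x)|\gtrsim\max\{|\xi_j(x)|,|\xi_k(x)|,x^{-1+\epsilon}\}$ for all $j\ne k$ in $\{r_1+1,\dots,m\}$. Then there are functions $\eta_0,\dots,\eta_m$ with $\eta_0=1$, $\eta_j\in S^{j}(\mathbb R)$ for $1\le j\le r_1$, $\eta_j\in S^1(\mathbb R)$ for $r_1+1\le j\le m$, and a differential operator $R=\sum_{k=0}^{m}\rho_k(x)D^{m-k}$, whose coefficients $\rho_k$ belong to $S^m(\mathbb R)$ and are rapidly decreasing as $x\to+\infty$ together with all their derivatives, such that for $x$ large $$P=\Big(\sum_{k=0}^{r_1}\eta_k(x)D^{r_1-k}\Big)\,(D-\eta_{r_1+1}(x))\,(D-\eta_{r_1+2}(x))\cdots(D-\eta_{m}(x))+R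 ,$$ and, as $x\to+\infty$, $$\eta_j(x)=\sigma_j(\xi_1(x),\dots,\xi_{r_1}(x))+O(x^{j-2})\quad(1\le j\le r_1),\qquad \eta_j(x)=\xi_j(x)+O(x^{-1})\quad(r_1+1\le j\le m).$$ -/

import Mathlib

open scoped ContDiff

noncomputable section

namespace WeylODE

/-- The operator `D = -i d/dx` on complex functions of a real variable. -/
def D (u : ℝ → ℂ) : ℝ → ℂ := fun x => -Complex.I * deriv u x

/-- The differential operator `∑_{α,β} a_{α,β} x^β D^α` with standard (left) symbol
`a(x,ξ) = ∑_{α,β} a_{α,β} x^β ξ^α`; the variable with index `0` is `x`, the one with index `1`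
is `ξ`. -/
def stdOp (a : MvPolynomial (Fin 2) ℂ) (u : ℝ → ℂ) : ℝ → ℂ := fun x =>
  ∑ s ∈ a.support, a.coeff s * (x : ℂ) ^ (s 0) * (D^[s 1] u) x

/-- `∂_ξ` on polynomial symbols. -/
def symDξ (a : MvPolynomial (Fin 2) ℂ) : MvPolynomial (Fin 2) ℂ :=
  MvPolynomial.pderiv 1 a

/-- `D_x = -i ∂_x` on polynomial symbols. -/
def symDx (a : MvPolynomial (Fin 2) ℂ) : MvPolynomial (Fin 2) ℂ :=
  MvPolynomial.C (-Complex.I) * MvPolynomial.pderiv 0 a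

/-- The Weyl symbol `∑_{γ ≥ 0} (1/γ!) (-1/2)^γ ∂_ξ^γ D_x^γ a` of the operator with standard
symbol `a` (the terms with `γ` larger than the degree of `a` vanish). -/
def weylSymbol (a : MvPolynomial (Fin 2) ℂ) : MvPolynomial (Fin 2) ℂ :=
  ∑ γ ∈ Finset.range (a.totalDegree + 1),
    MvPolynomial.C ((1 / (γ.factorial : ℂ)) * (-1 / 2) ^ γ) * symDξ^[γ] (symDx^[γ] a)

/-- The differential operator `∑_{k=0}^{n} c_k(x) D^{n-k}`. -/
def diffOp (n : ℕ) (c : ℕ → ℝ → ℂ) (u : ℝ → ℂ) : ℝ → ℂ := fun x =>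
  ∑ k ∈ Finset.range (n + 1), c k x * (D^[n - k] u) x

/-- The first order operator `D - f(x)`. -/
def firstOrder (f : ℝ → ℂ) (u : ℝ → ℂ) : ℝ → ℂ := fun x => D u x - f x * u x

/-- The ordered product `(D - η_{r+1}(x)) (D - η_{r+2}(x)) ⋯ (D - η_{r+n}(x))`
(the rightmost factor acts first). -/
def prodOp (η : ℕ → ℝ → ℂ) (r : ℕ) : ℕ → (ℝ → ℂ) → ℝ → ℂ
  | 0, u => u
  | n + 1, u => prodOp η r n (firstOrder (η (r + n + 1)) u)

/-- The signed elementary symmetric functions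
`σ_j(ξ_1, …, ξ_n) = (-1)^j ∑_{i_1 < ⋯ < i_j} ξ_{i_1} ⋯ ξ_{i_j}`, `σ_0 = 1`. -/
def sigma (n j : ℕ) (ξ : ℕ → ℂ) : ℂ :=
  (-1) ^ j * ∑ t ∈ Finset.powersetCard j (Finset.Icc 1 n), ∏ i ∈ t, ξ i

/-- The class `S^μ(ℝ)`: smooth functions with `|f^{(α)}(x)| ≤ C_α ⟨x⟩^{μ-α}` for all `α` and `x`,
where `⟨x⟩ = (1 + x²)^{1/2}`. -/
def IsSymbol (μ : ℝ) (f : ℝ → ℂ) : Prop :=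
  ContDiff ℝ ∞ f ∧ ∀ α : ℕ, ∃ C : ℝ, ∀ x : ℝ,
    ‖iteratedDeriv α f x‖ ≤ C * Real.sqrt (1 + x ^ 2) ^ (μ - (α : ℝ))

/-- `f` and all its derivatives are rapidly decreasing as `x → +∞`. -/
def RapidlyDecreasing (f : ℝ → ℂ) : Prop :=
  ∀ α N : ℕ, iteratedDeriv α f =O[Filter.atTop] fun x : ℝ => x ^ (-(N : ℤ))

end WeylODE

end

open scoped ContDiff

noncomputable section

namespace WeylODE

open Filter Topology Asymptotics

/-! Dividing an operator of order `N` on the right by `D - w` leaves as remainder the function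
obtained by applying the same operator, with `D` replaced by `D + w`, to the constant `1`. So `D -
w` is a right factor modulo rapidly decreasing terms as soon as `w` solves this Riccati equation
modulo such terms. The proof has three ingredients.

Roots are symbols. Let `z` be one of the roots `ξ_j`, `j > r₁`, and `π = ∂_ξ p(x, z) = ∏_{l ≠ j}
(ξ_j - ξ_l)`. The coefficients `c_n` of `p` are symmetric functions of the roots, and each factor of
`π` dominates `|ξ_j|`, `|ξ_l|` and `x^{-1+ε}`; hence `c_{r+1+e} z^r x^{-e} / π = O(x^{-εe})`. The
logarithmic derivatives of `z`, of `π` and of these ratios are `1/x` times polynomials in the ratios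
with `e = 0` and in symbols of order `0`. Differentiating repeatedly turns the bounds into symbol
estimates (`RootData.sym_ratio`, `RootData.sym_root`).

Riccati equation. Put `w = z + κ/x` with `κ` of order `0`, and expand `(D + w)^n 1 = ∑_l z^{n-l}
x^{-l} T_{n,l}(κ)`. After division by `π/x`, the terms `l = 0` cancel because `z` is a root of `p`,
the terms `l = 1` contribute `κ` plus known functions, and everything else, including the difference
between the standard and the Weyl coefficients, improves differences by `x^{-ε}`. Iteration and
asymptotic summation give an approximate fixed point (`exists_approx_fixed_point`,
`RootData.exists_riccati`).

Successive factors. All the Riccati solutions `W_j` are built for `P` itself. Once `D - w` has been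
divided out, conjugation by `W_j - w` shows that `W_j + (W_j - w)⁻¹ D(W_j - w)` solves the Riccati
equation of the quotient (`rapid_connOp_quot`). The correction is a logarithmic derivative, of order
`-1` by the separation of the roots, so the new solution is still `ξ_j + O(x^{-1})` and the
extraction continues (`exists_factorization`). The coefficients of each quotient stay close to the
symmetric functions of the remaining roots, by comparison with the synthetic division of `∏ (ζ -
ξ_i)`. -/

/-- Smoothness near `+∞`. -/
def EvSmooth (f : ℝ → ℂ) : Prop := ∀ᶠ x in atTop, ContDiffAt ℝ ∞ f x

theorem eventually_atTop_nhds {p : ℝ → Prop} (h : ∀ᶠ x in atTop, p x) :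
    ∀ᶠ x in atTop, ∀ᶠ y in 𝓝 x, p y := by
  obtain ⟨a, ha⟩ := eventually_atTop.1 h
  filter_upwards [eventually_gt_atTop a] with x hx
  filter_upwards [Ioi_mem_nhds hx] with y hy using ha y (le_of_lt hy)

theorem EventuallyEq.deriv_atTop {f g : ℝ → ℂ} (h : f =ᶠ[atTop] g) :
    deriv f =ᶠ[atTop] deriv g := by
  filter_upwards [eventually_atTop_nhds h] with x hx using EventuallyEq.deriv_eq hx

theorem EvSmooth.congr {f g : ℝ → ℂ} (hf : EvSmooth f) (h : f =ᶠ[atTop] g) : EvSmooth g := by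
  filter_upwards [hf, eventually_atTop_nhds h] with x hx hx'
  exact hx.congr_of_eventuallyEq (EventuallyEq.symm hx')

theorem ContDiffAt.deriv_smooth {f : ℝ → ℂ} {x : ℝ} (hf : ContDiffAt ℝ ∞ f x) :
    ContDiffAt ℝ ∞ (deriv f) x := by
  have := hf.fderiv_right (m := ∞) (by simp)
  have h2 : deriv f = fun y => fderiv ℝ f y 1 := by ext y; simp
  rw [h2]
  exact this.clm_apply contDiffAt_const

theorem ContDiff.deriv_smooth {f : ℝ → ℂ} (hf : ContDiff ℝ ∞ f) : ContDiff ℝ ∞ (deriv f) :=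
  contDiff_iff_contDiffAt.2 fun _ => ContDiffAt.deriv_smooth hf.contDiffAt

theorem EvSmooth.derivative {f : ℝ → ℂ} (hf : EvSmooth f) : EvSmooth (deriv f) := by
  filter_upwards [hf] with x hx using ContDiffAt.deriv_smooth hx

theorem EvSmooth.differentiable {f : ℝ → ℂ} (hf : EvSmooth f) :
    ∀ᶠ x in atTop, DifferentiableAt ℝ f x := by
  filter_upwards [hf] with x hx using hx.differentiableAt (by simp)

theorem EvSmooth.add {f g : ℝ → ℂ} (hf : EvSmooth f) (hg : EvSmooth g) : EvSmooth (f + g) := by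
  filter_upwards [hf, hg] with x h1 h2 using h1.add h2

theorem EvSmooth.mul {f g : ℝ → ℂ} (hf : EvSmooth f) (hg : EvSmooth g) : EvSmooth (f * g) := by
  filter_upwards [hf, hg] with x h1 h2 using h1.mul h2

theorem EvSmooth.inv {f : ℝ → ℂ} (hf : EvSmooth f) (h0 : ∀ᶠ x in atTop, f x ≠ 0) :
    EvSmooth f⁻¹ := by
  filter_upwards [hf, h0] with x h1 h2 using h1.inv h2

theorem _root_.ContDiff.evSmooth {f : ℝ → ℂ} (hf : ContDiff ℝ ∞ f) : EvSmooth f :=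
  Eventually.of_forall fun _ => hf.contDiffAt

/-! ### Symbol classes near `+∞` -/

/-- Symbols of order `s` at `+∞`, up to `n` derivatives. -/
def SymN (n : ℕ) (s : ℝ) (f : ℝ → ℂ) : Prop :=
  EvSmooth f ∧ ∀ k ≤ n, iteratedDeriv k f =O[atTop] fun x : ℝ => x ^ (s - k)

/-- Symbols of order `s` at `+∞`. -/
def Sym (s : ℝ) (f : ℝ → ℂ) : Prop := ∀ n, SymN n s f

theorem rpow_isBigO {s t : ℝ} (h : s ≤ t) :
    (fun x : ℝ => x ^ s) =O[atTop] fun x : ℝ => x ^ t := by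
  refine IsBigO.of_bound 1 ?_
  filter_upwards [eventually_ge_atTop 1] with x hx
  have h0 : (0:ℝ) ≤ x := by linarith
  rw [one_mul, Real.norm_of_nonneg (Real.rpow_nonneg h0 _),
    Real.norm_of_nonneg (Real.rpow_nonneg h0 _)]
  exact Real.rpow_le_rpow_of_exponent_le hx h

theorem rpow_mul_isBigO {f g : ℝ → ℂ} {s t : ℝ} (hf : f =O[atTop] fun x : ℝ => x ^ s)
    (hg : g =O[atTop] fun x : ℝ => x ^ t) : (f * g) =O[atTop] fun x : ℝ => x ^ (s + t) := by
  refine (hf.mul hg).congr' (EventuallyEq.refl _ _) ?_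
  filter_upwards [eventually_gt_atTop 0] with x hx
  rw [Real.rpow_add hx]

theorem symN_zero {s : ℝ} {f : ℝ → ℂ} :
    SymN 0 s f ↔ EvSmooth f ∧ f =O[atTop] fun x : ℝ => x ^ s := by
  simp [SymN]

/-- The form in which estimates are bootstrapped: if `f'` is expressed through functions already
controlled up to `n` derivatives, then `f` is controlled up to `n + 1`. -/
theorem symN_succ {n : ℕ} {s : ℝ} {f : ℝ → ℂ} :
    SymN (n + 1) s f ↔ SymN 0 s f ∧ SymN n (s - 1) (deriv f) := by
  constructor
  · rintro ⟨h1, h2⟩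
    refine ⟨⟨h1, fun k hk => h2 k (by omega)⟩, h1.derivative, fun k hk => ?_⟩
    have := h2 (k + 1) (by omega)
    rw [iteratedDeriv_succ'] at this
    convert this using 3
    push_cast; ring
  · rintro ⟨⟨h1, h2⟩, h3, h4⟩
    refine ⟨h1, fun k hk => ?_⟩
    cases k with
    | zero => exact h2 0 le_rfl
    | succ k =>
      have := h4 k (by omega)
      rw [iteratedDeriv_succ']
      convert this using 3
      push_cast; ring

theorem SymN.mono {n k : ℕ} {s t : ℝ} {f : ℝ → ℂ} (h : SymN n s f) (hk : k ≤ n) (hs : s ≤ t) :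
    SymN k t f :=
  ⟨h.1, fun i hi => (h.2 i (hi.trans hk)).trans (rpow_isBigO (by linarith))⟩

theorem SymN.congr {n : ℕ} {s : ℝ} {f g : ℝ → ℂ} (h : SymN n s f) (hfg : f =ᶠ[atTop] g) :
    SymN n s g := by
  refine ⟨h.1.congr hfg, fun k hk => (h.2 k hk).congr' ?_ (EventuallyEq.refl _ _)⟩
  filter_upwards [eventually_atTop_nhds hfg] with x hx
  exact EventuallyEq.iteratedDeriv_eq k hx

theorem SymN.add {n : ℕ} {s : ℝ} {f g : ℝ → ℂ} (hf : SymN n s f) (hg : SymN n s g) :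
    SymN n s (f + g) := by
  refine ⟨hf.1.add hg.1, fun k hk => ?_⟩
  refine ((hf.2 k hk).add (hg.2 k hk)).congr' ?_ (EventuallyEq.refl _ _)
  filter_upwards [hf.1, hg.1] with x h1 h2
  rw [iteratedDeriv_add (h1.of_le (by exact_mod_cast le_top)) (h2.of_le (by exact_mod_cast le_top))]

theorem SymN.mul {n : ℕ} {s t : ℝ} {f g : ℝ → ℂ} (hf : SymN n s f) (hg : SymN n t g) :
    SymN n (s + t) (f * g) := by
  induction n generalizing s t f g with
  | zero =>
    rw [symN_zero] at *
    exact ⟨hf.1.mul hg.1, rpow_mul_isBigO hf.2 hg.2⟩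
  | succ n ih =>
    have hf' := symN_succ.1 hf
    have hg' := symN_succ.1 hg
    refine symN_succ.2 ⟨?_, ?_⟩
    · rw [symN_zero] at *
      exact ⟨hf'.1.1.mul hg'.1.1, rpow_mul_isBigO hf'.1.2 hg'.1.2⟩
    · have h1 := ih hf'.2 (hg.mono (Nat.le_succ n) le_rfl)
      have h2 := ih (hf.mono (Nat.le_succ n) le_rfl) hg'.2
      have h3 : SymN n (s + t - 1) (deriv f * g + f * deriv g) :=
        (h1.mono le_rfl (by linarith)).add (h2.mono le_rfl (by linarith))
      refine h3.congr ?_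
      filter_upwards [hf.1.differentiable, hg.1.differentiable] with x k1 k2
      simp [deriv_mul k1 k2]

theorem SymN.isBigO {n : ℕ} {s : ℝ} {f : ℝ → ℂ} (h : SymN n s f) :
    f =O[atTop] fun x : ℝ => x ^ s := by
  simpa using h.2 0 (Nat.zero_le _)

namespace Sym

variable {s t : ℝ} {f g : ℝ → ℂ}

theorem evSmooth (h : Sym s f) : EvSmooth f := (h 0).1

theorem isBigO (h : Sym s f) : f =O[atTop] fun x : ℝ => x ^ s := (h 0).isBigO

theorem mono (h : Sym s f) (hs : s ≤ t) : Sym t f := fun n => (h n).mono le_rfl hs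

theorem congr (h : Sym s f) (hfg : f =ᶠ[atTop] g) : Sym s g := fun n => (h n).congr hfg

theorem add (hf : Sym s f) (hg : Sym s g) : Sym s (f + g) := fun n => (hf n).add (hg n)

theorem mul (hf : Sym s f) (hg : Sym t g) : Sym (s + t) (f * g) := fun n => (hf n).mul (hg n)

theorem mul_le {r : ℝ} (hf : Sym s f) (hg : Sym t g) (h : s + t ≤ r) : Sym r (f * g) :=
  (hf.mul hg).mono h

theorem derivative (hf : Sym s f) : Sym (s - 1) (deriv f) := fun n => (symN_succ.1 (hf (n + 1))).2

theorem of_deriv (h0 : SymN 0 s f) (h : Sym (s - 1) (deriv f)) : Sym s f := fun n =>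
  (symN_succ.2 ⟨h0, h n⟩).mono (Nat.le_succ n) le_rfl

end Sym

theorem sym_zero (s : ℝ) : Sym s 0 := by
  refine fun n => ⟨contDiff_const.evSmooth, fun k _ => ?_⟩
  have : iteratedDeriv k (0 : ℝ → ℂ) = fun _ => 0 := by
    have : (0 : ℝ → ℂ) = fun _ => 0 := rfl
    ext x; rw [this, iteratedDeriv_const]; simp
  rw [this]
  exact isBigO_zero _ _

theorem sym_const (c : ℂ) : Sym 0 (fun _ => c) := by
  refine Sym.of_deriv ?_ ?_
  · refine symN_zero.2 ⟨contDiff_const.evSmooth, ?_⟩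
    simpa using isBigO_const_const c (one_ne_zero : (1:ℝ) ≠ 0) atTop
  · have : deriv (fun _ : ℝ => c) = 0 := by ext; simp
    rw [this]; exact sym_zero _

theorem sym_one : Sym 0 1 := sym_const 1

theorem Sym.const_mul {s : ℝ} {f : ℝ → ℂ} (hf : Sym s f) (c : ℂ) : Sym s (fun x => c * f x) :=
  ((sym_const c).mul hf).mono (by simp)

theorem Sym.neg {s : ℝ} {f : ℝ → ℂ} (hf : Sym s f) : Sym s (-f) :=
  (hf.const_mul (-1)).congr (Eventually.of_forall fun x => by simp)

theorem Sym.sub {s : ℝ} {f g : ℝ → ℂ} (hf : Sym s f) (hg : Sym s g) : Sym s (f - g) := by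
  rw [sub_eq_add_neg]; exact hf.add hg.neg

theorem Sym.of_sub {s : ℝ} {f g : ℝ → ℂ} (hf : Sym s (f - g)) (hg : Sym s g) : Sym s f := by
  have := hf.add hg
  rwa [sub_add_cancel] at this

theorem Sym.sum {ι : Type*} {S : Finset ι} {s : ℝ} {f : ι → ℝ → ℂ} (h : ∀ i ∈ S, Sym s (f i)) :
    Sym s (∑ i ∈ S, f i) := by
  classical
  induction S using Finset.induction_on with
  | empty => simpa using sym_zero s
  | insert a S ha ih =>
    rw [Finset.sum_insert ha]
    exact (h a (by simp)).add (ih fun i hi => h i (by simp [hi]))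

theorem Sym.fun_sum {ι : Type*} {S : Finset ι} {s : ℝ} {f : ι → ℝ → ℂ}
    (h : ∀ i ∈ S, Sym s (f i)) : Sym s (fun x => ∑ i ∈ S, f i x) :=
  (Sym.sum h).congr (Eventually.of_forall fun x => by simp)

theorem Sym.pow {s : ℝ} {f : ℝ → ℂ} (hf : Sym s f) (n : ℕ) : Sym (n * s) (f ^ n) := by
  induction n with
  | zero => simpa using sym_one
  | succ n ih =>
    rw [pow_succ]
    exact (ih.mul hf).mono (by push_cast; linarith)

theorem SymN.of_sym_mul {n : ℕ} {s : ℝ} {f g : ℝ → ℂ} (hf : Sym 0 f) (hg : SymN n s g) :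
    SymN n s (f * g) := ((hf n).mul hg).mono le_rfl (by simp)

/-- The coordinate function. -/
def cx : ℝ → ℂ := fun x => (x : ℂ)

/-- The inverse of the coordinate function. -/
def ix : ℝ → ℂ := fun x => (x : ℂ)⁻¹

theorem contDiff_cx : ContDiff ℝ ∞ cx := Complex.ofRealCLM.contDiff

theorem hasDerivAt_cx (x : ℝ) : HasDerivAt cx 1 x := Complex.ofRealCLM.hasDerivAt

theorem deriv_cx : deriv cx = 1 := by ext x; exact (hasDerivAt_cx x).deriv

theorem cx_ne_zero : ∀ᶠ x in atTop, cx x ≠ 0 := by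
  filter_upwards [eventually_gt_atTop 0] with x hx
  simpa [cx] using hx.ne'

theorem sym_cx : Sym 1 cx := by
  refine Sym.of_deriv (symN_zero.2 ⟨contDiff_cx.evSmooth, ?_⟩) ?_
  · refine IsBigO.of_bound 1 (Eventually.of_forall fun x => ?_)
    simp [cx]
  · rw [deriv_cx]; simpa using sym_one

theorem ix_isBigO : ix =O[atTop] fun x : ℝ => x ^ (-1 : ℝ) := by
  refine IsBigO.of_bound 1 ?_
  filter_upwards [eventually_gt_atTop 0] with x hx
  rw [Real.rpow_neg_one]; simp [ix]

theorem evSmooth_ix : EvSmooth ix := contDiff_cx.evSmooth.inv cx_ne_zero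

theorem deriv_ix : deriv ix =ᶠ[atTop] -(ix * ix) := by
  filter_upwards [cx_ne_zero] with x hx
  have := ((hasDerivAt_cx x).inv hx).deriv
  have h2 : ix = cx⁻¹ := rfl
  rw [h2, this]
  simp; field_simp

theorem symN_ix (n : ℕ) : SymN n (-1) ix := by
  induction n with
  | zero => exact symN_zero.2 ⟨evSmooth_ix, ix_isBigO⟩
  | succ n ih =>
    refine symN_succ.2 ⟨symN_zero.2 ⟨evSmooth_ix, ix_isBigO⟩, ?_⟩
    have : SymN n (-1 - 1) (-(ix * ix)) := by
      have h := SymN.of_sym_mul (sym_const (-1)) (ih.mul ih)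
      refine (h.mono le_rfl (by norm_num)).congr (Eventually.of_forall fun x => by simp)
    exact this.congr deriv_ix.symm

theorem sym_ix : Sym (-1) ix := symN_ix

theorem cx_mul_ix : cx * ix =ᶠ[atTop] 1 := by
  filter_upwards [cx_ne_zero] with x hx
  simp only [cx, ne_eq, Complex.ofReal_eq_zero] at hx
  simp [cx, ix, hx]

theorem sym_ix_pow (n : ℕ) : Sym (-(n:ℝ)) (ix ^ n) := (sym_ix.pow n).mono (by simp)

theorem sym_cx_pow (n : ℕ) : Sym (n:ℝ) (cx ^ n) := (sym_cx.pow n).mono (by simp)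

/-- A function whose logarithmic derivative is a symbol of order `-1` satisfies symbol estimates
of the order of its size. -/
theorem Sym.of_logDeriv {s : ℝ} {f g : ℝ → ℂ} (hs : EvSmooth f)
    (hf : f =O[atTop] fun x : ℝ => x ^ s) (hg : Sym (-1) g) (h : deriv f =ᶠ[atTop] f * g) :
    Sym s f := by
  intro n
  induction n with
  | zero => exact symN_zero.2 ⟨hs, hf⟩
  | succ n ih =>
    refine symN_succ.2 ⟨symN_zero.2 ⟨hs, hf⟩, ?_⟩
    exact ((ih.mul (hg n)).mono le_rfl (by linarith)).congr h.symm

theorem deriv_inv_eq {f : ℝ → ℂ} (hf : EvSmooth f) (h0 : ∀ᶠ x in atTop, f x ≠ 0) :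
    deriv f⁻¹ =ᶠ[atTop] f⁻¹ * -(f⁻¹ * deriv f) := by
  filter_upwards [hf.differentiable, h0] with x h1 h2
  rw [(h1.hasDerivAt.inv h2).deriv]
  simp; field_simp

/-- Since `(f⁻¹)' = -f⁻¹ · f⁻¹ f'` has order `2t + s - 1`, the condition `s + t ≤ 0` is what makes
each derivative gain a full power of `x`. -/
theorem Sym.inv {s t : ℝ} {f : ℝ → ℂ} (hf : Sym s f) (h0 : ∀ᶠ x in atTop, f x ≠ 0)
    (hb : f⁻¹ =O[atTop] fun x : ℝ => x ^ t) (hst : s + t ≤ 0) : Sym t f⁻¹ := by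
  have hs := hf.evSmooth.inv h0
  intro n
  induction n with
  | zero => exact symN_zero.2 ⟨hs, hb⟩
  | succ n ih =>
    refine symN_succ.2 ⟨symN_zero.2 ⟨hs, hb⟩, ?_⟩
    have h1 := ih.mul (SymN.of_sym_mul (sym_const (-1)) (ih.mul (hf.derivative n)))
    refine (h1.mono le_rfl (by linarith)).congr ?_
    refine EventuallyEq.trans (Eventually.of_forall fun x => ?_) (deriv_inv_eq hf.evSmooth h0).symm
    simp

theorem tendsto_zero_of_isBigO {f : ℝ → ℂ} {s : ℝ} (hs : s < 0)
    (hf : f =O[atTop] fun x : ℝ => x ^ s) : Tendsto f atTop (𝓝 0) := by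
  refine hf.trans_tendsto ?_
  simpa using tendsto_rpow_neg_atTop (y := -s) (by linarith)

theorem Sym.one_add_inv {s : ℝ} {f : ℝ → ℂ} (hf : Sym s f) (hs : s < 0) :
    (∀ᶠ x in atTop, (1 + f) x ≠ 0) ∧ Sym 0 (1 + f)⁻¹ := by
  have ht := tendsto_zero_of_isBigO hs hf.isBigO
  have hb : ∀ᶠ x in atTop, 1 / 2 ≤ ‖(1 + f) x‖ := by
    have := ht.norm
    rw [norm_zero] at this
    filter_upwards [this.eventually_le_const (show (0:ℝ) < 1 / 2 by norm_num)] with x hx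
    have h1 := norm_sub_norm_le (1 : ℂ) (-f x)
    simp only [norm_one, norm_neg, sub_neg_eq_add] at h1
    simp only [Pi.add_apply, Pi.one_apply]
    linarith
  have h0 : ∀ᶠ x in atTop, (1 + f) x ≠ 0 := by
    filter_upwards [hb] with x hx h
    rw [h, norm_zero] at hx; norm_num at hx
  refine ⟨h0, Sym.inv (s := 0) (sym_one.add (hf.mono hs.le)) h0 ?_ (by simp)⟩
  refine IsBigO.of_bound 2 ?_
  filter_upwards [hb] with x hx
  rw [Pi.inv_apply, norm_inv]
  simp only [Real.rpow_zero, norm_one, mul_one]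
  rw [inv_le_comm₀ (by linarith) (by norm_num)]
  linarith

/-- Symbols of order `-∞`. -/
def Rapid (f : ℝ → ℂ) : Prop := ∀ s, Sym s f

theorem Rapid.congr {f g : ℝ → ℂ} (h : Rapid f) (hfg : f =ᶠ[atTop] g) : Rapid g :=
  fun s => (h s).congr hfg

theorem Rapid.add {f g : ℝ → ℂ} (hf : Rapid f) (hg : Rapid g) : Rapid (f + g) :=
  fun s => (hf s).add (hg s)

theorem Rapid.sub {f g : ℝ → ℂ} (hf : Rapid f) (hg : Rapid g) : Rapid (f - g) :=
  fun s => (hf s).sub (hg s)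

theorem Rapid.mul_sym {s : ℝ} {f g : ℝ → ℂ} (hf : Rapid f) (hg : Sym s g) : Rapid (f * g) :=
  fun t => ((hf (t - s)).mul hg).mono (by linarith)

theorem rapid_zero : Rapid 0 := fun s => sym_zero s

theorem Rapid.fun_sum {ι : Type*} {S : Finset ι} {f : ι → ℝ → ℂ} (h : ∀ i ∈ S, Rapid (f i)) :
    Rapid (fun x => ∑ i ∈ S, f i x) := fun s => Sym.fun_sum fun i hi => h i hi s

/-! ### Cutoffs and asymptotic summation -/

/-- A smooth function which vanishes for `x ≤ 0` and equals `1` for `x ≥ 1`. -/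
def cutoff : ℝ → ℂ := fun x => (Real.smoothTransition x : ℂ)

theorem contDiff_cutoff : ContDiff ℝ ∞ cutoff :=
  Complex.ofRealCLM.contDiff.comp Real.smoothTransition.contDiff

theorem cutoff_of_nonpos {x : ℝ} (h : x ≤ 0) : cutoff x = 0 := by
  simp [cutoff, Real.smoothTransition.zero_of_nonpos h]

theorem cutoff_of_one_le {x : ℝ} (h : 1 ≤ x) : cutoff x = 1 := by
  simp [cutoff, Real.smoothTransition.one_of_one_le h]

theorem iteratedDeriv_eq_zero_of_eventuallyEq {f : ℝ → ℂ} {x : ℝ} (h : f =ᶠ[𝓝 x] 0) (k : ℕ) :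
    iteratedDeriv k f x = 0 := by
  rw [EventuallyEq.iteratedDeriv_eq k h]
  have : (0 : ℝ → ℂ) = fun _ => 0 := rfl
  rw [this, iteratedDeriv_const]; simp

theorem cutoff_bound (k : ℕ) : ∃ B : ℝ, ∀ x, ‖iteratedDeriv k cutoff x‖ ≤ B := by
  have hc : Continuous (iteratedDeriv k cutoff) :=
    contDiff_cutoff.continuous_iteratedDeriv k (by exact_mod_cast le_top)
  obtain ⟨B, hB⟩ := (isCompact_Icc (a := (0:ℝ)) (b := 1)).exists_bound_of_continuousOn
    hc.continuousOn
  refine ⟨max B 1, fun x => ?_⟩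
  rcases lt_or_ge x 0 with h | h
  · rw [iteratedDeriv_eq_zero_of_eventuallyEq]
    · simp
    · filter_upwards [Iio_mem_nhds h] with y hy using cutoff_of_nonpos (le_of_lt hy)
  rcases le_or_gt x 1 with h1 | h1
  · exact (hB x ⟨h, h1⟩).trans (le_max_left _ _)
  · have : cutoff =ᶠ[𝓝 x] fun _ => 1 := by
      filter_upwards [Ioi_mem_nhds h1] with y hy using cutoff_of_one_le (le_of_lt hy)
    rw [EventuallyEq.iteratedDeriv_eq k this, iteratedDeriv_const]
    split_ifs <;> simp

theorem contDiff_shifted_cutoff_mul {f : ℝ → ℂ} {R : ℝ} (hf : ∀ x ≥ R, ContDiffAt ℝ ∞ f x) :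
    ContDiff ℝ ∞ (fun x => cutoff (x - R) * f x) := by
  refine contDiff_iff_contDiffAt.2 fun x => ?_
  rcases lt_or_ge x R with h | h
  · have : (fun x => cutoff (x - R) * f x) =ᶠ[𝓝 x] fun _ => 0 := by
      filter_upwards [Iio_mem_nhds h] with y hy
      rw [cutoff_of_nonpos (by linarith [Set.mem_Iio.1 hy]), zero_mul]
    exact contDiffAt_const.congr_of_eventuallyEq this
  · exact ((contDiff_cutoff.comp (contDiff_id.sub contDiff_const)).contDiffAt).mul (hf x h)

theorem shifted_cutoff_mul_eq (f : ℝ → ℂ) (R : ℝ) :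
    (fun x => cutoff (x - R) * f x) =ᶠ[atTop] f := by
  filter_upwards [eventually_ge_atTop (R + 1)] with x hx
  rw [cutoff_of_one_le (by linarith), one_mul]

/-- The derivatives of the cutoff are bounded independently of the translation, so `B` depends on
`n` only. This allows `R` to be chosen after `B` in the asymptotic summation. -/
theorem exists_cutoff_mul_bound (n : ℕ) : ∃ B : ℝ, 0 < B ∧ ∀ (f : ℝ → ℂ) (R c x : ℝ), R ≤ x →
    ContDiffAt ℝ ∞ f x → (∀ k ≤ n, ‖iteratedDeriv k f x‖ ≤ c) →
    ∀ k ≤ n, ‖iteratedDeriv k (fun x => cutoff (x - R) * f x) x‖ ≤ B * c := by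
  choose b hb using cutoff_bound
  have hb0 : ∀ k, 0 ≤ b k := fun k => (norm_nonneg _).trans (hb k 0)
  refine ⟨1 + ∑ k ∈ Finset.range (n + 1), ∑ i ∈ Finset.range (k + 1), (k.choose i : ℝ) * b i,
    ?_, ?_⟩
  · have : 0 ≤ ∑ k ∈ Finset.range (n + 1), ∑ i ∈ Finset.range (k + 1), (k.choose i : ℝ) * b i :=
      Finset.sum_nonneg fun k _ => Finset.sum_nonneg fun i _ => mul_nonneg (by positivity) (hb0 i)
    linarith
  intro f R c x _ hf hc k hk
  have hc0 : 0 ≤ c := (norm_nonneg _).trans (hc 0 (Nat.zero_le _))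
  have hcut : ContDiffAt ℝ ∞ (fun x => cutoff (x - R)) x :=
    (contDiff_cutoff.comp (contDiff_id.sub contDiff_const)).contDiffAt
  have e : (fun x => cutoff (x - R) * f x) = (fun x => cutoff (x - R)) * f := rfl
  rw [e, iteratedDeriv_mul (hcut.of_le (by exact_mod_cast le_top))
    (hf.of_le (by exact_mod_cast le_top))]
  have h1 : ‖∑ i ∈ Finset.range (k + 1), (k.choose i : ℂ) *
      iteratedDeriv i (fun x => cutoff (x - R)) x * iteratedDeriv (k - i) f x‖ ≤
      (∑ i ∈ Finset.range (k + 1), (k.choose i : ℝ) * b i) * c := by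
    rw [Finset.sum_mul]
    refine (norm_sum_le _ _).trans (Finset.sum_le_sum fun i hi => ?_)
    rw [norm_mul, norm_mul]
    refine mul_le_mul ?_ (hc _ (by omega)) (norm_nonneg _) (mul_nonneg (by positivity) (hb0 i))
    rw [iteratedDeriv_comp_sub_const]
    simp only [Complex.norm_natCast]
    exact mul_le_mul_of_nonneg_left (hb i _) (by positivity)
  refine h1.trans (mul_le_mul_of_nonneg_right ?_ hc0)
  have := Finset.single_le_sum (f := fun k => ∑ i ∈ Finset.range (k + 1), (k.choose i : ℝ) * b i)
    (fun k _ => Finset.sum_nonneg fun i _ => mul_nonneg (by positivity) (hb0 i))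
    (Finset.mem_range.2 (Nat.lt_succ_of_le hk))
  linarith

theorem isLittleO_rpow_rpow {s t : ℝ} (h : s < t) :
    (fun x : ℝ => x ^ s) =o[atTop] fun x : ℝ => x ^ t := by
  refine (isLittleO_iff_tendsto' ?_).2 ?_
  · filter_upwards [eventually_gt_atTop 0] with x hx h0
    exact absurd h0 (Real.rpow_pos_of_pos hx _).ne'
  · refine (tendsto_rpow_neg_atTop (y := t - s) (by linarith)).congr' ?_
    filter_upwards [eventually_gt_atTop 0] with x hx
    rw [← Real.rpow_sub hx]; congr 1; ring

theorem sym_eventually_small {s t c : ℝ} {f : ℝ → ℂ} (hf : Sym s f) (hst : s < t) (hc : 0 < c)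
    (n : ℕ) : ∀ᶠ x in atTop, ∀ k ≤ n, ‖iteratedDeriv k f x‖ ≤ c * x ^ t := by
  have h1 : ∀ k ∈ Finset.range (n + 1), ∀ᶠ x in atTop, ‖iteratedDeriv k f x‖ ≤ c * x ^ t := by
    intro k _
    have h2 := ((hf k).2 k le_rfl).trans
      (rpow_isBigO (show s - k ≤ s by linarith [Nat.cast_nonneg (α := ℝ) k]))
    have h3 := h2.trans_isLittleO (isLittleO_rpow_rpow hst)
    filter_upwards [h3.bound hc, eventually_gt_atTop 0] with x hx hx0
    rwa [Real.norm_of_nonneg (Real.rpow_nonneg hx0.le _)] at hx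
  filter_upwards [(Finset.eventually_all _).2 h1] with x hx k hk
  exact hx k (Finset.mem_range.2 (by omega))

/-- Asymptotic summation of symbols of orders tending to `-∞`. -/
theorem exists_asymptotic_sum {ε : ℝ} (hε : 0 < ε) (δ : ℕ → ℝ → ℂ)
    (h : ∀ n : ℕ, Sym (-(n * ε)) (δ n)) :
    ∃ κ : ℝ → ℂ, ∀ n : ℕ, Sym (-(n * ε)) (κ - ∑ i ∈ Finset.range n, δ i) := by
  choose B hB0 hB using exists_cutoff_mul_bound
  -- Giving up a factor `x^ε` makes the first `n` derivatives of `δ n` as small as desired far out.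
  -- The factor `(1/2)^n / B n` leaves a geometric series after the cutoff, and `n ≤ R` makes the
  -- sum locally finite.
  have hR : ∀ n : ℕ, ∃ R : ℝ, (n : ℝ) ≤ R ∧ 1 ≤ R ∧ ∀ x ≥ R, ContDiffAt ℝ ∞ (δ n) x ∧
      ∀ k ≤ n, ‖iteratedDeriv k (δ n) x‖ ≤ ((1 / 2) ^ n / B n) * x ^ (-(n * ε) + ε) := by
    intro n
    have h1 := (h n).evSmooth.and (sym_eventually_small (h n)
      (show -(n * ε) < -(n * ε) + ε by linarith)
      (show 0 < (1 / 2) ^ n / B n by have := hB0 n; positivity) n)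
    obtain ⟨R, hR⟩ := eventually_atTop.1 h1
    exact ⟨max R (max n 1), (le_max_left _ _).trans (le_max_right _ _),
      (le_max_right _ _).trans (le_max_right _ _),
      fun x hx => hR x ((le_max_left _ _).trans hx)⟩
  choose R hRn hR1 hR using hR
  set term : ℕ → ℝ → ℂ := fun n x => cutoff (x - R n) * δ n x with hterm
  have tsm : ∀ n, ContDiff ℝ ∞ (term n) := fun n =>
    contDiff_shifted_cutoff_mul fun x hx => (hR n x hx).1
  have tzero : ∀ n x, x ≤ R n → term n x = 0 := fun n x hx => by
    simp only [hterm]; rw [cutoff_of_nonpos (by linarith), zero_mul]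
  have tbound : ∀ n x, 1 ≤ x → ∀ k ≤ n,
      ‖iteratedDeriv k (term n) x‖ ≤ (1 / 2) ^ n * x ^ (-(n * ε) + ε) := by
    intro n x hx1 k hk
    rcases lt_or_ge x (R n) with hx | hx
    · rw [iteratedDeriv_eq_zero_of_eventuallyEq]
      · rw [norm_zero]; positivity
      · filter_upwards [Iio_mem_nhds hx] with y hy using tzero n y (le_of_lt hy)
    · refine (hB n (δ n) (R n) _ x hx (hR n x hx).1 (hR n x hx).2 k hk).trans (le_of_eq ?_)
      have := (hB0 n).ne'
      field_simp
  -- The truncation at `⌈x⌉₊` loses nothing: for larger `n` one has `x ≤ n ≤ R n`, where the term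
  -- vanishes.
  set κ : ℝ → ℂ := fun x => ∑ n ∈ Finset.range ⌈x⌉₊, term n x with hκ
  have κeq : ∀ (N : ℕ) (x : ℝ), x ≤ N → κ x = ∑ n ∈ Finset.range N, term n x := by
    intro N x hx
    refine Finset.sum_subset (Finset.range_mono (Nat.ceil_le.2 hx)) fun n _ hn => ?_
    refine tzero n x ?_
    rw [Finset.mem_range, not_lt] at hn
    exact (Nat.le_ceil x).trans ((by exact_mod_cast hn : (⌈x⌉₊ : ℝ) ≤ n).trans (hRn n))
  have tail_eq : ∀ (M : ℕ) (x : ℝ), ∃ N : ℕ, M ≤ N ∧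
      (κ - fun y => ∑ i ∈ Finset.range M, term i y) =ᶠ[𝓝 x]
        fun y => ∑ i ∈ Finset.Ico M N, term i y := by
    intro M x
    refine ⟨max M ⌈x + 1⌉₊, le_max_left _ _, ?_⟩
    filter_upwards [Iio_mem_nhds (show x < x + 1 by linarith)] with y hy
    have hy' : y ≤ (max M ⌈x + 1⌉₊ : ℕ) := by
      refine (le_of_lt hy).trans ((Nat.le_ceil _).trans ?_)
      exact_mod_cast le_max_right _ _
    rw [Pi.sub_apply, κeq _ y hy', Finset.sum_Ico_eq_sub _ (le_max_left _ _)]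
  have tail_smooth : ∀ M, EvSmooth (κ - fun y => ∑ i ∈ Finset.range M, term i y) := by
    intro M
    refine Eventually.of_forall fun x => ?_
    obtain ⟨N, -, hN⟩ := tail_eq M x
    exact (ContDiff.sum fun i _ => tsm i).contDiffAt.congr_of_eventuallyEq hN
  have tail_bound : ∀ M k : ℕ, k ≤ M →
      iteratedDeriv k (κ - fun y => ∑ i ∈ Finset.range M, term i y)
        =O[atTop] fun x : ℝ => x ^ (-(M * ε) + ε) := by
    intro M k hk
    refine IsBigO.of_bound 2 ?_
    filter_upwards [eventually_ge_atTop 1] with x hx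
    have hx0 : (0:ℝ) ≤ x := by linarith
    obtain ⟨N, -, hN⟩ := tail_eq M x
    rw [EventuallyEq.iteratedDeriv_eq k hN, iteratedDeriv_fun_sum
      (fun i _ => (tsm i).contDiffAt.of_le (by exact_mod_cast le_top)),
      Real.norm_of_nonneg (Real.rpow_nonneg hx0 _)]
    refine (norm_sum_le _ _).trans ?_
    have h1 : ∀ i ∈ Finset.Ico M N, ‖iteratedDeriv k (term i) x‖ ≤
        (1 / 2) ^ i * x ^ (-(M * ε) + ε) := by
      intro i hi
      have hMi := (Finset.mem_Ico.1 hi).1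
      refine (tbound i x hx k (hk.trans hMi)).trans ?_
      refine mul_le_mul_of_nonneg_left (Real.rpow_le_rpow_of_exponent_le hx ?_) (by positivity)
      have : (M:ℝ) * ε ≤ i * ε := mul_le_mul_of_nonneg_right (by exact_mod_cast hMi) hε.le
      linarith
    refine (Finset.sum_le_sum h1).trans ?_
    rw [← Finset.sum_mul]
    refine mul_le_mul_of_nonneg_right ?_ (Real.rpow_nonneg hx0 _)
    refine (Summable.sum_le_tsum _ (fun i _ => by positivity) summable_geometric_two).trans ?_
    rw [tsum_geometric_two]
  refine ⟨κ, fun n K => ?_⟩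
  -- The tail bound loses `x^ε` and gains nothing from differentiation. Comparing with a partial sum
  -- so long that `M * ε ≥ n * ε + K + ε` absorbs both defects for `K` derivatives; the terms
  -- between `n` and `M` have order at most `-(n * ε)` anyway.
  obtain ⟨M', hM'⟩ := exists_nat_gt ((n * ε + K + ε) / ε)
  set M := max M' (max n K) with hM
  have hnM : n ≤ M := (le_max_left _ _).trans (le_max_right _ _)
  have hKM : K ≤ M := (le_max_right _ _).trans (le_max_right _ _)
  have hM2 : n * ε + K + ε ≤ M * ε := by
    rw [div_lt_iff₀ hε] at hM'
    have : (M':ℝ) * ε ≤ M * ε :=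
      mul_le_mul_of_nonneg_right (by exact_mod_cast le_max_left _ _) hε.le
    linarith
  have hA : SymN K (-(n * ε)) (κ - fun y => ∑ i ∈ Finset.range M, term i y) := by
    refine ⟨tail_smooth M, fun k hk => (tail_bound M k (hk.trans hKM)).trans (rpow_isBigO ?_)⟩
    have : (k:ℝ) ≤ K := by exact_mod_cast hk
    linarith
  have hS : Sym (-(n * ε)) (∑ i ∈ Finset.Ico n M, δ i) := by
    refine Sym.sum fun i hi => (h i).mono ?_
    have : (n:ℝ) * ε ≤ i * ε :=
      mul_le_mul_of_nonneg_right (by exact_mod_cast (Finset.mem_Ico.1 hi).1) hε.le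
    linarith
  refine (hA.add (hS K)).congr ?_
  have hall : ∀ᶠ x in atTop, ∀ i ∈ Finset.range M, term i x = δ i x :=
    (Finset.eventually_all _).2 fun i _ => shifted_cutoff_mul_eq (δ i) (R i)
  filter_upwards [hall] with x hx
  simp only [Pi.add_apply, Pi.sub_apply, Finset.sum_apply]
  rw [Finset.sum_congr rfl hx, Finset.sum_Ico_eq_sub _ hnM]
  ring

/-- A map of symbols of order `0` which improves differences by `ε` has an approximate fixed
point. -/
theorem exists_approx_fixed_point {ε : ℝ} (hε : 0 < ε) (F : (ℝ → ℂ) → ℝ → ℂ)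
    (h0 : ∀ κ, Sym 0 κ → Sym 0 (F κ))
    (h1 : ∀ κ κ' s, s ≤ 0 → Sym 0 κ → Sym 0 κ' → Sym s (κ - κ') → Sym (s - ε) (F κ - F κ')) :
    ∃ κ, Sym 0 κ ∧ Rapid (κ - F κ) := by
  have hk : ∀ n, Sym 0 (F^[n] 0) := by
    intro n
    induction n with
    | zero => exact sym_zero 0
    | succ n ih => rw [Function.iterate_succ_apply']; exact h0 _ ih
  have hd : ∀ n : ℕ, Sym (-(n * ε)) (F^[n + 1] 0 - F^[n] 0) := by
    intro n
    induction n with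
    | zero => exact ((hk 1).sub (hk 0)).mono (by simp)
    | succ n ih =>
      have e : F^[n + 1 + 1] 0 - F^[n + 1] 0 = F (F^[n + 1] 0) - F (F^[n] 0) := by
        rw [Function.iterate_succ_apply' F (n + 1), ← Function.iterate_succ_apply' F n]
      rw [e]
      refine (h1 _ _ (-(n * ε)) ?_ (hk _) (hk _) ih).mono (t := -((n + 1 : ℕ) * ε))
        (by push_cast; linarith)
      have : 0 ≤ (n:ℝ) * ε := by positivity
      linarith
  obtain ⟨κ, hκ⟩ := exists_asymptotic_sum hε _ hd
  have hκ' : ∀ n : ℕ, Sym (-(n * ε)) (κ - F^[n] 0) := by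
    intro n
    have := hκ n
    rw [Finset.sum_range_sub (fun n => F^[n] 0)] at this
    simpa using this
  have hκ0 : Sym 0 κ := by simpa using hκ' 0
  refine ⟨κ, hκ0, fun s => ?_⟩
  obtain ⟨n, hn⟩ := exists_nat_gt (-s / ε)
  rw [div_lt_iff₀ hε] at hn
  have hn0 : 0 ≤ (n:ℝ) * ε := by positivity
  -- `κ - F κ` is the difference of `κ - F^[n+1] 0` and `F κ - F (F^[n] 0)`, both of order `-((n +
  -- 1) * ε)`, with `n` arbitrary.
  have e1 := hκ' (n + 1)
  have e2 := h1 _ _ _ (by linarith) hκ0 (hk n) (hκ' n)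
  rw [Function.iterate_succ_apply'] at e1
  have := (e1.mono (t := s) (by push_cast; linarith)).sub (e2.mono (t := s) (by linarith))
  simpa using this

/-! ### From germs at `+∞` to global symbols -/

theorem rpow_isBigO_sqrt_one_add_sq_rpow (s : ℝ) :
    (fun x : ℝ => x ^ s) =O[atTop] fun x : ℝ => Real.sqrt (1 + x ^ 2) ^ s := by
  have key : ∀ x : ℝ, 1 ≤ x → x ≤ Real.sqrt (1 + x ^ 2) ∧ Real.sqrt (1 + x ^ 2) ≤ 2 * x := by
    intro x hx
    refine ⟨Real.le_sqrt_of_sq_le (by linarith), ?_⟩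
    rw [Real.sqrt_le_left (by linarith)]
    nlinarith
  refine IsBigO.of_bound (2 ^ |s|) ?_
  filter_upwards [eventually_ge_atTop 1] with x hx
  have hx0 : 0 < x := by linarith
  obtain ⟨k1, k2⟩ := key x hx
  have hq : 0 < Real.sqrt (1 + x ^ 2) := by linarith
  rw [Real.norm_of_nonneg (by positivity), Real.norm_of_nonneg (by positivity)]
  rcases le_total 0 s with hs | hs
  · have h1 : x ^ s ≤ Real.sqrt (1 + x ^ 2) ^ s := Real.rpow_le_rpow hx0.le k1 hs
    have h2 : (1:ℝ) ≤ 2 ^ |s| := Real.one_le_rpow (by norm_num) (abs_nonneg s)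
    have h3 : 0 ≤ Real.sqrt (1 + x ^ 2) ^ s := by positivity
    nlinarith
  · have h1 : (2 * x) ^ s ≤ Real.sqrt (1 + x ^ 2) ^ s := Real.rpow_le_rpow_of_nonpos hq k2 hs
    rw [Real.mul_rpow (by norm_num) hx0.le] at h1
    have h2 : (2:ℝ) ^ |s| * 2 ^ s = 1 := by
      rw [← Real.rpow_add (by norm_num), abs_of_nonpos hs]; simp
    calc x ^ s = 2 ^ |s| * (2 ^ s * x ^ s) := by rw [← mul_assoc, h2, one_mul]
      _ ≤ _ := mul_le_mul_of_nonneg_left h1 (by positivity)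

/-- A symbol at `+∞` agrees near `+∞` with a globally defined symbol. -/
theorem Sym.exists_isSymbol {s : ℝ} {f : ℝ → ℂ} (hf : Sym s f) :
    ∃ g : ℝ → ℂ, f =ᶠ[atTop] g ∧ IsSymbol s g := by
  obtain ⟨R, hR⟩ := eventually_atTop.1 hf.evSmooth
  have hsm := contDiff_shifted_cutoff_mul hR
  have heq := shifted_cutoff_mul_eq f R
  refine ⟨_, heq.symm, hsm, fun α => ?_⟩
  have hg : Sym s fun x => cutoff (x - R) * f x := hf.congr heq.symm
  obtain ⟨C, hC⟩ := (((hg α).2 α le_rfl).trans (rpow_isBigO_sqrt_one_add_sq_rpow (s - α))).bound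
  obtain ⟨X, hX⟩ := eventually_atTop.1 hC
  have hpos : ∀ x : ℝ, 0 < Real.sqrt (1 + x ^ 2) := fun x => Real.sqrt_pos.2 (by positivity)
  have hcont : Continuous fun x => iteratedDeriv α (fun x => cutoff (x - R) * f x) x /
      ((Real.sqrt (1 + x ^ 2) ^ (s - α) : ℝ) : ℂ) := by
    refine (hsm.continuous_iteratedDeriv α (by exact_mod_cast le_top)).div ?_ fun x => ?_
    · refine Complex.continuous_ofReal.comp ?_
      refine Continuous.rpow_const (by fun_prop) fun x => Or.inl (hpos x).ne'
    · exact_mod_cast (Real.rpow_pos_of_pos (hpos x) _).ne'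
  obtain ⟨C', hC'⟩ := (isCompact_Icc (a := R - 1) (b := X)).exists_bound_of_continuousOn
    hcont.continuousOn
  refine ⟨max (max C C') 0, fun x => ?_⟩
  have hp := Real.rpow_pos_of_pos (hpos x) (s - α)
  -- Three regions: the bound at infinity beyond `X`, compactness in between, and the vanishing of
  -- the cut-off function to the left of `R`.
  rcases le_or_gt X x with h | h
  · have := hX x h
    rw [Real.norm_of_nonneg hp.le] at this
    exact this.trans (mul_le_mul_of_nonneg_right
      ((le_max_left _ _).trans (le_max_left _ _)) hp.le)
  rcases lt_or_ge x R with h' | h'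
  · rw [iteratedDeriv_eq_zero_of_eventuallyEq]
    · rw [norm_zero]; exact mul_nonneg (le_max_right _ _) hp.le
    · filter_upwards [Iio_mem_nhds h'] with y hy
      rw [cutoff_of_nonpos (by linarith [Set.mem_Iio.1 hy]), zero_mul, Pi.zero_apply]
  · have := hC' x ⟨by linarith, h.le⟩
    rw [norm_div, Complex.norm_real, Real.norm_of_nonneg hp.le, div_le_iff₀ hp] at this
    exact this.trans (mul_le_mul_of_nonneg_right
      ((le_max_right _ _).trans (le_max_left _ _)) hp.le)

theorem Rapid.rapidlyDecreasing {f : ℝ → ℂ} (hf : Rapid f) : RapidlyDecreasing f := by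
  intro α N
  have := (hf (-N + α) α).2 α le_rfl
  refine this.congr' (EventuallyEq.refl _ _) ?_
  refine Eventually.of_forall fun x => ?_
  simp only [add_sub_cancel_right]
  rw [← Real.rpow_intCast]; push_cast; rfl

theorem Rapid.exists_isSymbol {f : ℝ → ℂ} (hf : Rapid f) (s : ℝ) :
    ∃ g : ℝ → ℂ, f =ᶠ[atTop] g ∧ IsSymbol s g ∧ RapidlyDecreasing g := by
  obtain ⟨g, h1, h2⟩ := (hf s).exists_isSymbol
  exact ⟨g, h1, h2, (hf.congr h1).rapidlyDecreasing⟩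

theorem Sym.D {s : ℝ} {f : ℝ → ℂ} (hf : Sym s f) : Sym (s - 1) (WeylODE.D f) :=
  hf.derivative.const_mul _

/-! ### Right division by first order operators -/

/-- The operator `D + V`. -/
def conn (V f : ℝ → ℂ) : ℝ → ℂ := fun x => D f x + V x * f x

/-- The operator `∑_{k ≤ n} c_k (D + V)^{n-k}`. -/
def connOp (V : ℝ → ℂ) (n : ℕ) (c : ℕ → ℝ → ℂ) (f : ℝ → ℂ) : ℝ → ℂ := fun x =>
  ∑ k ∈ Finset.range (n + 1), c k x * ((conn V)^[n - k] f) x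

theorem conn_zero : conn 0 = D := by
  ext f x; simp [conn]

theorem connOp_zero (n : ℕ) (c : ℕ → ℝ → ℂ) (f : ℝ → ℂ) : connOp 0 n c f = diffOp n c f := by
  ext x; simp [connOp, diffOp, conn_zero]

/-- Smoothness at the points of a set. -/
def SmoothOn (U : Set ℝ) (f : ℝ → ℂ) : Prop := ∀ x ∈ U, ContDiffAt ℝ ∞ f x

namespace SmoothOn

variable {U : Set ℝ} {f g V : ℝ → ℂ}

theorem differentiableAt (hf : SmoothOn U f) {x : ℝ} (hx : x ∈ U) : DifferentiableAt ℝ f x :=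
  (hf x hx).differentiableAt (by simp)

theorem add (hf : SmoothOn U f) (hg : SmoothOn U g) : SmoothOn U (f + g) :=
  fun x hx => (hf x hx).add (hg x hx)

theorem sub (hf : SmoothOn U f) (hg : SmoothOn U g) : SmoothOn U (f - g) :=
  fun x hx => (hf x hx).sub (hg x hx)

theorem mul (hf : SmoothOn U f) (hg : SmoothOn U g) : SmoothOn U (f * g) :=
  fun x hx => (hf x hx).mul (hg x hx)

theorem D (hf : SmoothOn U f) : SmoothOn U (WeylODE.D f) :=
  fun x hx => contDiffAt_const.mul (ContDiffAt.deriv_smooth (hf x hx))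

theorem conn (hV : SmoothOn U V) (hf : SmoothOn U f) : SmoothOn U (WeylODE.conn V f) :=
  hf.D.add (hV.mul hf)

theorem conn_iterate (hV : SmoothOn U V) (hf : SmoothOn U f) (k : ℕ) :
    SmoothOn U ((WeylODE.conn V)^[k] f) := by
  induction k with
  | zero => exact hf
  | succ k ih => rw [Function.iterate_succ_apply']; exact hV.conn ih

theorem const (c : ℂ) : SmoothOn U (fun _ => c) := fun _ _ => contDiffAt_const

theorem zero : SmoothOn U 0 := const 0

theorem one : SmoothOn U 1 := const 1

end SmoothOn

theorem _root_.ContDiff.smoothOn {f : ℝ → ℂ} (hf : ContDiff ℝ ∞ f) (U : Set ℝ) : SmoothOn U f :=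
  fun _ _ => hf.contDiffAt

theorem D_mul {f g : ℝ → ℂ} {x : ℝ} (hf : DifferentiableAt ℝ f x) (hg : DifferentiableAt ℝ g x) :
    D (f * g) x = D f x * g x + f x * D g x := by
  simp only [D, deriv_mul hf hg]; ring

theorem D_add {f g : ℝ → ℂ} {x : ℝ} (hf : DifferentiableAt ℝ f x) (hg : DifferentiableAt ℝ g x) :
    D (f + g) x = D f x + D g x := by
  simp only [D, deriv_add hf hg]; ring

theorem D_sum {ι : Type*} {S : Finset ι} {f : ι → ℝ → ℂ} {x : ℝ}
    (hf : ∀ i ∈ S, DifferentiableAt ℝ (f i) x) :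
    D (fun y => ∑ i ∈ S, f i y) x = ∑ i ∈ S, D (f i) x := by
  simp only [D, deriv_fun_sum hf, Finset.mul_sum]

theorem D_congr {f g : ℝ → ℂ} {x : ℝ} (h : f =ᶠ[𝓝 x] g) : D f x = D g x := by
  simp only [D, h.deriv_eq]

theorem conn_congr {U : Set ℝ} (hU : IsOpen U) {V f g : ℝ → ℂ} (h : Set.EqOn f g U) {x : ℝ}
    (hx : x ∈ U) : conn V f x = conn V g x := by
  simp only [conn, h hx, D_congr (h.eventuallyEq_of_mem (hU.mem_nhds hx))]

theorem conn_mul {V f g : ℝ → ℂ} {x : ℝ} (hf : DifferentiableAt ℝ f x)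
    (hg : DifferentiableAt ℝ g x) : conn V (f * g) x = D f x * g x + f x * conn V g x := by
  simp only [conn, D_mul hf hg, Pi.mul_apply]; ring

/-- The coefficients of the division of `(D + V)^k` by `D + V - w`: the remainder is `β_{k,0}`
and the quotient is `∑_i β_{k,i+1} (D + V)^i`. -/
def beta (w : ℝ → ℂ) : ℕ → ℕ → ℝ → ℂ
  | 0, 0 => 1
  | 0, _ + 1 => 0
  | k + 1, 0 => conn w (beta w k 0)
  | k + 1, i + 1 => beta w k i + D (beta w k (i + 1))

theorem D_zero : D 0 = 0 := by
  ext x; simp [D]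

theorem D_one : D 1 = 0 := by
  ext x
  have : (1 : ℝ → ℂ) = fun _ => 1 := rfl
  simp [D, this]

theorem beta_eq_zero (w : ℝ → ℂ) {k i : ℕ} (h : k < i) : beta w k i = 0 := by
  induction k generalizing i with
  | zero => obtain ⟨i, rfl⟩ := Nat.exists_eq_succ_of_ne_zero (by omega : i ≠ 0); rfl
  | succ k ih =>
    obtain ⟨i, rfl⟩ := Nat.exists_eq_succ_of_ne_zero (by omega : i ≠ 0)
    simp only [beta]
    rw [ih (by omega), ih (by omega), D_zero, add_zero]

theorem beta_self (w : ℝ → ℂ) (k : ℕ) : beta w k k = 1 := by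
  induction k with
  | zero => rfl
  | succ k ih => simp only [beta]; rw [ih, beta_eq_zero w (by omega), D_zero, add_zero]

/-- This identifies the remainder of the division by `D - w` with the left side of the Riccati
equation at `w`. -/
theorem beta_zero_right (w : ℝ → ℂ) (k : ℕ) : beta w k 0 = (conn w)^[k] 1 := by
  induction k with
  | zero => rfl
  | succ k ih => rw [Function.iterate_succ_apply', ← ih]; rfl

theorem SmoothOn.beta {U : Set ℝ} {w : ℝ → ℂ} (hw : SmoothOn U w) (k i : ℕ) :
    SmoothOn U (beta w k i) := by
  induction k generalizing i with
  | zero =>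
    cases i with
    | zero => exact SmoothOn.one
    | succ i => exact SmoothOn.zero
  | succ k ih =>
    cases i with
    | zero => exact hw.conn (ih 0)
    | succ i => exact (ih i).add (ih (i + 1)).D

/-- Induction with the Leibniz rule `(D + V)(βg) = (Dβ) g + β (D + V) g`, replacing `(D + V) f` by
`w f` plus the new function. The coefficients `β` do not depend on `V`: the same quotient serves for
`D` (the factorization) and for `D + V` (the other Riccati solutions). -/
theorem conn_iterate_eq {U : Set ℝ} (hU : IsOpen U) {V w f : ℝ → ℂ} (hV : SmoothOn U V)
    (hw : SmoothOn U w) (hf : SmoothOn U f) (k : ℕ) : ∀ x ∈ U,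
    ((conn V)^[k] f) x = beta w k 0 x * f x +
      ∑ i ∈ Finset.range k, beta w k (i + 1) x * ((conn V)^[i] (conn V f - w * f)) x := by
  have hG : ∀ i, SmoothOn U ((conn V)^[i] (conn V f - w * f)) := fun i =>
    hV.conn_iterate ((hV.conn hf).sub (hw.mul hf)) i
  induction k with
  | zero => intro x _; simp [beta]
  | succ k ih =>
    intro x hx
    have hb : ∀ i, DifferentiableAt ℝ (beta w k i) x := fun i => (hw.beta k i).differentiableAt hx
    have hg : ∀ i, DifferentiableAt ℝ ((conn V)^[i] (conn V f - w * f)) x := fun i =>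
      (hG i).differentiableAt hx
    have hf' := hf.differentiableAt hx
    rw [Function.iterate_succ_apply']
    have e : Set.EqOn ((conn V)^[k] f) (beta w k 0 * f + fun y => ∑ i ∈ Finset.range k,
      (beta w k (i + 1) * ((conn V)^[i] (conn V f - w * f))) y) U := fun y hy => by
        simpa using ih y hy
    rw [conn_congr hU e hx]
    have e2 : conn V (beta w k 0 * f + fun y => ∑ i ∈ Finset.range k,
      (beta w k (i + 1) * ((conn V)^[i] (conn V f - w * f))) y) x =
      conn V (beta w k 0 * f) x + ∑ i ∈ Finset.range k,
        conn V (beta w k (i + 1) * ((conn V)^[i] (conn V f - w * f))) x := by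
      simp only [conn]
      rw [D_add ((hb 0).mul hf') (DifferentiableAt.fun_sum fun i _ => (hb _).mul (hg i)),
        D_sum fun i _ => (hb _).mul (hg i), Finset.sum_add_distrib, Pi.add_apply, ← Finset.mul_sum]
      ring
    rw [e2, conn_mul (hb 0) hf']
    simp only [conn_mul (hb _) (hg _), ← Function.iterate_succ_apply' (conn V)]
    rw [Finset.sum_add_distrib]
    simp only [beta, Pi.add_apply, add_mul]
    rw [Finset.sum_add_distrib, Finset.sum_range_succ' (fun i => beta w k i x * _),
      Finset.sum_range_succ (fun i => D (beta w k (i + 1)) x * _),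
      beta_eq_zero w (Nat.lt_succ_self k), D_zero]
    simp only [Function.iterate_zero, id, Pi.sub_apply, Pi.mul_apply, Pi.zero_apply, zero_mul,
      conn, add_zero, Nat.succ_eq_add_one]
    ring

/-- The coefficients of the quotient of `∑_{k ≤ N} c_k D^{N-k}` by `D - w`; the one with index
`N` is the remainder. -/
def quot (w : ℝ → ℂ) (N : ℕ) (c : ℕ → ℝ → ℂ) (l : ℕ) : ℝ → ℂ := fun x =>
  ∑ k ∈ Finset.range (N + 1), c k x * beta w (N - k) (N - l) x

theorem connOp_succ_eq {U : Set ℝ} (hU : IsOpen U) {V w f : ℝ → ℂ} (hV : SmoothOn U V)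
    (hw : SmoothOn U w) (hf : SmoothOn U f) (N : ℕ) (c : ℕ → ℝ → ℂ) {x : ℝ} (hx : x ∈ U) :
    connOp V (N + 1) c f x = quot w (N + 1) c (N + 1) x * f x +
      connOp V N (quot w (N + 1) c) (conn V f - w * f) x := by
  have h1 : ∀ k ∈ Finset.range (N + 1 + 1), c k x * ((conn V)^[N + 1 - k] f) x =
      c k x * beta w (N + 1 - k) 0 x * f x + ∑ i ∈ Finset.range (N + 1),
        c k x * beta w (N + 1 - k) (i + 1) x * ((conn V)^[i] (conn V f - w * f)) x := by
    intro k _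
    rw [conn_iterate_eq hU hV hw hf _ x hx, mul_add, mul_assoc, Finset.mul_sum]
    congr 1
    refine (Finset.sum_subset (Finset.range_mono (by omega)) fun i _ hi => ?_).trans
      (Finset.sum_congr rfl fun i _ => by ring)
    rw [Finset.mem_range, not_lt] at hi
    rw [beta_eq_zero w (by omega)]; simp
  simp only [connOp, quot]
  -- The sum is reversed because coefficients are numbered from the top: `i = N - l` is the power of
  -- `D + V` carried by the coefficient `l`.
  rw [Finset.sum_congr rfl h1, Finset.sum_add_distrib, Finset.sum_comm,
    ← Finset.sum_range_reflect _ (N + 1), Finset.sum_mul]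
  congr 1
  · simp
  · refine Finset.sum_congr rfl fun l hl => ?_
    rw [Finset.mem_range] at hl
    rw [Finset.sum_mul]
    refine Finset.sum_congr rfl fun k _ => ?_
    rw [show N + 1 - 1 - l = N - l by omega, show N - l + 1 = N + 1 - l by omega]

/-- Gauge transformation: `g⁻¹ (D + V) g = D + V + g⁻¹ Dg`, iterated. -/
theorem conn_iterate_mul {U : Set ℝ} (hU : IsOpen U) {V g f : ℝ → ℂ} (hV : SmoothOn U V)
    (hg : SmoothOn U g) (hf : SmoothOn U f) (h0 : ∀ x ∈ U, g x ≠ 0) (k : ℕ) : ∀ x ∈ U,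
    ((conn V)^[k] (g * f)) x = g x * ((conn (V + g⁻¹ * D g))^[k] f) x := by
  have hV' : SmoothOn U (V + g⁻¹ * D g) :=
    hV.add (SmoothOn.mul (fun x hx => (hg x hx).inv (h0 x hx)) hg.D)
  induction k with
  | zero => intro x _; rfl
  | succ k ih =>
    intro x hx
    rw [Function.iterate_succ_apply', Function.iterate_succ_apply',
      conn_congr hU (g := g * (conn (V + g⁻¹ * D g))^[k] f) (fun y hy => ih y hy) hx,
      conn_mul (hg.differentiableAt hx) ((hV'.conn_iterate hf k).differentiableAt hx)]
    have := h0 x hx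
    simp only [conn, Pi.add_apply, Pi.mul_apply, Pi.inv_apply]
    field_simp
    ring

theorem connOp_mul {U : Set ℝ} (hU : IsOpen U) {V g f : ℝ → ℂ} (hV : SmoothOn U V)
    (hg : SmoothOn U g) (hf : SmoothOn U f) (h0 : ∀ x ∈ U, g x ≠ 0) (n : ℕ) (c : ℕ → ℝ → ℂ)
    {x : ℝ} (hx : x ∈ U) :
    connOp V n c (g * f) x = g x * connOp (V + g⁻¹ * D g) n c f x := by
  simp only [connOp, Finset.mul_sum]
  refine Finset.sum_congr rfl fun k _ => ?_
  rw [conn_iterate_mul hU hV hg hf h0 _ x hx]; ring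

/-! ### Symbol estimates for the division -/

theorem Sym.conn {s : ℝ} {V f : ℝ → ℂ} (hV : Sym 1 V) (hf : Sym s f) :
    Sym (s + 1) (WeylODE.conn V f) :=
  (hf.D.mono (by linarith)).add (hV.mul_le hf (by linarith))

theorem Sym.beta {w : ℝ → ℂ} (hw : Sym 1 w) (k i : ℕ) : Sym ((k : ℝ) - i) (beta w k i) := by
  induction k generalizing i with
  | zero =>
    cases i with
    | zero => simpa [WeylODE.beta] using sym_one
    | succ i => exact sym_zero _
  | succ k ih =>
    cases i with
    | zero => exact (hw.conn (ih 0)).mono (by push_cast; linarith)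
    | succ i =>
      exact ((ih i).mono (by push_cast; linarith)).add
        ((ih (i + 1)).D.mono (by push_cast; linarith))

/-- If `D` commuted with `w`, the coefficient would be exactly `w^{k-i}`. A correction uses one `D`
to differentiate a coefficient instead of producing a factor `w`: order `-1` in place of `+1`, hence
the loss of two. -/
theorem Sym.beta_sub_pow {w : ℝ → ℂ} (hw : Sym 1 w) {k i : ℕ} (h : i ≤ k) :
    Sym ((k : ℝ) - i - 2) (WeylODE.beta w k i - w ^ (k - i)) := by
  induction k generalizing i with
  | zero =>
    obtain rfl : i = 0 := by omega
    simpa [WeylODE.beta] using sym_zero _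
  | succ k ih =>
    cases i with
    | zero =>
      have h1 := (hw.mul (ih (Nat.zero_le k))).add ((hw.beta k 0).D.mono (by push_cast; linarith))
      refine (h1.mono (t := ((k + 1 : ℕ) : ℝ) - (0 : ℕ) - 2) (by push_cast; linarith)).congr ?_
      refine Eventually.of_forall fun x => ?_
      simp only [WeylODE.beta, WeylODE.conn, Pi.add_apply, Pi.sub_apply, Pi.mul_apply, Pi.pow_apply,
        Nat.sub_zero, pow_succ]
      ring
    | succ i =>
      have h1 := ((ih (i := i) (by omega)).mono (t := ((k + 1 : ℕ) : ℝ) - (i + 1 : ℕ) - 2)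
        (by push_cast; linarith)).add
        ((hw.beta k (i + 1)).D.mono (by push_cast; linarith))
      refine h1.congr (Eventually.of_forall fun x => ?_)
      simp only [WeylODE.beta, Pi.add_apply, Pi.sub_apply, Nat.add_sub_add_right]
      ring

theorem Sym.pow_sub_pow {w z : ℝ → ℂ} (hw : Sym 1 w) (hz : Sym 1 z) (h : Sym (-1) (w - z))
    (n : ℕ) : Sym ((n : ℝ) - 2) (w ^ n - z ^ n) := by
  induction n with
  | zero => simpa using sym_zero _
  | succ n ih =>
    have h1 := (hw.mul_le ih (r := ((n + 1 : ℕ) : ℝ) - 2) (by push_cast; linarith)).add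
      (h.mul_le (hz.pow n) (by push_cast; linarith))
    have e : w ^ (n + 1) - z ^ (n + 1) = w * (w ^ n - z ^ n) + (w - z) * z ^ n := by ring
    rwa [e]

theorem Sym.quot {w : ℝ → ℂ} (hw : Sym 1 w) {N : ℕ} {c : ℕ → ℝ → ℂ}
    (hc : ∀ k ≤ N, Sym k (c k)) {l : ℕ} (hl : l ≤ N) : Sym l (quot w N c l) := by
  refine Sym.fun_sum fun k hk => ?_
  have hk' : k ≤ N := by rw [Finset.mem_range] at hk; omega
  refine (hc k hk').mul_le (hw.beta (N - k) (N - l)) ?_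
  rw [Nat.cast_sub hk', Nat.cast_sub hl]; linarith

theorem sigma_zero (n : ℕ) (z : ℕ → ℂ) : sigma n 0 z = 1 := by simp [sigma]

theorem sigma_succ (n k : ℕ) (z : ℕ → ℂ) :
    sigma (n + 1) (k + 1) z = sigma n (k + 1) z - z (n + 1) * sigma n k z := by
  simp only [sigma]
  have h : n + 1 ∉ Finset.Icc 1 n := by simp
  have e : Finset.Icc 1 (n + 1) = insert (n + 1) (Finset.Icc 1 n) := by
    ext i; simp only [Finset.mem_Icc, Finset.mem_insert]; omega
  rw [e, Finset.powersetCard_succ_insert h, Finset.sum_union, Finset.sum_image]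
  · have : ∀ t ∈ Finset.powersetCard k (Finset.Icc 1 n), ∏ i ∈ insert (n + 1) t, z i =
        z (n + 1) * ∏ i ∈ t, z i := fun t ht => by
      rw [Finset.prod_insert fun h' => h ((Finset.mem_powersetCard.1 ht).1 h')]
    rw [Finset.sum_congr rfl this, ← Finset.mul_sum]
    ring
  · intro s hs t ht hst
    have h1 : n + 1 ∉ s := fun h' => h ((Finset.mem_powersetCard.1 hs).1 h')
    have h2 : n + 1 ∉ t := fun h' => h ((Finset.mem_powersetCard.1 ht).1 h')
    rw [← Finset.erase_insert h1, ← Finset.erase_insert h2, hst]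
  · rw [Finset.disjoint_left]
    intro s hs hs'
    obtain ⟨t, -, rfl⟩ := Finset.mem_image.1 hs'
    exact h ((Finset.mem_powersetCard.1 hs).1 (Finset.mem_insert_self _ _))

/-- Synthetic division of `∏_{i ≤ n+1} (ζ - z_i)` by `ζ - z_{n+1}`; it is the commutative model of
`quot`. -/
theorem sum_sigma_succ_mul_pow (n l : ℕ) (z : ℕ → ℂ) :
    ∑ k ∈ Finset.range (l + 1), sigma (n + 1) k z * z (n + 1) ^ (l - k) = sigma n l z := by
  induction l with
  | zero => simp [sigma_zero]
  | succ l ih =>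
    rw [Finset.sum_range_succ]
    have : ∀ k ∈ Finset.range (l + 1), sigma (n + 1) k z * z (n + 1) ^ (l + 1 - k) =
        z (n + 1) * (sigma (n + 1) k z * z (n + 1) ^ (l - k)) := fun k hk => by
      rw [Finset.mem_range] at hk
      rw [show l + 1 - k = (l - k) + 1 by omega, pow_succ]; ring
    rw [Finset.sum_congr rfl this, ← Finset.mul_sum, ih, sigma_succ]
    simp

/-- Three replacements lead from `quot` to synthetic division: `β` by a power of `w`, then `w` by
the root, then `c k` by the symmetric function. Each costs two orders. -/
theorem quot_sub_sigma_isBigO {ξ : ℕ → ℝ → ℂ} {w : ℝ → ℂ} {N : ℕ} {c : ℕ → ℝ → ℂ}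
    (hw : Sym 1 w) (hz : Sym 1 (ξ (N + 1))) (hwz : Sym (-1) (w - ξ (N + 1)))
    (hc : ∀ k ≤ N + 1, Sym k (c k))
    (hs : ∀ k ≤ N + 1, (fun x => c k x - sigma (N + 1) k (fun i => ξ i x))
      =O[atTop] fun x : ℝ => x ^ ((k : ℝ) - 2)) {l : ℕ} (hl : l ≤ N) :
    (fun x => quot w (N + 1) c l x - sigma N l (fun i => ξ i x))
      =O[atTop] fun x : ℝ => x ^ ((l : ℝ) - 2) := by
  have e : (fun x => quot w (N + 1) c l x - sigma N l (fun i => ξ i x)) = fun x =>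
      ∑ k ∈ Finset.range (l + 1),
        ((c k * (beta w (N + 1 - k) (N + 1 - l) - w ^ (N + 1 - k - (N + 1 - l)))) x +
          (c k * (w ^ (l - k) - ξ (N + 1) ^ (l - k))) x +
          ((fun x => c k x - sigma (N + 1) k (fun i => ξ i x)) * ξ (N + 1) ^ (l - k)) x) := by
    ext x
    rw [← sum_sigma_succ_mul_pow N l]
    simp only [quot]
    rw [← Finset.sum_subset (Finset.range_mono (show l + 1 ≤ N + 1 + 1 by omega)),
      ← Finset.sum_sub_distrib]
    · refine Finset.sum_congr rfl fun k hk => ?_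
      rw [Finset.mem_range] at hk
      simp only [Pi.mul_apply, Pi.sub_apply, Pi.pow_apply]
      rw [show N + 1 - k - (N + 1 - l) = l - k by omega]
      ring
    · intro k hk hk'
      rw [Finset.mem_range] at hk hk'
      rw [beta_eq_zero w (by omega)]; simp
  rw [e]
  refine IsBigO.fun_sum fun k hk => ?_
  rw [Finset.mem_range] at hk
  refine IsBigO.add (IsBigO.add ?_ ?_) ?_
  · refine Sym.isBigO ((hc k (by omega)).mul_le (hw.beta_sub_pow (by omega)) ?_)
    rw [Nat.cast_sub (by omega), Nat.cast_sub (by omega)]; linarith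
  · refine Sym.isBigO ((hc k (by omega)).mul_le (hw.pow_sub_pow hz hwz (l - k)) ?_)
    rw [Nat.cast_sub (by omega)]; linarith
  · refine (rpow_mul_isBigO (hs k (by omega)) (hz.pow (l - k)).isBigO).trans (rpow_isBigO ?_)
    rw [Nat.cast_sub (by omega)]; linarith

/-! ### Separated functions -/

/-- `d` is bounded below by `x^{-1+ε}`, with logarithmic derivative a symbol of order `-1`. -/
structure Sep (ε : ℝ) (d : ℝ → ℂ) : Prop where
  smooth : EvSmooth d
  ne_zero : ∀ᶠ x in atTop, d x ≠ 0
  inv : Sym (1 - ε) d⁻¹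
  logDeriv : Sym (-1) (d⁻¹ * deriv d)

/-- Write `d + e = d (1 + d⁻¹ e)` with `d⁻¹ e` of order `-ε`: the second factor tends to `1`. This
transfers separation from the roots to the Riccati solutions, which differ from them by symbols of
order `-1`. -/
theorem Sep.add {ε : ℝ} (hε : 0 < ε) {d e : ℝ → ℂ} (hd : Sep ε d) (he : Sym (-1) e) :
    Sep ε (d + e) := by
  have h1 : Sym (-ε) (d⁻¹ * e) := hd.inv.mul_le he (by linarith)
  obtain ⟨h2, h3⟩ := h1.one_add_inv (by linarith)
  have h4 : (d + e)⁻¹ =ᶠ[atTop] d⁻¹ * (1 + d⁻¹ * e)⁻¹ := by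
    filter_upwards [hd.ne_zero] with x hx
    simp only [Pi.inv_apply, Pi.add_apply, Pi.mul_apply, Pi.one_apply]
    rw [← mul_inv]; congr 1; field_simp
  have hi : Sym (1 - ε) (d + e)⁻¹ := (hd.inv.mul_le h3 (by linarith)).congr h4.symm
  refine ⟨hd.smooth.add he.evSmooth, ?_, hi, ?_⟩
  · filter_upwards [hd.ne_zero, h2] with x hx hx2
    have : (d + e) x = d x * (1 + d⁻¹ * e) x := by
      simp only [Pi.inv_apply, Pi.add_apply, Pi.mul_apply, Pi.one_apply]
      field_simp
    rw [this]; exact mul_ne_zero hx hx2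
  · have h5 : Sym (-1) (d⁻¹ * deriv d * (1 + d⁻¹ * e)⁻¹ + (d + e)⁻¹ * deriv e) :=
      (hd.logDeriv.mul_le h3 (by linarith)).add (hi.mul_le he.derivative (by linarith))
    refine h5.congr ?_
    filter_upwards [hd.smooth.differentiable, he.evSmooth.differentiable, h4] with x k1 k2 k3
    rw [Pi.mul_apply (d + e)⁻¹ (deriv (d + e)), deriv_add k1 k2, Pi.add_apply, Pi.mul_apply,
      Pi.mul_apply, Pi.mul_apply, k3, Pi.mul_apply]
    ring

/-! ### Composition with `D - w` on the right -/

/-- The coefficients of `D^k (D - w)`. -/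
def shiftCoeff (w : ℝ → ℂ) : ℕ → ℕ → ℝ → ℂ
  | 0, 0 => -w
  | 0, 1 => 1
  | 0, _ + 2 => 0
  | k + 1, 0 => D (shiftCoeff w k 0)
  | k + 1, i + 1 => D (shiftCoeff w k (i + 1)) + shiftCoeff w k i

theorem shiftCoeff_eq_zero (w : ℝ → ℂ) {k i : ℕ} (h : k + 1 < i) : shiftCoeff w k i = 0 := by
  induction k generalizing i with
  | zero => obtain ⟨i, rfl⟩ : ∃ j, i = j + 2 := ⟨i - 2, by omega⟩; rfl
  | succ k ih =>
    obtain ⟨i, rfl⟩ : ∃ j, i = j + 1 := ⟨i - 1, by omega⟩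
    simp only [shiftCoeff]
    rw [ih (by omega), ih (by omega), D_zero, add_zero]

theorem contDiff_D {f : ℝ → ℂ} (hf : ContDiff ℝ ∞ f) : ContDiff ℝ ∞ (D f) :=
  contDiff_const.mul (ContDiff.deriv_smooth hf)

theorem contDiff_D_iterate {f : ℝ → ℂ} (hf : ContDiff ℝ ∞ f) (k : ℕ) :
    ContDiff ℝ ∞ (D^[k] f) := by
  induction k with
  | zero => exact hf
  | succ k ih => rw [Function.iterate_succ_apply']; exact contDiff_D ih

theorem contDiff_shiftCoeff {w : ℝ → ℂ} (hw : ContDiff ℝ ∞ w) (k i : ℕ) :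
    ContDiff ℝ ∞ (shiftCoeff w k i) := by
  induction k generalizing i with
  | zero =>
    match i with
    | 0 => exact hw.neg
    | 1 => exact contDiff_const
    | _ + 2 => exact contDiff_const
  | succ k ih =>
    cases i with
    | zero => exact contDiff_D (ih 0)
    | succ i => exact (contDiff_D (ih (i + 1))).add (ih i)

theorem Sym.shiftCoeff {w : ℝ → ℂ} (hw : Sym 1 w) (k i : ℕ) : Sym 1 (shiftCoeff w k i) := by
  induction k generalizing i with
  | zero =>
    match i with
    | 0 => exact hw.neg
    | 1 => exact sym_one.mono (by norm_num)
    | _ + 2 => exact sym_zero _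
  | succ k ih =>
    cases i with
    | zero => exact (ih 0).D.mono (by norm_num)
    | succ i => exact ((ih (i + 1)).D.mono (by norm_num)).add (ih i)

theorem contDiff_firstOrder {w u : ℝ → ℂ} (hw : ContDiff ℝ ∞ w) (hu : ContDiff ℝ ∞ u) :
    ContDiff ℝ ∞ (firstOrder w u) := (contDiff_D hu).sub (hw.mul hu)

theorem D_iterate_firstOrder {w u : ℝ → ℂ} (hw : ContDiff ℝ ∞ w) (hu : ContDiff ℝ ∞ u) (k : ℕ) :
    D^[k] (firstOrder w u) = fun x => ∑ i ∈ Finset.range (k + 2), shiftCoeff w k i x *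
      (D^[i] u) x := by
  induction k with
  | zero =>
    ext x
    simp only [Function.iterate_zero, id, firstOrder, zero_add, Finset.sum_range_succ,
      Finset.range_zero, Finset.sum_empty, shiftCoeff, Pi.neg_apply, Pi.one_apply,
      Function.iterate_one]
    ring
  | succ k ih =>
    ext x
    have hd : ∀ i, DifferentiableAt ℝ (shiftCoeff w k i) x := fun i =>
      (contDiff_shiftCoeff hw k i).contDiffAt.differentiableAt (by simp)
    have hu' : ∀ i, DifferentiableAt ℝ (D^[i] u) x := fun i =>
      (contDiff_D_iterate hu i).contDiffAt.differentiableAt (by simp)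
    rw [Function.iterate_succ_apply', ih]
    have e : (fun x => ∑ i ∈ Finset.range (k + 2), shiftCoeff w k i x * (D^[i] u) x) =
      fun x => ∑ i ∈ Finset.range (k + 2), (shiftCoeff w k i * (D^[i] u)) x := rfl
    rw [e, D_sum fun i _ => (hd i).mul (hu' i)]
    simp only [D_mul (hd _) (hu' _), ← Function.iterate_succ_apply' D]
    rw [Finset.sum_add_distrib, Finset.sum_range_succ' (fun i => shiftCoeff w (k + 1) i x * _)]
    simp only [shiftCoeff, Pi.add_apply, add_mul]
    rw [Finset.sum_add_distrib, Finset.sum_range_succ' (fun i => D (shiftCoeff w k i) x * _) (k + 1),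
      Finset.sum_range_succ (fun i => D (shiftCoeff w k (i + 1)) x * _) (k + 1),
      shiftCoeff_eq_zero w (show k + 1 < k + 1 + 1 by omega), D_zero]
    simp only [Pi.zero_apply, zero_mul, Nat.succ_eq_add_one]
    ring

/-- The coefficients of `(∑_{k ≤ n} ρ_k D^{n-k}) (D - w)`. -/
def composeCoeff (w : ℝ → ℂ) (n : ℕ) (ρ : ℕ → ℝ → ℂ) (k : ℕ) : ℝ → ℂ := fun x =>
  ∑ j ∈ Finset.range (n + 1), ρ j x * shiftCoeff w (n - j) (n + 1 - k) x

theorem diffOp_firstOrder {w u : ℝ → ℂ} (hw : ContDiff ℝ ∞ w) (hu : ContDiff ℝ ∞ u) (n : ℕ)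
    (ρ : ℕ → ℝ → ℂ) (x : ℝ) :
    diffOp n ρ (firstOrder w u) x = diffOp (n + 1) (composeCoeff w n ρ) u x := by
  have h1 : ∀ k ∈ Finset.range (n + 1), ρ k x * (D^[n - k] (firstOrder w u)) x =
      ∑ i ∈ Finset.range (n + 1 + 1), ρ k x * shiftCoeff w (n - k) i x * (D^[i] u) x := by
    intro k _
    rw [D_iterate_firstOrder hw hu, Finset.mul_sum]
    refine (Finset.sum_subset (Finset.range_mono (by omega)) fun i _ hi => ?_).trans
      (Finset.sum_congr rfl fun i _ => by ring)
    rw [Finset.mem_range, not_lt] at hi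
    rw [shiftCoeff_eq_zero w (by omega)]; simp
  simp only [diffOp, composeCoeff]
  rw [Finset.sum_congr rfl h1, Finset.sum_comm, ← Finset.sum_range_reflect _ (n + 1 + 1)]
  refine Finset.sum_congr rfl fun l _ => ?_
  rw [Finset.sum_mul, show n + 1 + 1 - 1 - l = n + 1 - l by omega]

theorem Rapid.composeCoeff {w : ℝ → ℂ} (hw : Sym 1 w) {n : ℕ} {ρ : ℕ → ℝ → ℂ}
    (hρ : ∀ k ≤ n, Rapid (ρ k)) (k : ℕ) : Rapid (composeCoeff w n ρ k) :=
  Rapid.fun_sum fun j hj => (hρ j (by rw [Finset.mem_range] at hj; omega)).mul_sym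
    (hw.shiftCoeff _ _)

/-! ### Extraction of right factors -/

theorem diffOp_congr {n : ℕ} {c c' : ℕ → ℝ → ℂ} {u : ℝ → ℂ} {x : ℝ}
    (h : ∀ k ≤ n, c k x = c' k x) : diffOp n c u x = diffOp n c' u x :=
  Finset.sum_congr rfl fun k hk => by rw [h k (by rw [Finset.mem_range] at hk; omega)]

theorem prodOp_congr {η η' : ℕ → ℝ → ℂ} {r n : ℕ} (h : ∀ j ∈ Finset.Icc (r + 1) (r + n),
    η j = η' j) (u : ℝ → ℂ) : prodOp η r n u = prodOp η' r n u := by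
  induction n generalizing u with
  | zero => rfl
  | succ n ih =>
    simp only [prodOp]
    rw [h (r + n + 1) (by simp), ih fun j hj => h j (by simp at hj ⊢; omega)]

theorem Rapid.of_mul {t : ℝ} {g f : ℝ → ℂ} (h : Rapid (g * f)) (h0 : ∀ᶠ x in atTop, g x ≠ 0)
    (hg : Sym t g⁻¹) : Rapid f := by
  refine (h.mul_sym hg).congr ?_
  filter_upwards [h0] with x hx
  simp only [Pi.mul_apply, Pi.inv_apply]; field_simp

/-- If `V` and `w` are approximate Riccati solutions for an operator, then
`V + (V - w)⁻¹ D (V - w)` is one for the quotient of the operator by `D - w`. -/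
theorem rapid_connOp_quot {ε : ℝ} {V w : ℝ → ℂ} (hV : Sym 1 V) (hw : ContDiff ℝ ∞ w)
    (hd : Sep ε (V - w)) (N : ℕ) (c : ℕ → ℝ → ℂ) (h1 : Rapid (connOp V (N + 1) c 1))
    (h2 : Rapid (quot w (N + 1) c (N + 1))) :
    Rapid (connOp (V + (V - w)⁻¹ * D (V - w)) N (quot w (N + 1) c) 1) := by
  refine Rapid.of_mul (g := V - w) ((h1.sub h2).congr ?_) hd.ne_zero hd.inv
  obtain ⟨X, hX⟩ := eventually_atTop.1 (hV.evSmooth.and hd.ne_zero)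
  filter_upwards [eventually_gt_atTop X] with x hx
  have hU : IsOpen (Set.Ioi X) := isOpen_Ioi
  have sV : SmoothOn (Set.Ioi X) V := fun y hy => (hX y (le_of_lt hy)).1
  have sw : SmoothOn (Set.Ioi X) w := hw.smoothOn _
  -- Applied to `f = 1`, the division formula feeds `(D + V - w) 1 = V - w` to the quotient;
  -- conjugating by this function changes `V` into the new potential.
  have e : conn V 1 - w * 1 = (V - w) * 1 := by
    ext y; simp [conn, D_one]
  rw [Pi.sub_apply, connOp_succ_eq hU sV sw SmoothOn.one N c hx, e,
    connOp_mul hU sV (sV.sub sw) SmoothOn.one (fun y hy => (hX y (le_of_lt hy)).2) _ _ hx]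
  simp

theorem conn_iterate_congr {V V' : ℝ → ℂ} (h : V =ᶠ[atTop] V') (f : ℝ → ℂ) (k : ℕ) :
    (conn V)^[k] f =ᶠ[atTop] (conn V')^[k] f := by
  induction k with
  | zero => exact EventuallyEq.refl _ _
  | succ k ih =>
    rw [Function.iterate_succ_apply', Function.iterate_succ_apply']
    filter_upwards [h, ih, EventuallyEq.deriv_atTop ih] with x h1 h2 h3
    simp only [conn, D, h1, h2, h3]

/-- Successive extraction of approximate right factors. -/
theorem exists_factorization {ε : ℝ} (hε : 0 < ε) (r : ℕ) (ξ : ℕ → ℝ → ℂ) (n : ℕ)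
    (c W : ℕ → ℝ → ℂ) (hξ : ∀ j ∈ Finset.Icc (r + 1) (r + n), Sym 1 (ξ j))
    (hsep : ∀ j ∈ Finset.Icc (r + 1) (r + n), ∀ k ∈ Finset.Icc (r + 1) (r + n), j ≠ k →
      Sep ε (ξ j - ξ k))
    (h0 : c 0 = 1) (hc : ∀ k ≤ r + n, Sym k (c k))
    (hs : ∀ k ≤ r + n, (fun x => c k x - sigma (r + n) k (fun i => ξ i x))
      =O[atTop] fun x : ℝ => x ^ ((k : ℝ) - 2))
    (hW : ∀ j ∈ Finset.Icc (r + 1) (r + n), Sym (-1) (W j - ξ j))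
    (hR : ∀ j ∈ Finset.Icc (r + 1) (r + n), Rapid (connOp (W j) (r + n) c 1)) :
    ∃ η ρ : ℕ → ℝ → ℂ, η 0 = 1 ∧
      (∀ k ∈ Finset.Icc 1 r, IsSymbol k (η k) ∧
        (fun x => η k x - sigma r k (fun i => ξ i x)) =O[atTop] fun x : ℝ => x ^ ((k : ℝ) - 2)) ∧
      (∀ j ∈ Finset.Icc (r + 1) (r + n), IsSymbol 1 (η j) ∧ Sym (-1) (η j - ξ j)) ∧
      (∀ k ≤ r + n, Rapid (ρ k)) ∧
      ∃ X : ℝ, ∀ u, ContDiff ℝ ∞ u → ∀ x, X < x →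
        diffOp (r + n) c u x = diffOp r η (prodOp η r n u) x + diffOp (r + n) ρ u x := by
  induction n generalizing c W with
  | zero =>
    have hg : ∀ k, ∃ g : ℝ → ℂ, k ≤ r → c k =ᶠ[atTop] g ∧ IsSymbol k g := by
      intro k
      by_cases hk : k ≤ r
      · obtain ⟨g, h⟩ := (hc k hk).exists_isSymbol
        exact ⟨g, fun _ => h⟩
      · exact ⟨0, fun h => absurd h hk⟩
    choose g hg using hg
    have hev : ∀ᶠ x in atTop, ∀ k ∈ Finset.range (r + 1), c k x = g k x :=
      (Finset.eventually_all _).2 fun k hk =>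
        (hg k (by rw [Finset.mem_range] at hk; omega)).1
    obtain ⟨X, hX⟩ := eventually_atTop.1 hev
    -- The leading coefficient is set to `1` by hand, since its global extension equals `1` only
    -- near `+∞`.
    refine ⟨fun k => if k = 0 then 1 else g k, 0, by simp, ?_, ?_, fun k _ => rapid_zero, X, ?_⟩
    · intro k hk
      obtain ⟨hk1, hkr⟩ := Finset.mem_Icc.1 hk
      simp only [show k ≠ 0 by omega, if_false]
      refine ⟨(hg k hkr).2, (hs k hkr).congr' ?_ (EventuallyEq.refl _ _)⟩
      filter_upwards [(hg k hkr).1] with x hx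
      rw [hx, add_zero]
    · intro j hj; simp at hj
    · intro u _ x hx
      have e2 : diffOp (r + 0) (0 : ℕ → ℝ → ℂ) u x = 0 := by simp [diffOp]
      rw [e2]
      simp only [prodOp, add_zero]
      refine diffOp_congr fun k hk => ?_
      by_cases h : k = 0
      · simp [h, h0]
      · rw [if_neg h]
        exact hX x hx.le k (by rw [Finset.mem_range]; omega)
  | succ n ih =>
    have hN : r + (n + 1) ∈ Finset.Icc (r + 1) (r + (n + 1)) := by simp
    have hsub : ∀ {j}, j ∈ Finset.Icc (r + 1) (r + n) → j ∈ Finset.Icc (r + 1) (r + (n + 1)) := by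
      intro j hj; simp at hj ⊢; omega
    have hW1 : ∀ j ∈ Finset.Icc (r + 1) (r + (n + 1)), Sym 1 (W j) := fun j hj =>
      ((hW j hj).mono (by norm_num)).of_sub (hξ j hj)
    -- A globally smooth representative is needed: the induction hypothesis is applied to `(D - w)
    -- u`, which has to be smooth on all of `ℝ`.
    obtain ⟨w, hwe, hw⟩ := (hW1 _ hN).exists_isSymbol
    have hwsm : ContDiff ℝ ∞ w := hw.1
    have hw1 : Sym 1 w := (hW1 _ hN).congr hwe
    have hwξ : Sym (-1) (w - ξ (r + n + 1)) := (hW _ hN).congr (hwe.sub (EventuallyEq.refl _ _))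
    have hρ0 : Rapid (quot w (r + n + 1) c (r + n + 1)) := by
      refine (hR _ hN).congr ?_
      have : ∀ᶠ x in atTop, ∀ k ∈ Finset.range (r + n + 1 + 1),
          ((conn (W (r + (n + 1))))^[r + n + 1 - k] 1) x = ((conn w)^[r + n + 1 - k] 1) x :=
        (Finset.eventually_all _).2 fun k _ => conn_iterate_congr hwe 1 _
      filter_upwards [this] with x hx
      simp only [connOp, quot]
      refine Finset.sum_congr rfl fun k hk => ?_
      rw [Nat.sub_self, beta_zero_right, ← hx k hk]; rfl
    set q := quot w (r + n + 1) c with hq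
    have hsepW : ∀ j ∈ Finset.Icc (r + 1) (r + n), Sep ε (W j - w) := by
      intro j hj
      have hne : j ≠ r + (n + 1) := by simp at hj; omega
      have h := (hsep j (hsub hj) _ hN hne).add hε ((hW j (hsub hj)).sub hwξ)
      have e : ξ j - ξ (r + (n + 1)) + (W j - ξ j - (w - ξ (r + n + 1))) = W j - w := by
        rw [show r + (n + 1) = r + n + 1 by omega]; ring
      rwa [e] at h
    have q0 : q 0 = 1 := by
      ext x
      rw [hq, quot, Finset.sum_eq_single 0]
      · rw [h0, Nat.sub_zero, beta_self]; simp
      · intro k hk hk0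
        rw [Finset.mem_range] at hk
        rw [beta_eq_zero w (by omega)]; simp
      · simp
    -- Conjugation adds `-i` times a logarithmic derivative, of order `-1`, so the new solution
    -- stays as close to `ξ j` as required.
    have hW' : ∀ j ∈ Finset.Icc (r + 1) (r + n),
        Sym (-1) (W j + (W j - w)⁻¹ * D (W j - w) - ξ j) := by
      intro j hj
      have h := (hW j (hsub hj)).add ((hsepW j hj).logDeriv.const_mul (-Complex.I))
      refine h.congr (Eventually.of_forall fun x => ?_)
      simp only [Pi.add_apply, Pi.sub_apply, Pi.mul_apply, D]; ring
    obtain ⟨η, ρ, i1, i2, i3, i4, X, i5⟩ := ih q (fun j => W j + (W j - w)⁻¹ * D (W j - w))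
      (fun j hj => hξ j (hsub hj)) (fun j hj k hk => hsep j (hsub hj) k (hsub hk)) q0
      (fun k hk => hw1.quot hc (by omega))
      (fun k hk => quot_sub_sigma_isBigO hw1 (hξ _ hN) hwξ hc hs hk) hW'
      (fun j hj => rapid_connOp_quot (hW1 j (hsub hj)) hwsm (hsepW j hj) (r + n) c
        (hR j (hsub hj)) hρ0)
    -- The new remainder is the old one composed with `D - w`, plus the remainder of the division.
    -- The latter is a multiplication operator and goes to the last index, that of `D^0`.
    refine ⟨Function.update η (r + n + 1) w, fun k => composeCoeff w (r + n) ρ k +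
      if k = r + n + 1 then q (r + n + 1) else 0, ?_, ?_, ?_, ?_, X, ?_⟩
    · rw [Function.update_of_ne (by omega), i1]
    · intro k hk
      rw [Function.update_of_ne (by simp at hk; omega)]
      exact i2 k hk
    · intro j hj
      by_cases h : j = r + n + 1
      · subst h; rw [Function.update_self]; exact ⟨hw, hwξ⟩
      · rw [Function.update_of_ne h]
        exact i3 j (by simp at hj ⊢; omega)
    · intro k _
      refine (Rapid.composeCoeff hw1 i4 k).add ?_
      split_ifs
      · exact hρ0
      · exact rapid_zero
    · intro u hu x hx
      have e1 : diffOp (r + (n + 1)) c u x = q (r + n + 1) x * u x +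
          diffOp (r + n) q (firstOrder w u) x := by
        have := connOp_succ_eq isOpen_univ (SmoothOn.zero (U := Set.univ)) (hwsm.smoothOn _)
          (hu.smoothOn _) (r + n) c (Set.mem_univ x)
        rw [connOp_zero, connOp_zero, conn_zero] at this
        exact this
      rw [e1, i5 _ (contDiff_firstOrder hwsm hu) x hx, diffOp_firstOrder hwsm hu]
      have e2 : diffOp r (Function.update η (r + n + 1) w) (prodOp (Function.update η (r + n + 1) w)
          r (n + 1) u) x = diffOp r η (prodOp η r n (firstOrder w u)) x := by
        simp only [prodOp, Function.update_self]
        rw [prodOp_congr (η := Function.update η (r + n + 1) w) (η' := η)]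
        · refine diffOp_congr fun k hk => ?_
          rw [Function.update_of_ne (by omega)]
        · intro j hj
          rw [Function.update_of_ne (by simp at hj; omega)]
      have e3 : diffOp (r + (n + 1)) (fun k => composeCoeff w (r + n) ρ k +
          if k = r + n + 1 then q (r + n + 1) else 0) u x =
          diffOp (r + n + 1) (composeCoeff w (r + n) ρ) u x + q (r + n + 1) x * u x := by
        simp only [diffOp, Pi.add_apply, add_mul, Finset.sum_add_distrib]
        rw [show r + (n + 1) = r + n + 1 by omega]
        congr 1
        rw [Finset.sum_eq_single (r + n + 1)]
        · simp
        · intro k _ hk; simp [hk]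
        · simp
      rw [e2, e3]; ring

/-! ### Logarithmic derivatives -/

theorem hasDerivAt_mul_log {f g : ℝ → ℂ} {a b : ℂ} {x : ℝ} (hf : HasDerivAt f (f x * a) x)
    (hg : HasDerivAt g (g x * b) x) : HasDerivAt (f * g) ((f * g) x * (a + b)) x := by
  refine (hf.mul hg).congr_deriv ?_
  simp only [Pi.mul_apply]; ring

theorem hasDerivAt_pow_log {f : ℝ → ℂ} {a : ℂ} {x : ℝ} (hf : HasDerivAt f (f x * a) x) (n : ℕ) :
    HasDerivAt (f ^ n) ((f ^ n) x * (n * a)) x := by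
  induction n with
  | zero =>
    rw [pow_zero]
    exact (hasDerivAt_const x (1 : ℂ)).congr_deriv (by simp)
  | succ n ih =>
    rw [pow_succ]
    refine (hasDerivAt_mul_log ih hf).congr_deriv ?_
    push_cast; ring

theorem hasDerivAt_inv_log {f : ℝ → ℂ} {a : ℂ} {x : ℝ} (hf : HasDerivAt f (f x * a) x)
    (h0 : f x ≠ 0) : HasDerivAt f⁻¹ (f⁻¹ x * (-a)) x := by
  refine (hf.inv h0).congr_deriv ?_
  simp only [Pi.inv_apply]; field_simp

theorem hasDerivAt_ix_log {x : ℝ} (hx : cx x ≠ 0) : HasDerivAt ix (ix x * (-ix x)) x := by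
  refine ((hasDerivAt_cx x).inv hx).congr_deriv ?_
  simp only [ix, cx] at hx ⊢; field_simp

/-! ### Polynomials as symbols -/

/-- The function of a real variable defined by a complex polynomial. -/
def ev (c : Polynomial ℂ) : ℝ → ℂ := fun x => c.eval (x : ℂ)

theorem hasDerivAt_ev (c : Polynomial ℂ) (x : ℝ) :
    HasDerivAt (ev c) (ev (Polynomial.derivative c) x) x :=
  (c.hasDerivAt (x : ℂ)).comp_ofReal

theorem deriv_ev (c : Polynomial ℂ) : deriv (ev c) = ev (Polynomial.derivative c) := by
  ext x; exact (hasDerivAt_ev c x).deriv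

theorem sym_ev {c : Polynomial ℂ} {d : ℕ} (h : c.natDegree ≤ d) : Sym d (ev c) := by
  have e : ev c = fun x => ∑ i ∈ Finset.range (d + 1), (fun x => c.coeff i * (cx ^ i) x) x := by
    ext x
    simp only [ev]
    rw [Polynomial.eval_eq_sum_range' (Nat.lt_succ_of_le h)]
    rfl
  rw [e]
  refine Sym.fun_sum fun i hi => ((sym_cx_pow i).const_mul _).mono ?_
  rw [Finset.mem_range] at hi
  exact_mod_cast Nat.lt_succ_iff.1 hi

theorem sym_ev_derivative {c : Polynomial ℂ} {s : ℝ} (h : Sym s (ev c)) (γ : ℕ) :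
    Sym (s - γ) (ev (Polynomial.derivative^[γ] c)) := by
  induction γ with
  | zero => simpa using h
  | succ γ ih =>
    rw [Function.iterate_succ_apply', ← deriv_ev]
    exact ih.derivative.mono (by push_cast; linarith)

/-- Factor out the leading term: the polynomial is a monomial times `1` plus a symbol of order `-1`.
-/
theorem ev_inv {c : Polynomial ℂ} (h : c ≠ 0) :
    (∀ᶠ x in atTop, ev c x ≠ 0) ∧ Sym (-(c.natDegree : ℝ)) (ev c)⁻¹ := by
  set d := c.natDegree with hd
  have hl : c.leadingCoeff ≠ 0 := by simpa using h
  have h1 : Sym ((d : ℝ) - 1) (ev c.eraseLead) := by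
    rcases Nat.eq_zero_or_pos d with h0 | h0
    · have : c.eraseLead = 0 := by
        obtain ⟨a, ha⟩ := Polynomial.natDegree_eq_zero.1 (hd ▸ h0)
        rw [← ha]; simp
      have e : ev c.eraseLead = 0 := by ext x; simp [ev, this]
      rw [e]; exact sym_zero _
    · have := sym_ev (c := c.eraseLead) (d := d - 1) c.eraseLead_natDegree_le
      rwa [Nat.cast_sub h0, Nat.cast_one] at this
  have h2 : Sym (-1) (fun x => c.leadingCoeff⁻¹ * (ix ^ d * ev c.eraseLead) x) :=
    ((sym_ix_pow d).mul_le h1 (by linarith)).const_mul _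
  obtain ⟨h3, h4⟩ := h2.one_add_inv (by norm_num)
  have e : ∀ᶠ x in atTop, ev c x = c.leadingCoeff * (cx ^ d) x *
      (1 + fun x => c.leadingCoeff⁻¹ * (ix ^ d * ev c.eraseLead) x) x := by
    filter_upwards [cx_ne_zero] with x hx
    have : ev c x = ev c.eraseLead x + c.leadingCoeff * (x:ℂ) ^ d := by
      conv_lhs => rw [ev, ← c.eraseLead_add_C_mul_X_pow]
      simp only [ev, hd, Polynomial.eval_add, Polynomial.eval_mul, Polynomial.eval_C,
        Polynomial.eval_pow, Polynomial.eval_X]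
    rw [this]
    simp only [Pi.add_apply, Pi.one_apply, Pi.mul_apply, Pi.pow_apply, ix, inv_pow]
    simp only [cx] at hx ⊢
    field_simp
    ring
  refine ⟨?_, ?_⟩
  · filter_upwards [e, h3, cx_ne_zero] with x k1 k2 k3
    rw [k1]
    exact mul_ne_zero (mul_ne_zero hl (pow_ne_zero _ k3)) k2
  · have := ((sym_ix_pow d).mul_le h4 (r := -(d:ℝ)) (by linarith)).const_mul c.leadingCoeff⁻¹
    refine this.congr ?_
    filter_upwards [e, cx_ne_zero] with x k1 k3
    rw [Pi.inv_apply, k1, Pi.mul_apply, Pi.inv_apply, mul_inv, mul_inv]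
    simp only [Pi.pow_apply, ix, cx, inv_pow]
    ring

/-- The multiplicative form, in place of a quotient by `ev c`, also covers the zero polynomial,
which may occur among the coefficients. -/
theorem ev_derivative_eq (c : Polynomial ℂ) (γ : ℕ) : ∃ s, Sym 0 s ∧
    ev (Polynomial.derivative^[γ] c) =ᶠ[atTop] ix ^ γ * s * ev c := by
  by_cases h : c = 0
  · refine ⟨0, sym_zero 0, Eventually.of_forall fun x => ?_⟩
    subst h
    simp [ev]
  · obtain ⟨h0, h1⟩ := ev_inv h
    refine ⟨cx ^ γ * ev (Polynomial.derivative^[γ] c) * (ev c)⁻¹, ?_, ?_⟩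
    · exact ((sym_cx_pow γ).mul (sym_ev_derivative (sym_ev le_rfl) γ)).mul_le h1 (by linarith)
    · filter_upwards [h0, cx_ne_zero] with x k1 k2
      simp only [Pi.mul_apply, Pi.pow_apply, Pi.inv_apply, ix, inv_pow]
      simp only [cx] at k2 ⊢
      field_simp

/-! ### Symbol estimates for a root -/

theorem SymN.sum {ι : Type*} {S : Finset ι} {N : ℕ} {s : ℝ} {f : ι → ℝ → ℂ}
    (h : ∀ i ∈ S, SymN N s (f i)) : SymN N s (∑ i ∈ S, f i) := by
  classical
  induction S using Finset.induction_on with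
  | empty => simpa using sym_zero s N
  | insert a S ha ih =>
    rw [Finset.sum_insert ha]
    exact (h a (by simp)).add (ih fun i hi => h i (by simp [hi]))

theorem SymN.sub {n : ℕ} {s : ℝ} {f g : ℝ → ℂ} (hf : SymN n s f) (hg : SymN n s g) :
    SymN n s (f - g) := by
  have := hf.add (SymN.of_sym_mul (sym_const (-1)) hg)
  refine this.congr (Eventually.of_forall fun x => ?_)
  simp [sub_eq_add_neg]

theorem SymN.mul_zero_zero {n : ℕ} {f g : ℝ → ℂ} (hf : SymN n 0 f) (hg : SymN n 0 g) :
    SymN n 0 (f * g) := (hf.mul hg).mono le_rfl (by simp)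

theorem sym_natCast (n : ℕ) : Sym 0 (n : ℝ → ℂ) := sym_const (n : ℂ)

/-- A root `z` of the polynomial `∑_{n ≤ m} c_n z^n`, whose coefficients have the logarithmic
derivatives `s_n / x`, such that the derivative `π` of the polynomial at the root dominates its
terms, with a gain of `x^{-εe}` when `e` powers of `z` are replaced by powers of `x⁻¹`. -/
structure RootData (ε : ℝ) (m : ℕ) (c s : ℕ → ℝ → ℂ) (z : ℝ → ℂ) : Prop where
  smooth : EvSmooth z
  isBigO : z =O[atTop] fun x : ℝ => x ^ (1 : ℝ)
  coeff_sym : ∀ n ≤ m, Sym m (c n)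
  coeff_log_sym : ∀ n, Sym 0 (s n)
  coeff_deriv : ∀ n ≤ m, ∀ᶠ x in atTop, HasDerivAt (c n) (c n x * (ix x * s n x)) x
  root : ∀ᶠ x in atTop, ∑ n ∈ Finset.range (m + 1), c n x * z x ^ n = 0
  ne_zero : ∀ᶠ x in atTop, (∑ n ∈ Finset.range m, (n + 1 : ℂ) * c (n + 1) x * z x ^ n) ≠ 0
  bound : ∀ r e, r + 1 + e ≤ m → (fun x => c (r + 1 + e) x * z x ^ r * ix x ^ e *
    (∑ n ∈ Finset.range m, (n + 1 : ℂ) * c (n + 1) x * z x ^ n)⁻¹)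
      =O[atTop] fun x : ℝ => x ^ (-(ε * e))

namespace RootData

variable {ε : ℝ} {m : ℕ} {c s : ℕ → ℝ → ℂ} {z : ℝ → ℂ}

/-- The derivative of the polynomial at the root. -/
def slope (m : ℕ) (c : ℕ → ℝ → ℂ) (z : ℝ → ℂ) : ℝ → ℂ :=
  fun x => ∑ n ∈ Finset.range m, (n + 1 : ℂ) * c (n + 1) x * z x ^ n

/-- The ratios of the terms of the polynomial to its derivative at the root. -/
def ratio (m : ℕ) (c : ℕ → ℝ → ℂ) (z : ℝ → ℂ) (r e : ℕ) : ℝ → ℂ :=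
  c (r + 1 + e) * z ^ r * ix ^ e * (slope m c z)⁻¹

/-- `x` times the logarithmic derivative of the root. -/
def rootLog (m : ℕ) (c s : ℕ → ℝ → ℂ) (z : ℝ → ℂ) : ℝ → ℂ :=
  ∑ n ∈ Finset.range m, (s 0 - s (n + 1)) * ratio m c z n 0

/-- `x` times the logarithmic derivative of the slope. -/
def slopeLog (m : ℕ) (c s : ℕ → ℝ → ℂ) (z : ℝ → ℂ) : ℝ → ℂ :=
  ∑ n ∈ Finset.range m, ((n + 1 : ℕ) : ℝ → ℂ) * ratio m c z n 0 *
    (s (n + 1) + (n : ℝ → ℂ) * rootLog m c s z)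

/-- Implicit differentiation of the root equation. Subtracting `s_0 / x` times the equation itself
kills the term `n = 0`, so that a factor `z` comes out. The formula is not divided by `z`, which may
vanish. -/
theorem hasDerivAt_root (H : RootData ε m c s z) :
    ∀ᶠ x in atTop, HasDerivAt z (z x * (ix x * rootLog m c s z x)) x := by
  have hc : ∀ᶠ x in atTop, ∀ n ∈ Finset.range (m + 1),
      HasDerivAt (c n) (c n x * (ix x * s n x)) x :=
    (Finset.eventually_all _).2 fun n hn =>
      H.coeff_deriv n (by rw [Finset.mem_range] at hn; omega)
  filter_upwards [H.smooth.differentiable, hc, eventually_atTop_nhds H.root, H.ne_zero]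
    with x hz hc hr h0
  have hz' := hz.hasDerivAt
  set p := deriv z x with hp
  have h1 : HasDerivAt (fun x => ∑ n ∈ Finset.range (m + 1), c n x * z x ^ n)
      (∑ n ∈ Finset.range (m + 1), (c n x * (ix x * s n x) * z x ^ n +
        c n x * (n * z x ^ (n - 1) * p))) x :=
    HasDerivAt.fun_sum fun n hn => (hc n hn).mul (hz'.pow n)
  have h2 : HasDerivAt (fun x => ∑ n ∈ Finset.range (m + 1), c n x * z x ^ n) 0 x :=
    (hasDerivAt_const x (0:ℂ)).congr_of_eventuallyEq hr
  have h3 := h1.unique h2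
  rw [Finset.sum_add_distrib, Finset.sum_range_succ' (fun n => c n x * (n * z x ^ (n - 1) * p))]
    at h3
  set π := ∑ n ∈ Finset.range m, (n + 1 : ℂ) * c (n + 1) x * z x ^ n with hπ
  have h4 : ∑ n ∈ Finset.range m, c (n + 1) x * (((n + 1 : ℕ) : ℂ) * z x ^ (n + 1 - 1) * p) =
      π * p := by
    rw [hπ, Finset.sum_mul]
    refine Finset.sum_congr rfl fun n _ => ?_
    rw [Nat.add_sub_cancel]; push_cast; ring
  rw [h4, Finset.sum_range_succ'] at h3
  have hr0 := hr.self_of_nhds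
  rw [Finset.sum_range_succ'] at hr0
  have h5 : π * (z x * (ix x * rootLog m c s z x)) =
      ix x * ∑ n ∈ Finset.range m, (s 0 x - s (n + 1) x) * (c (n + 1) x * z x ^ (n + 1)) := by
    simp only [rootLog, Finset.sum_apply, Finset.mul_sum]
    refine Finset.sum_congr rfl fun n _ => ?_
    have e : slope m c z x = π := rfl
    simp only [ratio, Pi.mul_apply, Pi.sub_apply, Pi.pow_apply, Pi.inv_apply, e, pow_zero,
      add_zero, mul_one, pow_succ (z x) n]
    field_simp
  have h6 : π * p = π * (z x * (ix x * rootLog m c s z x)) := by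
    rw [h5]
    simp only [sub_mul, Finset.sum_sub_distrib, ← Finset.mul_sum]
    have e1 : ∑ n ∈ Finset.range m, c (n + 1) x * (ix x * s (n + 1) x) * z x ^ (n + 1) =
        ix x * ∑ n ∈ Finset.range m, s (n + 1) x * (c (n + 1) x * z x ^ (n + 1)) := by
      rw [Finset.mul_sum]; exact Finset.sum_congr rfl fun n _ => by ring
    rw [e1] at h3
    simp only [pow_zero, mul_one, Nat.cast_zero, zero_mul, mul_zero, add_zero] at h3 hr0
    linear_combination h3 - ix x * s 0 x * hr0
  rw [← mul_left_cancel₀ h0 h6]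
  exact hz'

theorem hasDerivAt_slope (H : RootData ε m c s z) :
    ∀ᶠ x in atTop, HasDerivAt (slope m c z) (slope m c z x * (ix x * slopeLog m c s z x)) x := by
  have hc : ∀ᶠ x in atTop, ∀ n ∈ Finset.range m,
      HasDerivAt (c (n + 1)) (c (n + 1) x * (ix x * s (n + 1) x)) x :=
    (Finset.eventually_all _).2 fun n hn =>
      H.coeff_deriv _ (by rw [Finset.mem_range] at hn; omega)
  filter_upwards [H.hasDerivAt_root, hc, H.ne_zero] with x hz hc h0
  have h1 : HasDerivAt (fun y => ∑ n ∈ Finset.range m, (n + 1 : ℂ) * (c (n + 1) * z ^ n) y)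
      (∑ n ∈ Finset.range m, (n + 1 : ℂ) * ((c (n + 1) * z ^ n) x *
        (ix x * s (n + 1) x + n * (ix x * rootLog m c s z x)))) x :=
    HasDerivAt.fun_sum fun n hn =>
      (hasDerivAt_mul_log (hc n hn) (hasDerivAt_pow_log hz n)).const_mul _
  have e : slope m c z = fun y => ∑ n ∈ Finset.range m, (n + 1 : ℂ) * (c (n + 1) * z ^ n) y := by
    ext y; simp [slope, mul_assoc]
  have e2 : slope m c z x * (ix x * slopeLog m c s z x) = ∑ n ∈ Finset.range m,
      (n + 1 : ℂ) * ((c (n + 1) * z ^ n) x *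
        (ix x * s (n + 1) x + n * (ix x * rootLog m c s z x))) := by
    simp only [slopeLog, Finset.sum_apply, Finset.mul_sum]
    refine Finset.sum_congr rfl fun n _ => ?_
    have h0' : slope m c z x ≠ 0 := h0
    simp only [ratio, Pi.mul_apply, Pi.add_apply, Pi.pow_apply, Pi.inv_apply, Pi.natCast_apply,
      pow_zero, mul_one, add_zero]
    push_cast
    field_simp
  rw [e2, e]
  exact h1

theorem hasDerivAt_ratio (H : RootData ε m c s z) {r e : ℕ} (h : r + 1 + e ≤ m) :
    ∀ᶠ x in atTop, HasDerivAt (ratio m c z r e) (ratio m c z r e x * (ix x *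
      (s (r + 1 + e) x + r * rootLog m c s z x - e - slopeLog m c s z x))) x := by
  filter_upwards [H.hasDerivAt_root, H.hasDerivAt_slope, H.coeff_deriv _ h, H.ne_zero, cx_ne_zero]
    with x h1 h2 h3 h4 h5
  have := hasDerivAt_mul_log (hasDerivAt_mul_log (hasDerivAt_mul_log h3 (hasDerivAt_pow_log h1 r))
    (hasDerivAt_pow_log (hasDerivAt_ix_log h5) e)) (hasDerivAt_inv_log h2 h4)
  refine this.congr_deriv ?_
  simp only [ratio]
  ring

theorem evSmooth_slope (H : RootData ε m c s z) : EvSmooth (slope m c z) := by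
  have hc : ∀ᶠ x in atTop, ∀ n ∈ Finset.range m, ContDiffAt ℝ ∞ (c (n + 1)) x :=
    (Finset.eventually_all _).2 fun n hn =>
      (H.coeff_sym _ (by rw [Finset.mem_range] at hn; omega)).evSmooth
  filter_upwards [H.smooth, hc] with x hz hc
  exact ContDiffAt.sum fun n hn => (contDiffAt_const.mul (hc n hn)).mul (hz.pow n)

theorem evSmooth_ratio (H : RootData ε m c s z) {r e : ℕ} (h : r + 1 + e ≤ m) :
    EvSmooth (ratio m c z r e) := by
  filter_upwards [H.smooth, (H.coeff_sym _ h).evSmooth, H.evSmooth_slope, H.ne_zero, evSmooth_ix]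
    with x h1 h2 h3 h4 h5
  exact ((h2.mul (h1.pow r)).mul (h5.pow e)).mul (h3.inv h4)

/-- The ratios with `e = 0` form a closed system: the logarithmic derivative of each is `1/x` times
a polynomial in all of them and in the `s n`. Boundedness thus propagates to one more derivative at
a time, for all indices at once. -/
theorem sym_ratio_zero (H : RootData ε m c s z) {n : ℕ} (hn : n < m) :
    Sym 0 (ratio m c z n 0) := by
  intro N
  induction N generalizing n with
  | zero =>
    refine symN_zero.2 ⟨H.evSmooth_ratio (by omega), ?_⟩
    have := H.bound n 0 (by omega)
    simp only [Nat.cast_zero, mul_zero, neg_zero] at this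
    exact this
  | succ N ih =>
    have h0 : SymN 0 0 (ratio m c z n 0) := (ih hn).mono (Nat.zero_le _) le_rfl
    refine symN_succ.2 ⟨h0, ?_⟩
    have hh : SymN N 0 (rootLog m c s z) := SymN.sum fun k hk =>
      (((H.coeff_log_sym 0).sub (H.coeff_log_sym (k + 1))) N).mul_zero_zero
        (ih (Finset.mem_range.1 hk))
    have ht : SymN N 0 (slopeLog m c s z) := SymN.sum fun k hk =>
      ((sym_natCast (k + 1) N).mul_zero_zero (ih (Finset.mem_range.1 hk))).mul_zero_zero
        ((H.coeff_log_sym (k + 1) N).add ((sym_natCast k N).mul_zero_zero hh))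
    have h1 := (sym_ix N).mul ((ih hn).mul_zero_zero
      (((H.coeff_log_sym (n + 1) N).add ((sym_natCast n N).mul_zero_zero hh)).sub ht))
    refine (h1.mono le_rfl (by norm_num)).congr ?_
    filter_upwards [H.hasDerivAt_ratio (r := n) (e := 0) (by omega)] with x hx
    rw [hx.deriv]
    simp only [Pi.mul_apply, Pi.sub_apply, Pi.add_apply, Pi.natCast_apply, Nat.cast_zero, add_zero]
    ring

theorem sym_rootLog (H : RootData ε m c s z) : Sym 0 (rootLog m c s z) :=
  Sym.sum fun k hk => ((H.coeff_log_sym 0).sub (H.coeff_log_sym (k + 1))).mul_le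
    (H.sym_ratio_zero (Finset.mem_range.1 hk)) (by simp)

theorem sym_slopeLog (H : RootData ε m c s z) : Sym 0 (slopeLog m c s z) :=
  Sym.sum fun k hk => ((sym_natCast (k + 1)).mul_le (H.sym_ratio_zero (Finset.mem_range.1 hk))
    (r := 0) (by simp)).mul_le ((H.coeff_log_sym (k + 1)).add
      ((sym_natCast k).mul_le H.sym_rootLog (by simp))) (by simp)

theorem sym_ratio (H : RootData ε m c s z) {r e : ℕ} (h : r + 1 + e ≤ m) :
    Sym (-(ε * e)) (ratio m c z r e) := by
  have h1 : Sym 0 (s (r + 1 + e) + (r : ℝ → ℂ) * rootLog m c s z - (e : ℝ → ℂ) -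
      slopeLog m c s z) :=
    (((H.coeff_log_sym _).add ((sym_natCast r).mul_le H.sym_rootLog (by simp))).sub
      (sym_natCast e)).sub H.sym_slopeLog
  refine Sym.of_logDeriv (H.evSmooth_ratio h) (H.bound r e h) (sym_ix.mul_le h1 (by simp)) ?_
  filter_upwards [H.hasDerivAt_ratio h] with x hx
  rw [hx.deriv]
  simp only [Pi.mul_apply, Pi.sub_apply, Pi.add_apply, Pi.natCast_apply]

theorem sym_root (H : RootData ε m c s z) : Sym 1 z := by
  refine Sym.of_logDeriv H.smooth H.isBigO (sym_ix.mul_le H.sym_rootLog (by simp)) ?_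
  filter_upwards [H.hasDerivAt_root] with x hx
  rw [hx.deriv]; rfl

end RootData

/-! ### Separation of two roots -/

/-- Two functions with logarithmic derivatives in `S^{-1}` which are separated relatively to their
sizes. -/
theorem sep_of_isBigO {ε : ℝ} {f g a b : ℝ → ℂ} (hf : Sym 1 f) (hg : Sym 1 g) (ha : Sym 0 a)
    (hb : Sym 0 b) (hfa : ∀ᶠ x in atTop, HasDerivAt f (f x * (ix x * a x)) x)
    (hgb : ∀ᶠ x in atTop, HasDerivAt g (g x * (ix x * b x)) x)
    (h : (fun x : ℝ => max (max ‖f x‖ ‖g x‖) (x ^ (-1 + ε))) =O[atTop] fun x => f x - g x) :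
    Sep ε (f - g) := by
  have hsm : EvSmooth (f - g) := (hf.sub hg).evSmooth
  have h0 : ∀ᶠ x in atTop, (f - g) x ≠ 0 := by
    obtain ⟨C, hC⟩ := h.bound
    filter_upwards [hC, eventually_gt_atTop 0] with x hx hx0 hxe
    rw [Pi.sub_apply] at hxe
    rw [hxe, norm_zero, mul_zero] at hx
    have h1 := Real.rpow_pos_of_pos hx0 (-1 + ε)
    have h2 := le_max_right (max ‖f x‖ ‖g x‖) (x ^ (-1 + ε))
    have h3 := norm_le_zero_iff.1 hx
    linarith
  have hu : (f * (f - g)⁻¹) =O[atTop] fun x : ℝ => x ^ (0 : ℝ) := by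
    obtain ⟨C, hC⟩ := h.bound
    refine IsBigO.of_bound C ?_
    filter_upwards [hC, h0] with x hx hx0
    have h1 : ‖f x‖ ≤ C * ‖f x - g x‖ := by
      refine le_trans ?_ hx
      exact ((le_max_left _ _).trans (le_max_left _ _)).trans (Real.le_norm_self _)
    have h2 : 0 < ‖f x - g x‖ := norm_pos_iff.2 hx0
    simp only [Pi.mul_apply, Pi.inv_apply, Pi.sub_apply, norm_mul, norm_inv, Real.rpow_zero,
      norm_one, mul_one]
    rwa [← div_eq_mul_inv, div_le_iff₀ h2]
  have hi : (f - g)⁻¹ =O[atTop] fun x : ℝ => x ^ (1 - ε) := by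
    obtain ⟨C, hC⟩ := h.bound
    refine IsBigO.of_bound C ?_
    filter_upwards [hC, h0, eventually_gt_atTop 0] with x hx hx0 hxp
    have h1 : x ^ (-1 + ε) ≤ C * ‖f x - g x‖ :=
      (le_max_right _ _).trans ((Real.le_norm_self _).trans hx)
    have h2 : 0 < ‖f x - g x‖ := norm_pos_iff.2 hx0
    have h3 : x ^ (-1 + ε) * x ^ (1 - ε) = 1 := by
      rw [← Real.rpow_add hxp]; simp
    have h4 := Real.rpow_pos_of_pos hxp (1 - ε)
    rw [Real.norm_of_nonneg h4.le, Pi.inv_apply, norm_inv, Pi.sub_apply, inv_le_iff_one_le_mul₀ h2]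
    calc (1 : ℝ) = x ^ (-1 + ε) * x ^ (1 - ε) := h3.symm
      _ ≤ C * ‖f x - g x‖ * x ^ (1 - ε) := mul_le_mul_of_nonneg_right h1 h4.le
      _ = _ := by ring
  -- Since `g / (f - g) = u - 1`, the logarithmic derivatives of `f - g` and of `u` are `1/x` times
  -- polynomials in `u`, `a`, `b`. The boundedness of `u` is then bootstrapped to a symbol estimate
  -- of order `0`.
  set u : ℝ → ℂ := f * (f - g)⁻¹ with hudef
  have hd : ∀ᶠ x in atTop, HasDerivAt (f - g)
      ((f - g) x * (ix x * (u * a - (u - 1) * b) x)) x := by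
    filter_upwards [hfa, hgb, h0] with x h1 h2 h3
    refine (h1.sub h2).congr_deriv ?_
    rw [hudef]
    simp only [Pi.mul_apply, Pi.sub_apply, Pi.inv_apply, Pi.one_apply] at h3 ⊢
    field_simp
    ring
  have hus : EvSmooth u := hf.evSmooth.mul (hsm.inv h0)
  have hud : ∀ᶠ x in atTop, HasDerivAt u (u x * (ix x * (a - (u * a - (u - 1) * b)) x)) x := by
    filter_upwards [hfa, hd, h0] with x h1 h2 h3
    refine (hasDerivAt_mul_log h1 (hasDerivAt_inv_log h2 h3)).congr_deriv ?_
    rw [hudef]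
    simp only [Pi.mul_apply, Pi.sub_apply]; ring
  have husym : Sym 0 u := by
    intro N
    induction N with
    | zero => exact symN_zero.2 ⟨hus, hu⟩
    | succ N ih =>
      refine symN_succ.2 ⟨symN_zero.2 ⟨hus, hu⟩, ?_⟩
      have h1 := (ih.mul_zero_zero (ha N)).sub ((ih.sub (sym_one N)).mul_zero_zero (hb N))
      have h2 := (sym_ix N).mul (ih.mul_zero_zero ((ha N).sub h1))
      refine (h2.mono le_rfl (by norm_num)).congr ?_
      filter_upwards [hud] with x hx
      rw [hx.deriv]
      simp only [Pi.mul_apply]; ring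
  have hl : Sym 0 (u * a - (u - 1) * b) :=
    (husym.mul_le ha (by simp)).sub ((husym.sub sym_one).mul_le hb (by simp))
  refine ⟨hsm, h0, ?_, ?_⟩
  · refine Sym.of_logDeriv (hsm.inv h0) hi (sym_ix.mul_le hl.neg (by simp)) ?_
    filter_upwards [hd, h0] with x h1 h2
    rw [(hasDerivAt_inv_log h1 h2).deriv]
    simp only [Pi.mul_apply, Pi.neg_apply]; ring
  · refine (sym_ix.mul_le hl (r := -1) (by simp)).congr ?_
    filter_upwards [hd, h0] with x h1 h2
    simp only [Pi.mul_apply, Pi.inv_apply] at *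
    rw [h1.deriv]
    field_simp

/-! ### Approximate solution of the Riccati equation -/

/-- Maps on symbols of order `0` which lower the order of differences by `ε`. -/
def Contracts (ε : ℝ) (T : (ℝ → ℂ) → ℝ → ℂ) : Prop :=
  (∀ κ, Sym 0 κ → Sym 0 (T κ)) ∧
    ∀ κ κ' s, s ≤ 0 → Sym 0 κ → Sym 0 κ' → Sym s (κ - κ') → Sym (s - ε) (T κ - T κ')

namespace Contracts

variable {ε : ℝ} {S T : (ℝ → ℂ) → ℝ → ℂ}

theorem const {f : ℝ → ℂ} (hf : Sym 0 f) : Contracts ε (fun _ => f) :=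
  ⟨fun _ _ => hf, fun _ _ _ _ _ _ _ => by simpa using sym_zero _⟩

theorem id : Contracts 0 (fun κ => κ) :=
  ⟨fun _ h => h, fun _ _ _ _ _ _ h => by simpa using h⟩

theorem add (hS : Contracts ε S) (hT : Contracts ε T) : Contracts ε (fun κ => S κ + T κ) := by
  refine ⟨fun κ h => (hS.1 κ h).add (hT.1 κ h), fun κ κ' s hs h h' hd => ?_⟩
  have := (hS.2 κ κ' s hs h h' hd).add (hT.2 κ κ' s hs h h' hd)
  rwa [add_sub_add_comm]

theorem sum {ι : Type*} {I : Finset ι} {T : ι → (ℝ → ℂ) → ℝ → ℂ}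
    (h : ∀ i ∈ I, Contracts ε (T i)) : Contracts ε (fun κ => ∑ i ∈ I, T i κ) := by
  classical
  induction I using Finset.induction_on with
  | empty => simpa using const (sym_zero 0)
  | insert a I ha ih =>
    simp only [Finset.sum_insert ha]
    exact (h a (by simp)).add (ih fun i hi => h i (by simp [hi]))

theorem coeff_mul (hε : 0 ≤ ε) {K : ℝ → ℂ} (hK : Sym (-ε) K) (hT : Contracts 0 T) :
    Contracts ε (fun κ => K * T κ) := by
  refine ⟨fun κ h => hK.mul_le (hT.1 κ h) (by linarith), fun κ κ' s hs h h' hd => ?_⟩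
  have := hK.mul_le (hT.2 κ κ' s hs h h' hd) (r := s - ε) (by linarith)
  rwa [mul_sub] at this

theorem mul (hS : Contracts 0 S) (hT : Contracts 0 T) : Contracts 0 (fun κ => S κ * T κ) := by
  refine ⟨fun κ h => (hS.1 κ h).mul_le (hT.1 κ h) (by simp), fun κ κ' s hs h h' hd => ?_⟩
  have h1 := (hS.2 κ κ' s hs h h' hd).mul_le (hT.1 κ h) (r := s - 0) (by simp)
  have h2 := (hS.1 κ' h').mul_le (hT.2 κ κ' s hs h h' hd) (r := s - 0) (by simp)
  have e : S κ * T κ - S κ' * T κ' = (S κ - S κ') * T κ + S κ' * (T κ - T κ') := by ring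
  rw [e]; exact h1.add h2

/-- The derivatives of `κ` enter only through `x d/dx`, which preserves orders. The gain must
therefore come from the coefficients, by `coeff_mul`. -/
theorem euler (hT : Contracts 0 T) : Contracts 0 (fun κ => cx * deriv (T κ)) := by
  refine ⟨fun κ h => sym_cx.mul_le (hT.1 κ h).derivative (by simp), fun κ κ' s hs h h' hd => ?_⟩
  have h1 := sym_cx.mul_le (hT.2 κ κ' s hs h h' hd).derivative (r := s - 0) (by linarith)
  refine h1.congr ?_
  filter_upwards [(hT.1 κ h).evSmooth.differentiable, (hT.1 κ' h').evSmooth.differentiable]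
    with x k1 k2
  simp only [Pi.mul_apply, Pi.sub_apply]
  rw [deriv_sub k1 k2]; ring

end Contracts

/-- The coefficients `T_{n,l}` of `(D + z + x⁻¹ κ)^n 1 = ∑_l z^{n-l} x^{-l} T_{n,l}`, where
`h` is `x` times the logarithmic derivative of `z`. -/
def riccatiCoeff (h : ℝ → ℂ) : ℕ → ℕ → (ℝ → ℂ) → ℝ → ℂ
  | 0, 0, _ => 1
  | 0, _ + 1, _ => 0
  | n + 1, 0, κ => riccatiCoeff h n 0 κ
  | n + 1, l + 1, κ => riccatiCoeff h n (l + 1) κ +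
      ((κ + fun x => -Complex.I * (((n - l : ℕ) : ℂ) * h x - l)) * riccatiCoeff h n l κ +
        (fun _ => -Complex.I) * (cx * deriv (riccatiCoeff h n l κ)))

theorem riccatiCoeff_eq_zero (h : ℝ → ℂ) {n l : ℕ} (hl : n < l) (κ : ℝ → ℂ) :
    riccatiCoeff h n l κ = 0 := by
  induction n generalizing l with
  | zero => obtain ⟨l, rfl⟩ := Nat.exists_eq_succ_of_ne_zero (by omega : l ≠ 0); rfl
  | succ n ih =>
    obtain ⟨l, rfl⟩ := Nat.exists_eq_succ_of_ne_zero (by omega : l ≠ 0)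
    simp only [riccatiCoeff]
    rw [ih (by omega), ih (by omega)]
    have : deriv (0 : ℝ → ℂ) = 0 := deriv_zero
    rw [this]; simp

theorem riccatiCoeff_zero_right (h : ℝ → ℂ) (n : ℕ) (κ : ℝ → ℂ) : riccatiCoeff h n 0 κ = 1 := by
  induction n with
  | zero => rfl
  | succ n ih => exact ih

theorem contracts_riccatiCoeff {h : ℝ → ℂ} (hh : Sym 0 h) (n l : ℕ) :
    Contracts 0 (riccatiCoeff h n l) := by
  induction n generalizing l with
  | zero =>
    cases l with
    | zero => exact Contracts.const sym_one
    | succ l => exact Contracts.const (sym_zero 0)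
  | succ n ih =>
    cases l with
    | zero => exact ih 0
    | succ l =>
      refine (ih (l + 1)).add (((Contracts.id.add (Contracts.const ?_)).mul (ih l)).add
        ((Contracts.const (sym_const _)).mul (ih l).euler))
      exact (((hh.const_mul ((n - l : ℕ) : ℂ)).sub (sym_const (l : ℂ))).const_mul (-Complex.I)).congr
        (Eventually.of_forall fun x => by simp)

/-- The part of order `l = 1` is affine in `κ`, without derivatives, and with slope `n`: summed
against the coefficients it reproduces the derivative of the polynomial at the root. -/
theorem riccatiCoeff_one (h : ℝ → ℂ) (n : ℕ) (κ : ℝ → ℂ) :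
    riccatiCoeff h n 1 κ = (n : ℝ → ℂ) * κ + riccatiCoeff h n 1 0 := by
  induction n with
  | zero => simp [riccatiCoeff]
  | succ n ih =>
    have h1 : ∀ κ, riccatiCoeff h (n + 1) 1 κ = riccatiCoeff h n 1 κ +
        (κ + fun x => -Complex.I * (((n : ℕ) : ℂ) * h x)) := by
      intro κ
      simp only [riccatiCoeff, riccatiCoeff_zero_right]
      ext x
      have : deriv (1 : ℝ → ℂ) = 0 := deriv_one
      simp [this]
    rw [h1, h1, ih]; push_cast; ring

/-- Applying `D + z + κ/x` to `z^{n-l} x^{-l} T` either multiplies by `z`, keeping `l`, or yields a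
factor `1/x`, raising `l`; this is the recursion of `riccatiCoeff`. -/
theorem conn_iterate_one_eq {z h κ : ℝ → ℂ} (hh : Sym 0 h) (hκ : Sym 0 κ)
    (hd : ∀ᶠ x in atTop, HasDerivAt z (z x * (ix x * h x)) x) (n : ℕ) :
    (conn (z + ix * κ))^[n] 1 =ᶠ[atTop] fun x => ∑ l ∈ Finset.range (n + 1),
      (z ^ (n - l) * ix ^ l * riccatiCoeff h n l κ) x := by
  induction n with
  | zero => exact Eventually.of_forall fun x => by simp [riccatiCoeff]
  | succ n ih =>
    have hT : ∀ᶠ x in atTop, ∀ l ∈ Finset.range (n + 1),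
        DifferentiableAt ℝ (riccatiCoeff h n l κ) x :=
      (Finset.eventually_all _).2 fun l _ =>
        ((contracts_riccatiCoeff hh n l).1 κ hκ).evSmooth.differentiable
    filter_upwards [eventually_atTop_nhds ih, hT, hd, cx_ne_zero] with x h1 h2 h3 h4
    rw [Function.iterate_succ_apply']
    have hder : ∀ l ∈ Finset.range (n + 1), HasDerivAt (z ^ (n - l) * ix ^ l * riccatiCoeff h n l κ)
        (z x ^ (n - l) * ix x ^ l * (((n - l : ℕ) : ℂ) * (ix x * h x) + l * (-ix x)) *
          riccatiCoeff h n l κ x + z x ^ (n - l) * ix x ^ l * deriv (riccatiCoeff h n l κ) x) x :=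
      fun l hl => (hasDerivAt_mul_log (hasDerivAt_pow_log h3 (n - l))
        (hasDerivAt_pow_log (hasDerivAt_ix_log h4) l)).mul (h2 l hl).hasDerivAt
    have hD : D ((conn (z + ix * κ))^[n] 1) x = -Complex.I * ∑ l ∈ Finset.range (n + 1),
        (z x ^ (n - l) * ix x ^ l * (((n - l : ℕ) : ℂ) * (ix x * h x) + l * (-ix x)) *
          riccatiCoeff h n l κ x + z x ^ (n - l) * ix x ^ l * deriv (riccatiCoeff h n l κ) x) := by
      rw [D_congr h1]
      simp only [D]
      rw [(HasDerivAt.fun_sum hder).deriv]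
    have hix : ix x * cx x = 1 := by
      simp only [ix, cx] at h4 ⊢; field_simp
    simp only [conn]
    rw [hD, h1.self_of_nhds, Finset.mul_sum, Finset.mul_sum, ← Finset.sum_add_distrib]
    have hterm : ∀ l ∈ Finset.range (n + 1), -Complex.I * (z x ^ (n - l) * ix x ^ l *
        (((n - l : ℕ) : ℂ) * (ix x * h x) + l * (-ix x)) * riccatiCoeff h n l κ x +
          z x ^ (n - l) * ix x ^ l * deriv (riccatiCoeff h n l κ) x) +
        (z + ix * κ) x * (z ^ (n - l) * ix ^ l * riccatiCoeff h n l κ) x =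
        z x ^ (n + 1 - l) * ix x ^ l * riccatiCoeff h n l κ x +
          (z x ^ (n - l) * ix x ^ (l + 1) * riccatiCoeff h (n + 1) (l + 1) κ x -
            z x ^ (n - l) * ix x ^ (l + 1) * riccatiCoeff h n (l + 1) κ x) := by
      intro l hl
      rw [Finset.mem_range] at hl
      rw [show n + 1 - l = n - l + 1 by omega]
      simp only [riccatiCoeff, Pi.add_apply, Pi.mul_apply, Pi.pow_apply]
      linear_combination -Complex.I * z x ^ (n - l) * ix x ^ l * deriv (riccatiCoeff h n l κ) x *
        (-hix)
    rw [Finset.sum_congr rfl hterm, Finset.sum_add_distrib, Finset.sum_sub_distrib]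
    rw [Finset.sum_range_succ' (fun l => (z ^ (n + 1 - l) * ix ^ l * riccatiCoeff h (n + 1) l κ) x),
      Finset.sum_range_succ' (fun l => z x ^ (n + 1 - l) * ix x ^ l * riccatiCoeff h n l κ x),
      Finset.sum_range_succ (fun l => z x ^ (n - l) * ix x ^ (l + 1) *
        riccatiCoeff h n (l + 1) κ x),
      riccatiCoeff_eq_zero h (Nat.lt_succ_self n)]
    simp only [Nat.add_sub_add_right, Pi.mul_apply, Pi.pow_apply, Pi.zero_apply,
      riccatiCoeff_zero_right, mul_zero, add_zero]
    ring

/-- An approximate solution of the Riccati equation near a root. -/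
theorem RootData.exists_riccati {ε : ℝ} (hε : 0 < ε) {m : ℕ} {c s : ℕ → ℝ → ℂ} {z : ℝ → ℂ}
    (H : RootData ε m c s z) (b : ℕ → ℝ → ℂ)
    (hb : ∀ n l, l ≤ n → n ≤ m →
      Sym (-(ε * l)) (b n * z ^ (n - l) * (cx * ix ^ l) * (slope m c z)⁻¹)) :
    ∃ W, Sym (-1) (W - z) ∧ Rapid (connOp W m (fun k => c (m - k) + b (m - k)) 1) := by
  set π := slope m c z with hπ
  set h := rootLog m c s z with hh
  have hhs : Sym 0 h := H.sym_rootLog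
  -- The equation is multiplied by `x / π`, which normalizes the coefficient of `κ` to `1`. `P`
  -- comes from the Weyl coefficients, `Q` from the perturbation `b`.
  set P : ℕ → ℕ → ℝ → ℂ := fun n l => c n * z ^ (n - l) * (cx * ix ^ l) * π⁻¹ with hP
  set Q : ℕ → ℕ → ℝ → ℂ := fun n l => b n * z ^ (n - l) * (cx * ix ^ l) * π⁻¹ with hQ
  have hPs : ∀ n l : ℕ, l + 1 ≤ n → n ≤ m → Sym (-(ε * l)) (P n (l + 1)) := by
    intro n l hl hn
    have := H.sym_ratio (r := n - (l + 1)) (e := l) (by omega)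
    refine this.congr ?_
    filter_upwards [cx_mul_ix] with x hx
    simp only [ratio, hP]
    rw [show n - (l + 1) + 1 + l = n by omega]
    simp only [Pi.mul_apply, Pi.pow_apply, Pi.one_apply] at hx ⊢
    rw [pow_succ]
    linear_combination (-(c n x * z x ^ (n - (l + 1)) * ix x ^ l * (π⁻¹ x))) * hx
  set T := riccatiCoeff h with hT
  -- the map whose fixed points solve the equation
  set G : (ℝ → ℂ) → ℝ → ℂ := fun κ =>
    (fun x => -(∑ n ∈ Finset.range (m + 1), Q n 0 + ∑ n ∈ Finset.range m, P (n + 1) 1 *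
        T (n + 1) 1 0) x) +
      (∑ n ∈ Finset.range m, -Q (n + 1) 1 * T (n + 1) 1 κ +
        ∑ n ∈ Finset.range m, ∑ l ∈ Finset.range n,
          -(P (n + 1) (l + 2) + Q (n + 1) (l + 2)) * T (n + 1) (l + 2) κ) with hG
  have hGc : Contracts ε G := by
    refine (Contracts.const ?_).add ((Contracts.sum fun n hn => ?_).add
      (Contracts.sum fun n hn => Contracts.sum fun l hl => ?_))
    · refine (Sym.add (Sym.sum fun n hn => ?_) (Sym.sum fun n hn => ?_)).neg
      · rw [Finset.mem_range] at hn
        exact (hb n 0 (by omega) (by omega)).mono (by simp)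
      · rw [Finset.mem_range] at hn
        exact (hPs (n + 1) 0 (by omega) (by omega)).mul_le
          ((contracts_riccatiCoeff hhs _ _).1 0 (sym_zero 0)) (by simp)
    · rw [Finset.mem_range] at hn
      exact Contracts.coeff_mul hε.le
        ((hb (n + 1) 1 (by omega) (by omega)).neg.mono (by simp)) (contracts_riccatiCoeff hhs _ _)
    · rw [Finset.mem_range] at hn hl
      refine Contracts.coeff_mul hε.le (Sym.neg (Sym.add ?_ ?_)) (contracts_riccatiCoeff hhs _ _)
      · refine (hPs (n + 1) (l + 1) (by omega) (by omega)).mono ?_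
        have : 0 ≤ ε * l := by positivity
        push_cast; linarith
      · refine (hb (n + 1) (l + 2) (by omega) (by omega)).mono ?_
        have : 0 ≤ ε * l := by positivity
        push_cast; linarith
  obtain ⟨κ, hκ, hκG⟩ := exists_approx_fixed_point hε G hGc.1 hGc.2
  refine ⟨z + ix * κ, ?_, ?_⟩
  · rw [add_sub_cancel_left]; exact sym_ix.mul_le hκ (by simp)
  -- A crude order suffices: it only serves to undo the normalization of a rapidly decreasing
  -- quantity.
  have hπs : Sym (m + m) π := by
    refine (Sym.fun_sum (f := fun n x => (n + 1 : ℂ) * (c (n + 1) * z ^ n) x) (S := Finset.range m)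
      fun n hn => ?_).congr (Eventually.of_forall fun x => ?_)
    · rw [Finset.mem_range] at hn
      refine (((H.coeff_sym _ (by omega)).mul_le (H.sym_root.pow n) ?_)).const_mul _
      have : (n:ℝ) ≤ m := by exact_mod_cast hn.le
      linarith
    · simp [hπ, slope, mul_assoc]
  refine (hκG.mul_sym (sym_ix.mul hπs)).congr ?_
  have hcon : ∀ᶠ x in atTop, ∀ n ∈ Finset.range (m + 1), ((conn (z + ix * κ))^[n] 1) x =
      ∑ l ∈ Finset.range (n + 1), (z ^ (n - l) * ix ^ l * T n l κ) x :=
    (Finset.eventually_all _).2 fun n _ =>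
      conn_iterate_one_eq hhs hκ H.hasDerivAt_root n
  filter_upwards [hcon, H.root, H.ne_zero, cx_ne_zero] with x h1 h2 h3 h4
  have hπ0 : π x ≠ 0 := h3
  have hix : ix x * cx x = 1 := by
    simp only [ix, cx] at h4 ⊢; field_simp
  have e1 : connOp (z + ix * κ) m (fun k => c (m - k) + b (m - k)) 1 x =
      (ix x * π x) * ∑ n ∈ Finset.range (m + 1), ∑ l ∈ Finset.range (n + 1),
        (P n l + Q n l) x * T n l κ x := by
    simp only [connOp]
    rw [← Finset.sum_range_reflect, Finset.mul_sum]
    refine Finset.sum_congr rfl fun n hn => ?_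
    rw [show m - (m + 1 - 1 - n) = n by rw [Finset.mem_range] at hn; omega, h1 n hn,
      Finset.mul_sum, Finset.mul_sum]
    refine Finset.sum_congr rfl fun l _ => ?_
    simp only [hP, hQ, Pi.add_apply, Pi.mul_apply, Pi.pow_apply, Pi.inv_apply]
    field_simp
    linear_combination (-(c n x + b n x) * z x ^ (n - l) * ix x ^ l * T n l κ x) * hix
  have e2 : ∑ n ∈ Finset.range (m + 1), ∑ l ∈ Finset.range (n + 1),
      (P n l + Q n l) x * T n l κ x = ∑ n ∈ Finset.range (m + 1), (P n 0 + Q n 0) x +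
        ∑ n ∈ Finset.range m, (P (n + 1) 1 + Q (n + 1) 1) x * T (n + 1) 1 κ x +
        ∑ n ∈ Finset.range m, ∑ l ∈ Finset.range n,
          (P (n + 1) (l + 2) + Q (n + 1) (l + 2)) x * T (n + 1) (l + 2) κ x := by
    have k1 : ∀ n, ∑ l ∈ Finset.range (n + 1), (P n l + Q n l) x * T n l κ x =
        (P n 0 + Q n 0) x + ∑ l ∈ Finset.range n, (P n (l + 1) + Q n (l + 1)) x *
          T n (l + 1) κ x := by
      intro n
      rw [Finset.sum_range_succ', hT, riccatiCoeff_zero_right]; simp; ring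
    simp only [k1]
    rw [Finset.sum_add_distrib, add_assoc]
    congr 1
    rw [Finset.sum_range_succ', Finset.range_zero, Finset.sum_empty, add_zero,
      ← Finset.sum_add_distrib]
    refine Finset.sum_congr rfl fun n _ => ?_
    rw [Finset.sum_range_succ', add_comm]
  -- The terms `l = 0` cancel because `z` is a root.
  have e3 : ∑ n ∈ Finset.range (m + 1), P n 0 x = 0 := by
    have : ∀ n ∈ Finset.range (m + 1), P n 0 x = (c n x * z x ^ n) * (cx x * (π x)⁻¹) := by
      intro n _
      simp only [hP, Pi.mul_apply, Pi.pow_apply, Pi.inv_apply, Nat.sub_zero, pow_zero, mul_one]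
      ring
    rw [Finset.sum_congr rfl this, ← Finset.sum_mul, h2, zero_mul]
  -- The coefficient of `κ` is `π / π`.
  have e4 : ∑ n ∈ Finset.range m, P (n + 1) 1 x * (n + 1 : ℂ) = 1 := by
    have : ∀ n ∈ Finset.range m, P (n + 1) 1 x * (n + 1 : ℂ) =
        ((n + 1 : ℂ) * c (n + 1) x * z x ^ n) * (π x)⁻¹ := by
      intro n _
      simp only [hP, Pi.mul_apply, Pi.pow_apply, Pi.inv_apply, Nat.add_sub_cancel, pow_one]
      linear_combination (c (n + 1) x * z x ^ n * (π x)⁻¹ * (n + 1 : ℂ)) * hix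
    rw [Finset.sum_congr rfl this, ← Finset.sum_mul]
    exact mul_inv_cancel₀ hπ0
  have e5 : ∑ n ∈ Finset.range m, (P (n + 1) 1 + Q (n + 1) 1) x * T (n + 1) 1 κ x =
      κ x + ∑ n ∈ Finset.range m, P (n + 1) 1 x * T (n + 1) 1 0 x +
        ∑ n ∈ Finset.range m, Q (n + 1) 1 x * T (n + 1) 1 κ x := by
    have : ∀ n ∈ Finset.range m, (P (n + 1) 1 + Q (n + 1) 1) x * T (n + 1) 1 κ x =
        P (n + 1) 1 x * (n + 1 : ℂ) * κ x + P (n + 1) 1 x * T (n + 1) 1 0 x +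
          Q (n + 1) 1 x * T (n + 1) 1 κ x := by
      intro n _
      have k := congrFun (riccatiCoeff_one h (n + 1) κ) x
      simp only [Pi.add_apply, Pi.mul_apply, Pi.natCast_apply] at k ⊢
      rw [hT, k]; push_cast; ring
    rw [Finset.sum_congr rfl this, Finset.sum_add_distrib, Finset.sum_add_distrib,
      ← Finset.sum_mul, e4, one_mul]
  rw [e1, e2, e5]
  simp only [hG, Pi.add_apply, Pi.mul_apply, Pi.sub_apply, Finset.sum_apply, Pi.neg_apply,
    Finset.sum_add_distrib, e3, neg_mul, Finset.sum_neg_distrib]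
  ring

/-! ### Coefficients of symbols -/

/-- A polynomial in `(x, ξ)` as a polynomial in `ξ` with coefficients in `ℂ[x]`. -/
def toPoly : MvPolynomial (Fin 2) ℂ →ₐ[ℂ] Polynomial (Polynomial ℂ) :=
  MvPolynomial.aeval ![Polynomial.C Polynomial.X, Polynomial.X]

/-- The coefficient of `ξ^n`. -/
def coefX (n : ℕ) (a : MvPolynomial (Fin 2) ℂ) : Polynomial ℂ := (toPoly a).coeff n

theorem coefX_add (n : ℕ) (a b : MvPolynomial (Fin 2) ℂ) :
    coefX n (a + b) = coefX n a + coefX n b := by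
  simp [coefX]

theorem coefX_sum {ι : Type*} (S : Finset ι) (n : ℕ) (f : ι → MvPolynomial (Fin 2) ℂ) :
    coefX n (∑ i ∈ S, f i) = ∑ i ∈ S, coefX n (f i) := by
  simp [coefX]

theorem toPoly_C (k : ℂ) : toPoly (MvPolynomial.C k) = Polynomial.C (Polynomial.C k) := by
  simp only [toPoly, MvPolynomial.aeval_C]
  rfl

theorem coefX_C_mul (n : ℕ) (k : ℂ) (a : MvPolynomial (Fin 2) ℂ) :
    coefX n (MvPolynomial.C k * a) = k • coefX n a := by
  rw [coefX, map_mul, toPoly_C, Polynomial.coeff_C_mul, Polynomial.smul_eq_C_mul]; rfl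

theorem toPoly_X_zero : toPoly (MvPolynomial.X 0) = Polynomial.C Polynomial.X := by
  simp [toPoly]

theorem toPoly_X_one : toPoly (MvPolynomial.X 1) = Polynomial.X := by
  simp [toPoly]

theorem toPoly_monomial (s : Fin 2 →₀ ℕ) (k : ℂ) : toPoly (MvPolynomial.monomial s k) =
    Polynomial.monomial (s 1) (Polynomial.monomial (s 0) k) := by
  have h : MvPolynomial.monomial s k =
      MvPolynomial.C k * (MvPolynomial.X 0 ^ s 0 * MvPolynomial.X 1 ^ s 1) := by
    rw [MvPolynomial.monomial_eq, Finsupp.prod_fintype _ _ (by simp), Fin.prod_univ_two]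
  rw [h, map_mul, map_mul, map_pow, map_pow, toPoly_X_zero, toPoly_X_one, toPoly_C,
    ← Polynomial.C_mul_X_pow_eq_monomial, ← Polynomial.C_mul_X_pow_eq_monomial,
    Polynomial.C_mul, Polynomial.C_pow]
  ring

theorem coefX_eq_sum (n : ℕ) (a : MvPolynomial (Fin 2) ℂ) : coefX n a =
    ∑ s ∈ a.support, if s 1 = n then Polynomial.monomial (s 0) (a.coeff s) else 0 := by
  conv_lhs => rw [a.as_sum, coefX_sum]
  refine Finset.sum_congr rfl fun s _ => ?_
  rw [coefX, toPoly_monomial, Polynomial.coeff_monomial]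

theorem toPoly_pderiv_one (a : MvPolynomial (Fin 2) ℂ) :
    toPoly (MvPolynomial.pderiv 1 a) = Polynomial.derivative (toPoly a) := by
  induction a using MvPolynomial.induction_on with
  | C k => simp
  | add p q hp hq => simp [hp, hq]
  | mul_X p i hp =>
    rw [Derivation.leibniz, map_add, smul_eq_mul, smul_eq_mul, map_mul, map_mul, map_mul, hp,
      Polynomial.derivative_mul]
    fin_cases i
    · simp [toPoly_X_zero, MvPolynomial.pderiv_X]; ring
    · simp [toPoly_X_one, MvPolynomial.pderiv_X]; ring

theorem coefX_symDξ (n : ℕ) (a : MvPolynomial (Fin 2) ℂ) :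
    coefX n (symDξ a) = ((n : ℂ) + 1) • coefX (n + 1) a := by
  rw [coefX, symDξ, toPoly_pderiv_one, Polynomial.coeff_derivative, Polynomial.smul_eq_C_mul]
  simp [coefX, mul_comm]

theorem coefX_pderiv_zero (n : ℕ) (a : MvPolynomial (Fin 2) ℂ) :
    coefX n (MvPolynomial.pderiv 0 a) = Polynomial.derivative (coefX n a) := by
  induction a using MvPolynomial.induction_on generalizing n with
  | C k =>
    simp only [MvPolynomial.pderiv_C, coefX, toPoly_C, map_zero, Polynomial.coeff_zero,
      Polynomial.coeff_C]
    split_ifs <;> simp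
  | add p q hp hq => rw [map_add, coefX_add, coefX_add, hp, hq, map_add]
  | mul_X p i hp =>
    rw [Derivation.leibniz, coefX_add, smul_eq_mul, smul_eq_mul]
    simp only [coefX, map_mul] at hp ⊢
    fin_cases i
    · simp [toPoly_X_zero, MvPolynomial.pderiv_X, Polynomial.coeff_mul_C,
        Polynomial.coeff_C_mul, hp]
      ring
    · cases n with
      | zero => simp [toPoly_X_one, MvPolynomial.pderiv_X]
      | succ n => simp [toPoly_X_one, MvPolynomial.pderiv_X, Polynomial.coeff_X_mul, hp]

theorem coefX_symDx (n : ℕ) (a : MvPolynomial (Fin 2) ℂ) :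
    coefX n (symDx a) = (-Complex.I) • Polynomial.derivative (coefX n a) := by
  rw [symDx, coefX_C_mul, coefX_pderiv_zero]

theorem coefX_symDξ_iterate (γ n : ℕ) : ∃ w : ℂ, (γ = 0 → w = 1) ∧
    ∀ a, coefX n (symDξ^[γ] a) = w • coefX (n + γ) a := by
  induction γ generalizing n with
  | zero => exact ⟨1, fun _ => rfl, fun a => by simp⟩
  | succ γ ih =>
    obtain ⟨w, -, hw⟩ := ih (n + 1)
    refine ⟨((n : ℂ) + 1) * w, fun h => absurd h (by omega), fun a => ?_⟩
    rw [Function.iterate_succ_apply', coefX_symDξ, hw, smul_smul,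
      show n + 1 + γ = n + (γ + 1) by omega]

theorem coefX_symDx_iterate (γ n : ℕ) (a : MvPolynomial (Fin 2) ℂ) :
    coefX n (symDx^[γ] a) = (-Complex.I) ^ γ • Polynomial.derivative^[γ] (coefX n a) := by
  induction γ with
  | zero => simp
  | succ γ ih =>
    rw [Function.iterate_succ_apply', coefX_symDx, ih, Function.iterate_succ_apply',
      Polynomial.derivative_smul, smul_smul, pow_succ, mul_comm]

/-- Of the weights only `w 0 = 1` matters: the passage from standard to Weyl coefficients is
unitriangular. -/
theorem coefX_weylSymbol (a : MvPolynomial (Fin 2) ℂ) (n : ℕ) : ∃ w : ℕ → ℂ, w 0 = 1 ∧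
    coefX n (weylSymbol a) = ∑ γ ∈ Finset.range (a.totalDegree + 1),
      w γ • Polynomial.derivative^[γ] (coefX (n + γ) a) := by
  choose w hw0 hw using fun γ => coefX_symDξ_iterate γ n
  refine ⟨fun γ => ((1 / (γ.factorial : ℂ)) * (-1 / 2) ^ γ) * (w γ * (-Complex.I) ^ γ), ?_, ?_⟩
  · simp [hw0]
  · rw [weylSymbol, coefX_sum]
    refine Finset.sum_congr rfl fun γ _ => ?_
    rw [coefX_C_mul, hw, coefX_symDx_iterate, smul_smul, smul_smul, mul_assoc]

/-- The span of the derivatives of order `γ ≥ 1` of `C_{n+γ}`. -/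
def lowerSpan (C : ℕ → Polynomial ℂ) (n : ℕ) : Submodule ℂ (Polynomial ℂ) :=
  Submodule.span ℂ {p | ∃ γ, 1 ≤ γ ∧ p = Polynomial.derivative^[γ] (C (n + γ))}

theorem iterate_derivative_mem_lowerSpan {C : ℕ → Polynomial ℂ} {n γ : ℕ} {p : Polynomial ℂ}
    (hp : p ∈ lowerSpan C (n + γ)) : Polynomial.derivative^[γ] p ∈ lowerSpan C n := by
  induction hp using Submodule.span_induction with
  | mem p hp =>
    obtain ⟨δ, hδ, rfl⟩ := hp
    refine Submodule.subset_span ⟨γ + δ, by omega, ?_⟩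
    rw [← Function.iterate_add_apply, add_assoc]
  | zero => rw [Polynomial.iterate_derivative_zero]; exact Submodule.zero_mem _
  | add p q _ _ hp hq => rw [iterate_map_add]; exact Submodule.add_mem _ hp hq
  | smul k p _ hp => rw [Polynomial.iterate_derivative_smul]; exact Submodule.smul_mem _ _ hp

section

variable {m : ℕ} {a : MvPolynomial (Fin 2) ℂ}

theorem coefX_eq_zero (hdeg : a.totalDegree ≤ m) {n : ℕ} (hn : m < n) : coefX n a = 0 := by
  rw [coefX_eq_sum]
  refine Finset.sum_eq_zero fun s hs => if_neg fun h => ?_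
  have h1 := (MvPolynomial.le_totalDegree hs).trans hdeg
  rw [Finsupp.sum_fintype _ _ (by simp), Fin.sum_univ_two] at h1
  omega

/-- Inversion of the unitriangular Weyl formula by descending induction on `n`. The correction has
to be written with Weyl coefficients, because these are the symmetric functions of the given roots.
-/
theorem coefX_sub_weylSymbol_mem (hdeg : a.totalDegree ≤ m) (n : ℕ) :
    coefX n a - coefX n (weylSymbol a) ∈ lowerSpan (fun n => coefX n (weylSymbol a)) n := by
  suffices h : ∀ k n, m ≤ n + k → coefX n a - coefX n (weylSymbol a) ∈
      lowerSpan (fun n => coefX n (weylSymbol a)) n from h m n (by omega)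
  intro k
  induction k with
  | zero =>
    intro n hn
    obtain ⟨w, hw0, hw⟩ := coefX_weylSymbol a n
    rw [Finset.sum_eq_single 0] at hw
    · rw [hw, hw0]; simp
    · intro γ _ hγ
      rw [coefX_eq_zero hdeg (by omega), Polynomial.iterate_derivative_zero, smul_zero]
    · simp
  | succ k ih =>
    intro n hn
    obtain ⟨w, hw0, hw⟩ := coefX_weylSymbol a n
    rw [Finset.sum_range_succ', hw0] at hw
    simp only [one_smul, Function.iterate_zero, id, add_zero] at hw
    rw [hw, sub_add_cancel_right]
    refine Submodule.neg_mem _ (Submodule.sum_mem _ fun γ _ => Submodule.smul_mem _ _ ?_)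
    have h1 := iterate_derivative_mem_lowerSpan (ih (n + (γ + 1)) (by omega))
    have h2 : Polynomial.derivative^[γ + 1] (coefX (n + (γ + 1)) (weylSymbol a)) ∈
        lowerSpan (fun n => coefX n (weylSymbol a)) n :=
      Submodule.subset_span ⟨γ + 1, by omega, rfl⟩
    have h3 := Submodule.add_mem _ h1 h2
    rwa [← iterate_map_add, sub_add_cancel] at h3

theorem natDegree_coefX_le (hdeg : a.totalDegree ≤ m) (n : ℕ) :
    (coefX n a).natDegree ≤ m - n := by
  rw [coefX_eq_sum]
  refine Polynomial.natDegree_sum_le_of_forall_le _ _ fun s hs => ?_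
  split_ifs with h
  · refine (Polynomial.natDegree_monomial_le _).trans ?_
    have h1 := (MvPolynomial.le_totalDegree hs).trans hdeg
    rw [Finsupp.sum_fintype _ _ (by simp), Fin.sum_univ_two] at h1
    omega
  · simp

theorem ev_zero : ev 0 = 0 := by ext x; simp [ev]

theorem sym_coefX (hdeg : a.totalDegree ≤ m) (n : ℕ) : Sym ((m : ℝ) - n) (ev (coefX n a)) := by
  rcases lt_or_ge m n with h | h
  · rw [coefX_eq_zero hdeg h, ev_zero]; exact sym_zero _
  · have := sym_ev (natDegree_coefX_le hdeg n)
    rwa [Nat.cast_sub h] at this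

theorem ev_sum {ι : Type*} (S : Finset ι) (f : ι → Polynomial ℂ) :
    ev (∑ i ∈ S, f i) = ∑ i ∈ S, ev (f i) := by
  ext x; simp [ev, Polynomial.eval_finsetSum]

theorem ev_smul (k : ℂ) (p : Polynomial ℂ) : ev (k • p) = fun x => k * ev p x := by
  ext x; simp [ev]

theorem ev_add (p q : Polynomial ℂ) : ev (p + q) = ev p + ev q := by ext x; simp [ev]

theorem ev_sub (p q : Polynomial ℂ) : ev (p - q) = ev p - ev q := by ext x; simp [ev]

theorem sym_coefX_weylSymbol (hdeg : a.totalDegree ≤ m) (n : ℕ) :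
    Sym ((m : ℝ) - n) (ev (coefX n (weylSymbol a))) := by
  obtain ⟨w, -, hw⟩ := coefX_weylSymbol a n
  rw [hw, ev_sum]
  refine Sym.sum fun γ _ => ?_
  rw [ev_smul]
  refine ((sym_ev_derivative (sym_coefX hdeg (n + γ)) γ).const_mul _).mono ?_
  have : (0:ℝ) ≤ γ := Nat.cast_nonneg _
  push_cast; linarith

theorem coefX_weylSymbol_eq_zero (hdeg : a.totalDegree ≤ m) {n : ℕ} (hn : m < n) :
    coefX n (weylSymbol a) = 0 := by
  obtain ⟨w, -, hw⟩ := coefX_weylSymbol a n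
  rw [hw]
  refine Finset.sum_eq_zero fun γ _ => ?_
  rw [coefX_eq_zero hdeg (by omega), Polynomial.iterate_derivative_zero, smul_zero]

theorem coefX_top (hdeg : a.totalDegree ≤ m) (hlead : a.coeff (Finsupp.single 1 m) = 1) :
    coefX m a = 1 := by
  rw [coefX_eq_sum, Finset.sum_eq_single (Finsupp.single 1 m)]
  · simp [hlead]
  · intro s hs hne
    refine if_neg fun h => hne ?_
    have h1 := (MvPolynomial.le_totalDegree hs).trans hdeg
    rw [Finsupp.sum_fintype _ _ (by simp), Fin.sum_univ_two] at h1
    ext i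
    fin_cases i
    · simp; omega
    · simpa using h
  · intro h
    rw [MvPolynomial.notMem_support_iff] at h
    simp [h]

theorem stdOp_eq (hdeg : a.totalDegree ≤ m) (u : ℝ → ℂ) :
    stdOp a u = diffOp m (fun k => ev (coefX (m - k) a)) u := by
  ext x
  simp only [stdOp, diffOp]
  rw [← Finset.sum_range_reflect]
  have h1 : ∀ n ∈ Finset.range (m + 1), ev (coefX (m - (m + 1 - 1 - n)) a) x *
      (D^[m - (m + 1 - 1 - n)] u) x = ∑ s ∈ a.support,
        if s 1 = n then a.coeff s * (x : ℂ) ^ (s 0) * (D^[s 1] u) x else 0 := by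
    intro n hn
    rw [Finset.mem_range] at hn
    rw [show m - (m + 1 - 1 - n) = n by omega, coefX_eq_sum, ev_sum, Finset.sum_apply,
      Finset.sum_mul]
    refine Finset.sum_congr rfl fun s _ => ?_
    split_ifs with h
    · rw [h]; simp [ev]
    · simp [ev]
  rw [Finset.sum_congr rfl h1, Finset.sum_comm]
  refine Finset.sum_congr rfl fun s hs => ?_
  rw [Finset.sum_ite_eq, if_pos]
  have h1 := (MvPolynomial.le_totalDegree hs).trans hdeg
  rw [Finsupp.sum_fintype _ _ (by simp), Fin.sum_univ_two] at h1
  rw [Finset.mem_range]; omega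

end

theorem eval_eq_eval_toPoly (p : MvPolynomial (Fin 2) ℂ) (x z : ℂ) :
    MvPolynomial.eval ![x, z] p = ((toPoly p).map (Polynomial.evalRingHom x)).eval z := by
  induction p using MvPolynomial.induction_on with
  | C k => simp
  | add p q hp hq => simp [hp, hq]
  | mul_X p i hp =>
    rw [map_mul, hp, map_mul, Polynomial.map_mul, Polynomial.eval_mul]
    fin_cases i
    · simp [toPoly_X_zero]
    · simp [toPoly_X_one]

theorem map_toPoly_eq_prod {p : MvPolynomial (Fin 2) ℂ} {x : ℂ} {m : ℕ} {ζ : ℕ → ℂ}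
    (h : ∀ z, MvPolynomial.eval ![x, z] p = ∏ j ∈ Finset.Icc 1 m, (z - ζ j)) :
    (toPoly p).map (Polynomial.evalRingHom x) =
      ∏ j ∈ Finset.Icc 1 m, (Polynomial.X - Polynomial.C (ζ j)) := by
  refine Polynomial.funext fun z => ?_
  rw [← eval_eq_eval_toPoly, h, Polynomial.eval_prod]
  simp

theorem eval_coefX_eq_sigma {p : MvPolynomial (Fin 2) ℂ} {x : ℂ} {m : ℕ} {ζ : ℕ → ℂ}
    (h : ∀ z, MvPolynomial.eval ![x, z] p = ∏ j ∈ Finset.Icc 1 m, (z - ζ j)) {n : ℕ}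
    (hn : n ≤ m) : (coefX n p).eval x = sigma m (m - n) ζ := by
  have h1 := congrArg (fun q => Polynomial.coeff q n) (map_toPoly_eq_prod h)
  simp only [Polynomial.coeff_map, Polynomial.coe_evalRingHom] at h1
  have e : ∏ j ∈ Finset.Icc 1 m, (Polynomial.X - Polynomial.C (ζ j)) =
      ∏ j ∈ Finset.Icc 1 m, (Polynomial.X + Polynomial.C (-ζ j)) := by
    simp [sub_eq_add_neg]
  rw [coefX, h1, e, Finset.prod_X_add_C_coeff _ _ (by simpa using hn)]
  simp only [sigma, Nat.card_Icc, Nat.add_sub_cancel, Finset.mul_sum]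
  refine Finset.sum_congr rfl fun t ht => ?_
  rw [Finset.prod_neg, (Finset.mem_powersetCard.1 ht).2]

theorem slope_eq_prod {p : MvPolynomial (Fin 2) ℂ} {m : ℕ} {ζ : ℕ → ℂ} {x : ℝ}
    (hp : ∀ n, m < n → coefX n p = 0)
    (h : ∀ z, MvPolynomial.eval ![(x : ℂ), z] p = ∏ j ∈ Finset.Icc 1 m, (z - ζ j)) {j : ℕ}
    (hj : j ∈ Finset.Icc 1 m) :
    ∑ n ∈ Finset.range m, (n + 1 : ℂ) * ev (coefX (n + 1) p) x * ζ j ^ n =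
      ∏ l ∈ (Finset.Icc 1 m).erase j, (ζ j - ζ l) := by
  have h1 := congrArg (fun q => (Polynomial.derivative q).eval (ζ j)) (map_toPoly_eq_prod h)
  rw [← Finset.mul_prod_erase _ _ hj, Polynomial.derivative_mul, Polynomial.eval_add,
    Polynomial.eval_mul, Polynomial.eval_mul, Polynomial.eval_prod] at h1
  simp only [Polynomial.derivative_sub, Polynomial.derivative_X, Polynomial.derivative_C,
    sub_zero, Polynomial.eval_one, one_mul, Polynomial.eval_sub, Polynomial.eval_X,
    Polynomial.eval_C, sub_self, zero_mul, add_zero] at h1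
  rw [← h1, Polynomial.derivative_eval, Polynomial.sum_over_range' _ (by simp) (m + 1)]
  · rw [Finset.sum_range_succ']
    simp only [Polynomial.coeff_map, Polynomial.coe_evalRingHom, Nat.add_sub_cancel, Nat.cast_zero,
      mul_zero, zero_mul, add_zero]
    refine Finset.sum_congr rfl fun n _ => ?_
    simp only [ev, coefX]; push_cast; ring
  · rw [Nat.lt_succ_iff, Polynomial.natDegree_le_iff_coeff_eq_zero]
    intro n hn
    have := hp n hn
    rw [coefX] at this
    rw [Polynomial.coeff_map, this]; simp

theorem sum_coefX_mul_pow {p : MvPolynomial (Fin 2) ℂ} {m : ℕ} (hp : ∀ n, m < n → coefX n p = 0)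
    (x : ℝ) (z : ℂ) : ∑ n ∈ Finset.range (m + 1), ev (coefX n p) x * z ^ n =
      MvPolynomial.eval ![(x : ℂ), z] p := by
  rw [eval_eq_eval_toPoly, Polynomial.eval_eq_sum_range' (n := m + 1)]
  · exact Finset.sum_congr rfl fun n _ => by rw [Polynomial.coeff_map]; rfl
  · rw [Nat.lt_succ_iff, Polynomial.natDegree_le_iff_coeff_eq_zero]
    intro n hn
    have := hp n hn
    rw [coefX] at this
    rw [Polynomial.coeff_map, this]; simp

/-! ### Size of the terms at a separated root -/

theorem pow_mul_pow_le_prod {S : Finset ℕ} {M : ℕ → ℝ} {y δ : ℝ} (hy0 : 0 ≤ y) (hδ0 : 0 ≤ δ)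
    (hy : ∀ l ∈ S, y ≤ M l) (hδ : ∀ l ∈ S, δ ≤ M l) {r e : ℕ} (h : S.card = r + e) :
    y ^ r * δ ^ e ≤ ∏ l ∈ S, M l := by
  have hm : 0 ≤ max y δ := le_max_of_le_left hy0
  calc y ^ r * δ ^ e ≤ max y δ ^ r * max y δ ^ e :=
        mul_le_mul (pow_le_pow_left₀ hy0 (le_max_left _ _) _)
          (pow_le_pow_left₀ hδ0 (le_max_right _ _) _) (by positivity) (by positivity)
    _ = ∏ l ∈ S, max y δ := by rw [← pow_add, Finset.prod_const, h]
    _ ≤ _ := Finset.prod_le_prod (fun _ _ => hm) fun l hl => max_le (hy l hl) (hδ l hl)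

/-- Distribute the factors over the indices `l ≠ j`: each `a l` with `l ∈ T` goes to its own `M l`,
and the powers of `a j` and `δ` fill the remaining places. If `j ∈ T`, its factor joins the power of
`a j`. -/
theorem prod_mul_pow_mul_pow_le {I T : Finset ℕ} {j : ℕ} (hj : j ∈ I) (hT : T ⊆ I) {a M : ℕ → ℝ}
    {δ : ℝ} (ha0 : ∀ l, 0 ≤ a l) (hδ0 : 0 ≤ δ) (ha : ∀ l ∈ I.erase j, a l ≤ M l)
    (hy : ∀ l ∈ I.erase j, a j ≤ M l) (hδ : ∀ l ∈ I.erase j, δ ≤ M l) {r e : ℕ}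
    (h : T.card + (r + 1 + e) = I.card) :
    (∏ l ∈ T, a l) * a j ^ r * δ ^ e ≤ ∏ l ∈ I.erase j, M l := by
  have hI := Finset.card_erase_add_one hj
  have key : ∀ U r', U ⊆ I.erase j → U.card + (r' + e) = (I.erase j).card →
      (∏ l ∈ U, a l) * (a j ^ r' * δ ^ e) ≤ ∏ l ∈ I.erase j, M l := by
    intro U r' hU hc
    rw [← Finset.prod_sdiff hU, mul_comm]
    have h1 := Finset.card_sdiff_add_card_eq_card hU
    refine mul_le_mul (pow_mul_pow_le_prod (ha0 j) hδ0 (fun l hl => hy l (Finset.sdiff_subset hl))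
      (fun l hl => hδ l (Finset.sdiff_subset hl)) (by omega))
      (Finset.prod_le_prod (fun l _ => ha0 l) fun l hl => ha l (hU hl))
      (Finset.prod_nonneg fun l _ => ha0 l) (Finset.prod_nonneg fun l hl => ?_)
    exact (ha0 l).trans (ha l (Finset.sdiff_subset hl))
  by_cases hjT : j ∈ T
  · have h1 := Finset.card_erase_add_one hjT
    have := key (T.erase j) (r + 1) (Finset.erase_subset_erase j hT) (by omega)
    rw [← Finset.mul_prod_erase T a hjT]
    calc _ = (∏ l ∈ T.erase j, a l) * (a j ^ (r + 1) * δ ^ e) := by ring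
      _ ≤ _ := this
  · rw [mul_assoc]
    exact key T r (fun l hl => Finset.mem_erase.2 ⟨fun h => hjT (h ▸ hl), hT hl⟩) (by omega)

theorem norm_sigma_mul_pow_le {m j : ℕ} (hj : j ∈ Finset.Icc 1 m) {ζ : ℕ → ℂ} {M : ℕ → ℝ} {δ : ℝ}
    (hδ0 : 0 ≤ δ) (ha : ∀ l ∈ (Finset.Icc 1 m).erase j, ‖ζ l‖ ≤ M l)
    (hy : ∀ l ∈ (Finset.Icc 1 m).erase j, ‖ζ j‖ ≤ M l)
    (hδ : ∀ l ∈ (Finset.Icc 1 m).erase j, δ ≤ M l) {r e : ℕ} (h : r + 1 + e ≤ m) :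
    ‖sigma m (m - (r + 1 + e)) ζ‖ * ‖ζ j‖ ^ r * δ ^ e ≤
      (m.choose (m - (r + 1 + e)) : ℝ) * ∏ l ∈ (Finset.Icc 1 m).erase j, M l := by
  have h1 : ‖sigma m (m - (r + 1 + e)) ζ‖ ≤
      ∑ t ∈ Finset.powersetCard (m - (r + 1 + e)) (Finset.Icc 1 m), ∏ i ∈ t, ‖ζ i‖ := by
    rw [sigma, norm_mul, norm_pow, norm_neg, norm_one, one_pow, one_mul]
    refine (norm_sum_le _ _).trans (Finset.sum_le_sum fun t _ => ?_)
    rw [norm_prod]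
  refine (mul_le_mul_of_nonneg_right (mul_le_mul_of_nonneg_right h1 (by positivity))
    (by positivity)).trans ?_
  rw [Finset.sum_mul, Finset.sum_mul]
  refine (Finset.sum_le_card_nsmul _ _ (∏ l ∈ (Finset.Icc 1 m).erase j, M l) fun t ht => ?_).trans
    (le_of_eq ?_)
  · have ht' := Finset.mem_powersetCard.1 ht
    refine prod_mul_pow_mul_pow_le (a := fun l => ‖ζ l‖) hj ht'.1 (fun l => norm_nonneg _) hδ0
      ha hy hδ ?_
    rw [ht'.2, Nat.card_Icc]; omega
  · rw [Finset.card_powersetCard, nsmul_eq_mul, Nat.card_Icc, Nat.add_sub_cancel]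

/-- Roots of the two groups differ by at least a multiple of `x`, which dominates both roots and,
for `ε ≤ 2`, also `x^{-1+ε}`. All pairs thus satisfy a single separation condition. -/
theorem max_isBigO_of_sep {ε : ℝ} (hε : ε ≤ 2) {f g : ℝ → ℂ} (hf : f =O[atTop] fun x : ℝ => x)
    (hg : g =O[atTop] fun x : ℝ => x) (h : (fun x : ℝ => x) =O[atTop] fun x => f x - g x) :
    (fun x : ℝ => max (max ‖f x‖ ‖g x‖) (x ^ (-1 + ε))) =O[atTop] fun x => f x - g x := by
  refine IsBigO.trans ?_ h
  have h1 : (fun x : ℝ => x ^ (-1 + ε)) =O[atTop] fun x : ℝ => x := by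
    simpa using rpow_isBigO (show -1 + ε ≤ 1 by linarith)
  refine IsBigO.trans ?_ ((hf.norm_left.add hg.norm_left).add h1)
  refine IsBigO.of_bound 1 ?_
  filter_upwards [eventually_gt_atTop 0] with x hx
  have h2 := Real.rpow_pos_of_pos hx (-1 + ε)
  have h3 := norm_nonneg (f x)
  have h4 := norm_nonneg (g x)
  rw [Real.norm_of_nonneg (le_max_of_le_right h2.le), Real.norm_of_nonneg (by positivity), one_mul]
  exact max_le (max_le (by linarith) (by linarith)) (by linarith)

theorem max_isBigO_of_le {ε ε' : ℝ} (h : ε' ≤ ε) {f g d : ℝ → ℂ}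
    (hd : (fun x : ℝ => max (max ‖f x‖ ‖g x‖) (x ^ (-1 + ε))) =O[atTop] d) :
    (fun x : ℝ => max (max ‖f x‖ ‖g x‖) (x ^ (-1 + ε'))) =O[atTop] d := by
  refine IsBigO.trans (IsBigO.of_bound 1 ?_) hd
  filter_upwards [eventually_ge_atTop 1] with x hx
  have h0 : (0:ℝ) ≤ x := by linarith
  rw [Real.norm_of_nonneg (le_max_of_le_right (Real.rpow_nonneg h0 _)),
    Real.norm_of_nonneg (le_max_of_le_right (Real.rpow_nonneg h0 _)), one_mul]
  exact max_le_max le_rfl (Real.rpow_le_rpow_of_exponent_le hx (by linarith))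

/-- The data attached to a root of the Weyl symbol which is separated from the other ones. -/
theorem exists_rootData {ε : ℝ} {m : ℕ} {a : MvPolynomial (Fin 2) ℂ}
    (hdeg : a.totalDegree ≤ m) {ξ : ℕ → ℝ → ℂ}
    (hroots : ∀ᶠ x : ℝ in atTop, ∀ z : ℂ, MvPolynomial.eval ![(x : ℂ), z] (weylSymbol a) =
      ∏ j ∈ Finset.Icc 1 m, (z - ξ j x))
    {s : ℕ → ℝ → ℂ} (hs0 : ∀ n, Sym 0 (s n)) (hs : ∀ n, ∀ᶠ x in atTop,
      HasDerivAt (ev (coefX n (weylSymbol a))) (ev (coefX n (weylSymbol a)) x * (ix x * s n x)) x)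
    {j : ℕ} (hj : j ∈ Finset.Icc 1 m) (hsm : EvSmooth (ξ j))
    (hO : ξ j =O[atTop] fun x : ℝ => x)
    (hsep : ∀ l ∈ (Finset.Icc 1 m).erase j,
      (fun x : ℝ => max (max ‖ξ j x‖ ‖ξ l x‖) (x ^ (-1 + ε))) =O[atTop] fun x => ξ j x - ξ l x) :
    RootData ε m (fun n => ev (coefX n (weylSymbol a))) s (ξ j) := by
  have hp : ∀ n, m < n → coefX n (weylSymbol a) = 0 := fun n hn =>
    coefX_weylSymbol_eq_zero hdeg hn
  set M : ℕ → ℝ → ℝ := fun l x => max (max ‖ξ j x‖ ‖ξ l x‖) (x ^ (-1 + ε)) with hM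
  have hslope : ∀ᶠ x in atTop, ∑ n ∈ Finset.range m, (n + 1 : ℂ) *
      ev (coefX (n + 1) (weylSymbol a)) x * ξ j x ^ n =
      ∏ l ∈ (Finset.Icc 1 m).erase j, (ξ j x - ξ l x) := by
    filter_upwards [hroots] with x hx using slope_eq_prod hp hx hj
  obtain ⟨K, hK⟩ := (IsBigO.finsetProd hsep).bound
  have hlow : ∀ᶠ x in atTop, ∏ l ∈ (Finset.Icc 1 m).erase j, M l x ≤
      K * ‖∑ n ∈ Finset.range m, (n + 1 : ℂ) * ev (coefX (n + 1) (weylSymbol a)) x *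
        ξ j x ^ n‖ := by
    filter_upwards [hK, hslope] with x h1 h2
    rw [h2]
    exact (Real.le_norm_self _).trans h1
  have hMpos : ∀ᶠ x in atTop, 0 < ∏ l ∈ (Finset.Icc 1 m).erase j, M l x := by
    filter_upwards [eventually_gt_atTop 0] with x hx
    exact Finset.prod_pos fun l _ => lt_max_of_lt_right (Real.rpow_pos_of_pos hx _)
  have hne : ∀ᶠ x in atTop, (∑ n ∈ Finset.range m, (n + 1 : ℂ) *
      ev (coefX (n + 1) (weylSymbol a)) x * ξ j x ^ n) ≠ 0 := by
    filter_upwards [hlow, hMpos] with x h1 h2 h3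
    rw [h3, norm_zero, mul_zero] at h1
    linarith
  refine ⟨hsm, by simpa using hO, fun n _ => (sym_coefX_weylSymbol hdeg n).mono ?_, hs0,
    fun n _ => hs n, ?_, hne, ?_⟩
  · have : (0:ℝ) ≤ n := Nat.cast_nonneg _
    linarith
  · filter_upwards [hroots] with x hx
    rw [sum_coefX_mul_pow hp, hx, Finset.prod_eq_zero hj (sub_self _)]
  · intro r e hre
    refine IsBigO.of_bound ((m.choose (m - (r + 1 + e)) : ℝ) * K) ?_
    filter_upwards [hlow, hroots, hne, eventually_gt_atTop 0] with x h1 h2 h3 hx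
    set π := ∑ n ∈ Finset.range m, (n + 1 : ℂ) * ev (coefX (n + 1) (weylSymbol a)) x * ξ j x ^ n
    have hπ : 0 < ‖π‖ := norm_pos_iff.2 h3
    have hδ : 0 < x ^ (-1 + ε) := Real.rpow_pos_of_pos hx _
    have h4 : ev (coefX (r + 1 + e) (weylSymbol a)) x =
        sigma m (m - (r + 1 + e)) (fun i => ξ i x) := eval_coefX_eq_sigma h2 hre
    have h5 := norm_sigma_mul_pow_le (ζ := fun i => ξ i x) (M := fun l => M l x) hj hδ.le
      (fun l _ => (le_max_right _ _).trans (le_max_left _ _))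
      (fun l _ => (le_max_left _ _).trans (le_max_left _ _)) (fun l _ => le_max_right _ _) hre
    have h6 := h5.trans (mul_le_mul_of_nonneg_left h1 (Nat.cast_nonneg _))
    -- Each `x⁻¹` is `x^{-ε}` times the lower bound `x^{-1+ε}`; this is the source of the gain
    -- `x^{-εe}`.
    have h7 : x ^ (-(ε * e)) * ((x ^ (-1 + ε)) ^ e) = x⁻¹ ^ e := by
      rw [← Real.rpow_natCast (x ^ (-1 + ε)), ← Real.rpow_mul hx.le, ← Real.rpow_add hx,
        ← Real.rpow_natCast, ← Real.rpow_neg_one, ← Real.rpow_mul hx.le]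
      congr 1; ring
    rw [h4, norm_mul, norm_mul, norm_mul, norm_pow, norm_pow, norm_inv,
      Real.norm_of_nonneg (Real.rpow_pos_of_pos hx _).le, ← div_eq_mul_inv, div_le_iff₀ hπ]
    have h8 : ‖ix x‖ = x⁻¹ := by simp [ix, abs_of_pos hx]
    rw [h8, ← h7]
    have h9 := mul_le_mul_of_nonneg_left h6 (Real.rpow_pos_of_pos hx (-(ε * e))).le
    linarith

/-! ### Size of the difference between standard and Weyl coefficients -/

/-- Passing to index `n + γ` and differentiating `γ` times costs `2γ ≥ 2` orders. -/
theorem sym_of_mem_lowerSpan {m : ℕ} {C : ℕ → Polynomial ℂ}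
    (hC : ∀ n : ℕ, Sym ((m : ℝ) - n) (ev (C n))) {n : ℕ} {p : Polynomial ℂ} (hp : p ∈ lowerSpan C n) :
    Sym ((m : ℝ) - n - 2) (ev p) := by
  induction hp using Submodule.span_induction with
  | mem p hp =>
    obtain ⟨γ, hγ, rfl⟩ := hp
    refine (sym_ev_derivative (hC (n + γ)) γ).mono ?_
    have : (1:ℝ) ≤ γ := by exact_mod_cast hγ
    push_cast; linarith
  | zero => rw [ev_zero]; exact sym_zero _
  | add p q _ _ hp hq => rw [ev_add]; exact hp.add hq
  | smul k p _ hp => rw [ev_smul]; exact hp.const_mul k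

/-- A derivative of order `γ` of `C (n + γ)` is `x^{-γ}` times the coefficient itself, up to a
symbol of order `0`. One of these powers cancels the factor `cx`, and the rest is the ratio with `r
= n - l`, `e = γ - 1 + l`. -/
theorem RootData.sym_lowerSpan {ε : ℝ} (hε : 0 < ε) {m : ℕ} {C : ℕ → Polynomial ℂ}
    {s : ℕ → ℝ → ℂ} {z : ℝ → ℂ} (H : RootData ε m (fun n => ev (C n)) s z)
    (hC : ∀ n, m < n → C n = 0) {n l : ℕ} (hl : l ≤ n) {p : Polynomial ℂ}
    (hp : p ∈ lowerSpan C n) :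
    Sym (-(ε * l)) (ev p * z ^ (n - l) * (cx * ix ^ l) *
      (slope m (fun n => ev (C n)) z)⁻¹) := by
  induction hp using Submodule.span_induction with
  | mem p hp =>
    obtain ⟨γ, hγ, rfl⟩ := hp
    by_cases hm : m < n + γ
    · rw [hC _ hm, Polynomial.iterate_derivative_zero, ev_zero]
      simpa using sym_zero _
    · obtain ⟨t, ht, he⟩ := ev_derivative_eq (C (n + γ)) γ
      have h1 := H.sym_ratio (r := n - l) (e := γ - 1 + l) (by omega)
      have h2 : -(ε * (γ - 1 + l : ℕ)) ≤ -(ε * l) := by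
        have : 0 ≤ ε * (γ - 1 : ℕ) := by positivity
        push_cast; linarith
      refine (ht.mul_le h1 (r := -(ε * l)) (by linarith)).congr ?_
      filter_upwards [he, cx_mul_ix] with x h3 h4
      simp only [ratio, Pi.mul_apply, Pi.pow_apply, Pi.one_apply] at h3 h4 ⊢
      rw [h3, show n - l + 1 + (γ - 1 + l) = n + γ by omega]
      have h5 : ix x ^ γ = ix x ^ (γ - 1) * ix x := by
        rw [← pow_succ, Nat.sub_add_cancel hγ]
      rw [h5, pow_add]
      linear_combination (-(ix x ^ (γ - 1) * t x * ev (C (n + γ)) x * z x ^ (n - l) * ix x ^ l *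
        (slope m (fun n => ev (C n)) z)⁻¹ x)) * h4
  | zero => rw [ev_zero]; simpa using sym_zero _
  | add p q _ _ hp hq =>
    rw [ev_add]
    refine (hp.add hq).congr (Eventually.of_forall fun x => ?_)
    simp only [Pi.add_apply, Pi.mul_apply]; ring
  | smul k p _ hp =>
    rw [ev_smul]
    refine (hp.const_mul k).congr (Eventually.of_forall fun x => ?_)
    simp only [Pi.mul_apply]; ring

end WeylODE

end

/-! ### The factorization theorem -/

open WeylODE Filter Asymptotics

theorem proposition3p5 (r₁ r₂ : ℕ)
    -- `P` is the operator with standard symbol `a`, of degree at most `m = r₁ + r₂` in `(x, ξ)`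
    -- and monic of degree `m` in `ξ`; `p = weylSymbol a` is its Weyl symbol
    (a : MvPolynomial (Fin 2) ℂ) (hdeg : a.totalDegree ≤ r₁ + r₂)
    (hlead : a.coeff (Finsupp.single 1 (r₁ + r₂)) = 1)
    -- the roots `ξ_1, …, ξ_m` of `p`, real-analytic for `x` large
    (ξ : ℕ → ℝ → ℂ) (X₀ : ℝ)
    (han : ∀ j ∈ Finset.Icc 1 (r₁ + r₂), AnalyticOnNhd ℝ (ξ j) (Set.Ioi X₀))
    (hroots : ∀ x : ℝ, X₀ < x → ∀ z : ℂ,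
      MvPolynomial.eval ![(x : ℂ), z] (WeylODE.weylSymbol a) =
        ∏ j ∈ Finset.Icc 1 (r₁ + r₂), (z - ξ j x))
    (hO : ∀ j ∈ Finset.Icc 1 (r₁ + r₂), ξ j =O[Filter.atTop] fun x : ℝ => x)
    (hsep : ∀ j ∈ Finset.Icc 1 r₁, ∀ k ∈ Finset.Icc (r₁ + 1) (r₁ + r₂),
      (fun x : ℝ => x) =O[Filter.atTop] fun x : ℝ => ξ j x - ξ k x)
    (ε : ℝ) (hε : 0 < ε)
    (hsep' : ∀ j ∈ Finset.Icc (r₁ + 1) (r₁ + r₂), ∀ k ∈ Finset.Icc (r₁ + 1) (r₁ + r₂), j ≠ k →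
      (fun x : ℝ => max (max ‖ξ j x‖ ‖ξ k x‖) (x ^ (-1 + ε)))
        =O[Filter.atTop] fun x : ℝ => ξ j x - ξ k x) :
    ∃ η ρ : ℕ → ℝ → ℂ,
      (∀ x : ℝ, η 0 x = 1) ∧
      (∀ j ∈ Finset.Icc 1 r₁, WeylODE.IsSymbol (j : ℝ) (η j)) ∧
      (∀ j ∈ Finset.Icc (r₁ + 1) (r₁ + r₂), WeylODE.IsSymbol 1 (η j)) ∧
      (∀ j ∈ Finset.Icc 1 r₁,
        (fun x : ℝ => η j x - WeylODE.sigma r₁ j (fun i => ξ i x))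
          =O[Filter.atTop] fun x : ℝ => x ^ ((j : ℤ) - 2)) ∧
      (∀ j ∈ Finset.Icc (r₁ + 1) (r₁ + r₂),
        (fun x : ℝ => η j x - ξ j x) =O[Filter.atTop] fun x : ℝ => x ^ (-1 : ℤ)) ∧
      (∀ k ∈ Finset.range (r₁ + r₂ + 1),
        WeylODE.IsSymbol ((r₁ + r₂ : ℕ) : ℝ) (ρ k) ∧ WeylODE.RapidlyDecreasing (ρ k)) ∧
      ∃ X : ℝ, ∀ u : ℝ → ℂ, ContDiff ℝ (⊤ : ℕ∞) u → ∀ x : ℝ, X < x →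
        WeylODE.stdOp a u x =
          WeylODE.diffOp r₁ η (WeylODE.prodOp η r₁ r₂ u) x +
            WeylODE.diffOp (r₁ + r₂) ρ u x := by
  set m := r₁ + r₂ with hm
  -- Capping the exponent keeps `x^{-1+δ}` below `x`, so that pairs of roots from different groups
  -- satisfy the same separation condition.
  set δ := min ε 1 with hδ
  have hδ0 : 0 < δ := lt_min hε one_pos
  have hroots' : ∀ᶠ x : ℝ in atTop, ∀ z : ℂ, MvPolynomial.eval ![(x : ℂ), z] (weylSymbol a) =
      ∏ j ∈ Finset.Icc 1 m, (z - ξ j x) := by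
    filter_upwards [eventually_gt_atTop X₀] with x hx using hroots x hx
  have hsm : ∀ j ∈ Finset.Icc 1 m, EvSmooth (ξ j) := by
    intro j hj
    filter_upwards [eventually_gt_atTop X₀] with x hx
    exact (han j hj x hx).contDiffAt
  have hmem : ∀ {j}, j ∈ Finset.Icc (r₁ + 1) m → j ∈ Finset.Icc 1 m := by
    intro j hj
    rw [Finset.mem_Icc] at hj ⊢
    omega
  have hsepδ : ∀ j ∈ Finset.Icc (r₁ + 1) m, ∀ l ∈ (Finset.Icc 1 m).erase j,
      (fun x : ℝ => max (max ‖ξ j x‖ ‖ξ l x‖) (x ^ (-1 + δ)))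
        =O[atTop] fun x => ξ j x - ξ l x := by
    intro j hj l hl
    obtain ⟨hne, hl1⟩ := Finset.mem_erase.1 hl
    by_cases h : l ≤ r₁
    · refine max_isBigO_of_sep ((min_le_right _ _).trans (by norm_num)) (hO j (hmem hj)) (hO l hl1)
        ?_
      refine (hsep l (by rw [Finset.mem_Icc] at hl1 ⊢; omega) j hj).trans ?_
      refine IsBigO.of_bound 1 (Eventually.of_forall fun x => ?_)
      rw [one_mul, norm_sub_rev]
    · exact max_isBigO_of_le (min_le_left _ _)
        (hsep' j hj l (by rw [Finset.mem_Icc] at hl1 ⊢; omega) hne.symm)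
  have hlog : ∀ n, ∃ s, Sym 0 s ∧ ∀ᶠ x in atTop, HasDerivAt (ev (coefX n (weylSymbol a)))
      (ev (coefX n (weylSymbol a)) x * (ix x * s x)) x := by
    intro n
    obtain ⟨s, hs, he⟩ := ev_derivative_eq (coefX n (weylSymbol a)) 1
    refine ⟨s, hs, ?_⟩
    filter_upwards [he] with x hx
    refine (hasDerivAt_ev _ x).congr_deriv ?_
    simp only [Function.iterate_one, pow_one, Pi.mul_apply] at hx
    rw [hx]; ring
  choose s hs0 hs using hlog
  have H : ∀ j ∈ Finset.Icc (r₁ + 1) m,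
      RootData δ m (fun n => ev (coefX n (weylSymbol a))) s (ξ j) := fun j hj =>
    exists_rootData hdeg hroots' hs0 hs (hmem hj) (hsm j (hmem hj)) (hO j (hmem hj)) (hsepδ j hj)
  have hW : ∀ j, ∃ W, j ∈ Finset.Icc (r₁ + 1) m → Sym (-1) (W - ξ j) ∧
      Rapid (connOp W m (fun k => ev (coefX (m - k) a)) 1) := by
    intro j
    by_cases hj : j ∈ Finset.Icc (r₁ + 1) m
    -- The perturbation is the difference between standard and Weyl coefficients, so that the
    -- equation solved is the one of `P` itself.
    · obtain ⟨W, h1, h2⟩ := (H j hj).exists_riccati hδ0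
        (fun n => ev (coefX n a - coefX n (weylSymbol a))) fun n l hl _ =>
          (H j hj).sym_lowerSpan hδ0 (fun n hn => coefX_weylSymbol_eq_zero hdeg hn) hl
            (coefX_sub_weylSymbol_mem hdeg n)
      refine ⟨W, fun _ => ⟨h1, ?_⟩⟩
      simpa only [ev_sub, add_sub_cancel] using h2
    · exact ⟨0, fun h => absurd h hj⟩
  choose W hW using hW
  have hc : ∀ k ≤ m, Sym k (ev (coefX (m - k) a)) := by
    intro k hk
    have := sym_coefX hdeg (m - k)
    rwa [Nat.cast_sub hk, sub_sub_cancel] at this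
  have hσ : ∀ k ≤ m, (fun x => ev (coefX (m - k) a) x - sigma m k (fun i => ξ i x))
      =O[atTop] fun x : ℝ => x ^ ((k : ℝ) - 2) := by
    intro k hk
    -- The Weyl coefficients equal the symmetric functions exactly; the error `O(x^{k-2})` is the
    -- correction leading to the standard ones.
    have h1 := sym_of_mem_lowerSpan (sym_coefX_weylSymbol hdeg)
      (coefX_sub_weylSymbol_mem hdeg (m - k))
    rw [Nat.cast_sub hk, sub_sub_cancel, ev_sub] at h1
    refine h1.isBigO.congr' ?_ (EventuallyEq.refl _ _)
    filter_upwards [hroots'] with x hx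
    have h2 := eval_coefX_eq_sigma hx (Nat.sub_le m k)
    rw [Nat.sub_sub_self hk] at h2
    rw [Pi.sub_apply, ← h2]; rfl
  obtain ⟨η, ρ, e1, e2, e3, e4, X, e5⟩ := exists_factorization hδ0 r₁ ξ r₂
    (fun k => ev (coefX (m - k) a)) W (fun j hj => (H j hj).sym_root)
    (fun j hj k hk hne => sep_of_isBigO (H j hj).sym_root (H k hk).sym_root (H j hj).sym_rootLog
      (H k hk).sym_rootLog (H j hj).hasDerivAt_root (H k hk).hasDerivAt_root
      (hsepδ j hj k (Finset.mem_erase.2 ⟨hne.symm, hmem hk⟩)))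
    (by ext x; simp [coefX_top hdeg hlead, ev]) hc hσ (fun j hj => (hW j hj).1)
    (fun j hj => (hW j hj).2)
  have hg : ∀ k, ∃ g : ℝ → ℂ, k ≤ m → ρ k =ᶠ[atTop] g ∧ IsSymbol (m : ℝ) g ∧
      RapidlyDecreasing g := by
    intro k
    by_cases hk : k ≤ m
    · obtain ⟨g, h⟩ := (e4 k hk).exists_isSymbol m
      exact ⟨g, fun _ => h⟩
    · exact ⟨0, fun h => absurd h hk⟩
  choose g hg using hg
  have hev : ∀ᶠ x in atTop, ∀ k ∈ Finset.range (m + 1), ρ k x = g k x :=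
    (Finset.eventually_all _).2 fun k hk => (hg k (by rw [Finset.mem_range] at hk; omega)).1
  obtain ⟨X', hX'⟩ := eventually_atTop.1 hev
  refine ⟨η, g, fun x => by rw [e1]; rfl, fun j hj => (e2 j hj).1, fun j hj => (e3 j hj).1, ?_, ?_,
    fun k hk => (hg k (by rw [Finset.mem_range] at hk; omega)).2, max X X', ?_⟩
  · intro j hj
    refine (e2 j hj).2.congr' (EventuallyEq.refl _ _) (Eventually.of_forall fun x => ?_)
    simp only
    rw [← Real.rpow_intCast]; push_cast; rfl
  · intro j hj
    refine (e3 j hj).2.isBigO.congr' (EventuallyEq.refl _ _) (Eventually.of_forall fun x => ?_)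
    simp only
    rw [← Real.rpow_intCast]; push_cast; rfl
  · intro u hu x hx
    rw [stdOp_eq hdeg, e5 u hu x ((le_max_left _ _).trans_lt hx)]
    congr 1
    exact diffOp_congr fun k hk => hX' x ((le_max_right _ _).trans hx.le) k
      (by rw [Finset.mem_range]; omega)
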